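/- Let $n\ge 3$, let $M$ be a connected smooth $n$-dimensional manifold, let $\alpha=\sqrt{a_{ij}(x)y^iy^j}$ be a smooth (positive definite) Riemannian metric on $M$ and $\beta=b_i(x)y^i$ a smooth nowhere vanishing 1-form on $M$. Consider the Kropina metric $F=\alpha^2/\beta$ on the domain $\{(x,y)\in TM:\beta_x(y)>0\}$ (it is non-Riemannian since $n\geq 2$). For a Finsler metric $F$ with fundamental tensor $g_{ij}=\frac12[F^2]_{y^iy^j}$ and geodesic coefficients $G^i=\frac14 g^{il}\{[F^2]_{x^ky^l}y^k-[F^2]_{x^l}\}$, the Ricci curvature is $Ric=R^m{}_m$, where $$R^i{}_k=2\frac{\partial G^i}{\partial x^k}-y^m\frac{\partial^2G^i}{\partial x^m\partial y^k}+2G^m\frac{\partial^2G^i}{\partial y^m\partial y^k}-\frac{\partial G^i}{\partial y^m}\frac{\partial G^m}{\partial y^k};$$ $F$ is Einstein with Einstein scalar $\sigma=\sigma(x)$, a function on $M$, if $Ric=\sigma F^2$ on the domain of $F$, and Ricci-flat if $Ric=0$ there. (The same definitions apply to $\alpha$, whose domain is $y\ne0$.) With $b_{i|j}$ the covariant derivative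 with respect to the Levi-Civita connection of $\alpha$, put $r_{ij}=\frac12(b_{i|j}+b_{j|i})$, $s_{ij}=\frac12(b_{i|j}-b_{j|i})$, $b^i=a^{ij}b_j$, $s_j=b^is_{ij}$ and $b^2=b^ib_i$. The form $\beta$ is Killing if $r_{ij}=0$, constant Killing if in addition $b^2$ is constant on $M$, and closed if $s_{ij}=0$. Suppose that $s_i=0$, that $F$ is Einstein with Einstein scalar $\sigma$, and that $\alpha$ is Einstein with Einstein scalar $\lambda$. Then at least one of the following holds: 1. $\beta$ is a constant Killing form; in this case $\sigma=\frac14\lambda b^2\ge 0$ on $M$. 2. $\beta$ is closed; in this case $\sigma=0$, i.e. $F$ is Ricci-flat. -/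

import Mathlib

open scoped Manifold ContDiff

namespace KropinaGeometry

noncomputable section

/-- The model space `ℝⁿ` of the coordinate charts. -/
abbrev Coord (n : ℕ) : Type := EuclideanSpace ℝ (Fin n)

/-- The partial derivative `∂f/∂uⁱ` of a function of `n` real variables. -/
def partialDeriv {n : ℕ} (i : Fin n) (f : Coord n → ℝ) (u : Coord n) : ℝ :=
  fderiv ℝ f u (EuclideanSpace.single i 1)

section FinslerCurvature

/-! Curvature of a Finsler metric in local coordinates. Throughout, `F x y` is the value of the
metric at the point with coordinates `x` on the tangent vector with components `y`. -/

variable {n : ℕ}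

/-- The fundamental tensor `g_ij = ½ [F²]_{yⁱyʲ}`. -/
def fundamentalTensor (F : Coord n → Coord n → ℝ) (x y : Coord n) : Matrix (Fin n) (Fin n) ℝ :=
  Matrix.of fun i j =>
    (1 / 2) * partialDeriv i (fun y' => partialDeriv j (fun y'' => F x y'' ^ 2) y') y

/-- The geodesic coefficients `Gⁱ = ¼ gⁱˡ ([F²]_{xᵏyˡ} yᵏ - [F²]_{xˡ})`. -/
def geodesicCoeff (F : Coord n → Coord n → ℝ) (i : Fin n) (x y : Coord n) : ℝ :=
  (1 / 4) * ∑ l, (fundamentalTensor F x y)⁻¹ i l *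
    ((∑ k, partialDeriv k (fun x' => partialDeriv l (fun y' => F x' y' ^ 2) y) x * y k)
      - partialDeriv l (fun x' => F x' y ^ 2) x)

/-- The Riemann curvature
`Rⁱ_k = 2 ∂Gⁱ/∂xᵏ - yᵐ ∂²Gⁱ/∂xᵐ∂yᵏ + 2 Gᵐ ∂²Gⁱ/∂yᵐ∂yᵏ - ∂Gⁱ/∂yᵐ ∂Gᵐ/∂yᵏ`. -/
def riemannCurvature (F : Coord n → Coord n → ℝ) (i k : Fin n) (x y : Coord n) : ℝ :=
  2 * partialDeriv k (fun x' => geodesicCoeff F i x' y) x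
    - ∑ m, y m * partialDeriv m (fun x' => partialDeriv k (fun y' => geodesicCoeff F i x' y') y) x
    + 2 * ∑ m, geodesicCoeff F m x y *
        partialDeriv m (fun y' => partialDeriv k (fun y'' => geodesicCoeff F i x y'') y') y
    - ∑ m, partialDeriv m (fun y' => geodesicCoeff F i x y') y *
        partialDeriv k (fun y' => geodesicCoeff F m x y') y

/-- The Ricci curvature `Ric = Rᵐ_m`. -/
def ricciCurvature (F : Coord n → Coord n → ℝ) (x y : Coord n) : ℝ :=
  ∑ m, riemannCurvature F m m x y

end FinslerCurvature

section LocalTensors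

/-! Tensors of a Riemannian metric with components `a u i j` and a 1-form with components `b u i`
in local coordinates. -/

variable {n : ℕ}

/-- The Christoffel symbols `Γᵏ_ij` of the Levi-Civita connection of `a`. -/
def christoffel (a : Coord n → Matrix (Fin n) (Fin n) ℝ) (k i j : Fin n) (u : Coord n) : ℝ :=
  (1 / 2) * ∑ l, (a u)⁻¹ k l *
    (partialDeriv i (fun v => a v j l) u + partialDeriv j (fun v => a v i l) u
      - partialDeriv l (fun v => a v i j) u)

/-- The covariant derivative `b_{i|j} = ∂b_i/∂uʲ - Γᵏ_ij b_k`. -/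
def covDeriv (a : Coord n → Matrix (Fin n) (Fin n) ℝ) (b : Coord n → Fin n → ℝ)
    (i j : Fin n) (u : Coord n) : ℝ :=
  partialDeriv j (fun v => b v i) u - ∑ k, christoffel a k i j u * b u k

/-- `r_ij = ½ (b_{i|j} + b_{j|i})`. -/
def rTensor (a : Coord n → Matrix (Fin n) (Fin n) ℝ) (b : Coord n → Fin n → ℝ)
    (i j : Fin n) (u : Coord n) : ℝ :=
  (1 / 2) * (covDeriv a b i j u + covDeriv a b j i u)

/-- `s_ij = ½ (b_{i|j} - b_{j|i})`. -/
def sTensor (a : Coord n → Matrix (Fin n) (Fin n) ℝ) (b : Coord n → Fin n → ℝ)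
    (i j : Fin n) (u : Coord n) : ℝ :=
  (1 / 2) * (covDeriv a b i j u - covDeriv a b j i u)

/-- `bⁱ = aⁱʲ b_j`. -/
def bUp (a : Coord n → Matrix (Fin n) (Fin n) ℝ) (b : Coord n → Fin n → ℝ)
    (i : Fin n) (u : Coord n) : ℝ :=
  ∑ j, (a u)⁻¹ i j * b u j

/-- `s_j = bⁱ s_ij`. -/
def sForm (a : Coord n → Matrix (Fin n) (Fin n) ℝ) (b : Coord n → Fin n → ℝ)
    (j : Fin n) (u : Coord n) : ℝ :=
  ∑ i, bUp a b i u * sTensor a b i j u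

/-- `b² = bⁱ b_i`. -/
def bSq (a : Coord n → Matrix (Fin n) (Fin n) ℝ) (b : Coord n → Fin n → ℝ) (u : Coord n) : ℝ :=
  ∑ i, bUp a b i u * b u i

end LocalTensors

section Manifold

variable {n : ℕ} {M : Type*} [TopologicalSpace M] [ChartedSpace (Coord n) M]

/-- The tangent vector `yⁱ ∂/∂xⁱ` at the point with coordinates `u` in the chart `e`. -/
def coordVector (e : OpenPartialHomeomorph M (Coord n)) (u y : Coord n) :
    TangentSpace (𝓡 n) (e.symm u) :=
  mfderiv (𝓡 n) (𝓡 n) e.symm u y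

/-- A function on the tangent bundle, written in the coordinates of the chart `e`. -/
def inChart (F : (x : M) → TangentSpace (𝓡 n) x → ℝ) (e : OpenPartialHomeomorph M (Coord n))
    (u y : Coord n) : ℝ :=
  F (e.symm u) (coordVector e u y)

/-- `F`, considered on the domain `D x ⊆ T_x M`, is an Einstein metric with Einstein scalar `σ`:
`Ric = σ F²` in every smooth chart, where `σ` is a function of the point alone. -/
def IsEinsteinWith (F : (x : M) → TangentSpace (𝓡 n) x → ℝ)
    (D : (x : M) → Set (TangentSpace (𝓡 n) x)) (σ : M → ℝ) : Prop :=
  ∀ e ∈ IsManifold.maximalAtlas (𝓡 n) ∞ M, ∀ u ∈ e.target, ∀ y : Coord n,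
    coordVector e u y ∈ D (e.symm u) →
      ricciCurvature (inChart F e) u y = σ (e.symm u) * inChart F e u y ^ 2

/-- `F`, considered on the domain `D x ⊆ T_x M`, is Ricci flat: `Ric = 0`. -/
def IsRicciFlat (F : (x : M) → TangentSpace (𝓡 n) x → ℝ)
    (D : (x : M) → Set (TangentSpace (𝓡 n) x)) : Prop :=
  ∀ e ∈ IsManifold.maximalAtlas (𝓡 n) ∞ M, ∀ u ∈ e.target, ∀ y : Coord n,
    coordVector e u y ∈ D (e.symm u) → ricciCurvature (inChart F e) u y = 0

variable [IsManifold (𝓡 n) ∞ M]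

/-- The (smooth, positive definite) Riemannian metrics `(a_ij)` on `M`. -/
abbrev Metric (n : ℕ) (M : Type*) [TopologicalSpace M] [ChartedSpace (Coord n) M]
    [IsManifold (𝓡 n) ∞ M] : Type _ :=
  Bundle.ContMDiffRiemannianMetric (𝓡 n) ∞ (Coord n) (fun x : M => TangentSpace (𝓡 n) x)

/-- The field of covectors `β` is a smooth section of the cotangent bundle. -/
def IsSmoothOneForm (β : (x : M) → TangentSpace (𝓡 n) x →L[ℝ] ℝ) : Prop :=
  ContMDiff (𝓡 n) ((𝓡 n).prod 𝓘(ℝ, Coord n →L[ℝ] ℝ)) ∞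
    (fun x : M => (Bundle.TotalSpace.mk' (Coord n →L[ℝ] ℝ) x (β x) :
      Bundle.TotalSpace (Coord n →L[ℝ] ℝ)
        (fun x : M => TangentSpace (𝓡 n) x →L[ℝ] Bundle.Trivial M ℝ x)))

/-- `α = √(a_ij yⁱ yʲ)`. -/
def alpha (a : Metric n M) (x : M) (y : TangentSpace (𝓡 n) x) : ℝ :=
  Real.sqrt (a.inner x y y)

/-- The Kropina metric `F = α² / β`. -/
def kropina (a : Metric n M) (β : (x : M) → TangentSpace (𝓡 n) x →L[ℝ] ℝ) (x : M)
    (y : TangentSpace (𝓡 n) x) : ℝ :=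
  alpha a x y ^ 2 / β x y

/-- The domain `y ≠ 0` of `α` as a Finsler metric. -/
def slitDomain (n : ℕ) (M : Type*) [TopologicalSpace M] [ChartedSpace (Coord n) M] (x : M) :
    Set (TangentSpace (𝓡 n) x) :=
  {y | y ≠ 0}

/-- The domain `β > 0` of the Kropina metric. -/
def positiveDomain (β : (x : M) → TangentSpace (𝓡 n) x →L[ℝ] ℝ) (x : M) :
    Set (TangentSpace (𝓡 n) x) :=
  {y | 0 < β x y}

/-- The components `a_ij` of the Riemannian metric in the chart `e`. -/
def metricCoeff (a : Metric n M) (e : OpenPartialHomeomorph M (Coord n)) (u : Coord n) :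
    Matrix (Fin n) (Fin n) ℝ :=
  Matrix.of fun i j => a.inner (e.symm u) (coordVector e u (EuclideanSpace.single i 1))
    (coordVector e u (EuclideanSpace.single j 1))

/-- The components `b_i` of the 1-form in the chart `e`. -/
def formCoeff (β : (x : M) → TangentSpace (𝓡 n) x →L[ℝ] ℝ)
    (e : OpenPartialHomeomorph M (Coord n)) (u : Coord n) (i : Fin n) : ℝ :=
  β (e.symm u) (coordVector e u (EuclideanSpace.single i 1))

/-- The squared length `b² = aⁱʲ b_i b_j` of `β` at `x` with respect to `α`. It does not depend on
the coordinates; the preferred chart at `x` is used to compute it. -/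
def lengthSq (a : Metric n M) (β : (x : M) → TangentSpace (𝓡 n) x →L[ℝ] ℝ) (x : M) : ℝ :=
  bSq (metricCoeff a (chartAt (Coord n) x)) (formCoeff β (chartAt (Coord n) x))
    (chartAt (Coord n) x x)

/-- `s_i = 0`. -/
def SFormVanishes (a : Metric n M) (β : (x : M) → TangentSpace (𝓡 n) x →L[ℝ] ℝ) : Prop :=
  ∀ e ∈ IsManifold.maximalAtlas (𝓡 n) ∞ M, ∀ u ∈ e.target, ∀ i : Fin n,
    sForm (metricCoeff a e) (formCoeff β e) i u = 0

/-- `β` is a Killing form: `r_ij = 0`. -/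
def IsKilling (a : Metric n M) (β : (x : M) → TangentSpace (𝓡 n) x →L[ℝ] ℝ) : Prop :=
  ∀ e ∈ IsManifold.maximalAtlas (𝓡 n) ∞ M, ∀ u ∈ e.target, ∀ i j : Fin n,
    rTensor (metricCoeff a e) (formCoeff β e) i j u = 0

/-- `β` is a constant Killing form: a Killing form of constant length with respect to `α`. -/
def IsConstantKilling (a : Metric n M) (β : (x : M) → TangentSpace (𝓡 n) x →L[ℝ] ℝ) : Prop :=
  IsKilling a β ∧ ∃ k : ℝ, ∀ x : M, lengthSq a β x = k

/-- `β` is closed: `s_ij = 0`. -/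
def IsClosedForm (a : Metric n M) (β : (x : M) → TangentSpace (𝓡 n) x →L[ℝ] ℝ) : Prop :=
  ∀ e ∈ IsManifold.maximalAtlas (𝓡 n) ∞ M, ∀ u ∈ e.target, ∀ i j : Fin n,
    sTensor (metricCoeff a e) (formCoeff β e) i j u = 0

end Manifold

end

end KropinaGeometry

/-! Write `H = α²`, `B = b²`. When `s_j = 0`, the spray of `α²/β` is that of `α` plus a field `Q`
whose only denominators are `β` and `B`, plus a multiple of `y` by the factor `-β r₀₀ / (B H)`
(`fund_G`). The projective change formula then gives `H² Ric = 3(n-1)(β r₀₀/B)² + H z`, with `z`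
polynomial in `y` up to powers of `β` (`exists_H_sq_mul_ricci_G`). If `F` is Einstein, `H² Ric = σ
H⁴/β²`, so `H` divides the square of `r₀₀`. On a line `y = b + s v` with `v` orthogonal to `b` the
form `β` is constant and `H = B + s²|v|²` has no real root, so `r₀₀` is proportional to `H` there.
Hence `r_ij = c a_ij` (`rTensor_eq`).

Put `κ = c/B`. The Ricci curvature now has an explicit form (`ricci_G_of_conformal`), and both
Einstein conditions together give a polynomial identity in `y`. With `t = sⁱ_m sᵐ_i`, comparing
powers of `s` along `y = v + s b` yields (`einstein_consequences`) `σ = -t/4`, `∂_k κ = -κ² b_k`,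
`-t = (λ + (n-1) κ c) B`.

Since `dκ` is parallel to `β`, taking the exterior derivative of `dκ = -κ² β` gives `κ² s_ij = 0`.
The same Riccati equation shows that `κ` vanishes near each of its zeros. As `∂_k B = 2 c b_k` and
`β` has no zeros, `κ = 0` at a point exactly when `B` is constant near it (`kappa_eq_zero_iff`), a
condition independent of charts. So the zero set of `κ` is open and closed, and `M` is connected. If
`κ` vanishes everywhere, then `r_ij = 0` and `B` is constant; if nowhere, then `s_ij = 0`.

A Killing `β` has `κ = 0`, so `σ = -t/4 = λB/4`, which is nonnegative because `t ≤ 0` for a skew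
tensor. A closed `β` has `t = 0`, so `σ = 0`.

The calculations take place in a commutative ring with derivations `∂/∂xⁱ`, `∂/∂yⁱ`; smooth
functions on the domain of `F` in a chart form such a ring. -/

namespace KropinaGeometry

/-! ### Ricci curvature of a spray in an abstract differential ring. -/

section SprayAlgebra

/-- A ring of functions of `(x, y)` with the partial derivatives `X i = ∂/∂xⁱ` and
`V i = ∂/∂yⁱ`, and the subring of the functions of `x` alone. -/
structure PhaseRing (ι R : Type*) [DecidableEq ι] [CommRing R] [Algebra ℝ R] where
  X : ι → Derivation ℝ R R
  V : ι → Derivation ℝ R R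
  y : ι → R
  base : Subalgebra ℝ R
  half : R
  two_half : 2 * half = 1
  V_y : ∀ i j, V i (y j) = if i = j then 1 else 0
  X_y : ∀ i j, X i (y j) = 0
  VV : ∀ i j f, V i (V j f) = V j (V i f)
  V_base : ∀ i, ∀ f ∈ base, V i f = 0
  X_base : ∀ i, ∀ f ∈ base, X i f ∈ base

variable {ι R : Type*} [DecidableEq ι] [CommRing R] [Algebra ℝ R]

theorem deriv_mul' (D : Derivation ℝ R R) (f g : R) : D (f * g) = f * D g + g * D f := by
  simp

theorem deriv_inv' (D : Derivation ℝ R R) {f g : R} (h : f * g = 1) : D g = -g ^ 2 * D f := by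
  have := D.leibniz_of_mul_eq_one (a := g) (b := f) (by rw [mul_comm]; exact h)
  simpa using this

namespace PhaseRing

variable (P : PhaseRing ι R)

theorem D_half (D : Derivation ℝ R R) : D P.half = 0 := by
  have := deriv_inv' D P.two_half
  have h2 : D (2 : R) = 0 := by exact_mod_cast D.map_natCast 2
  rw [this, h2, mul_zero]

variable [Fintype ι]

/-- The Ricci curvature of the spray with coefficients `G`. -/
def ricci (G : ι → R) : R :=
  ∑ m, (2 * P.X m (G m) - ∑ k, P.y k * P.X k (P.V m (G m))
    + 2 * ∑ k, G k * P.V k (P.V m (G m)) - ∑ k, P.V k (G m) * P.V m (G k))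

/-- The vertical divergence. -/
def vdiv (Q : ι → R) : R := ∑ m, P.V m (Q m)

/-- The Euler field. -/
def euler (f : R) : R := ∑ k, P.y k * P.V k f

/-- The commutator of a vertical derivative with the Euler field: it expresses that `V m` lowers the
degree of homogeneity by one. -/
theorem euler_V (m : ι) (f : R) : P.V m (P.euler f) = P.V m f + P.euler (P.V m f) := by
  simp only [euler, map_sum, deriv_mul', P.V_y, Finset.sum_add_distrib, P.VV m]
  simp [add_comm]

theorem ricci_eq (G : ι → R) :
    P.ricci G = 2 * ∑ m, P.X m (G m) - ∑ k, P.y k * P.X k (P.vdiv G)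
      + 2 * ∑ k, G k * P.V k (P.vdiv G) - ∑ m, ∑ k, P.V k (G m) * P.V m (G k) := by
  simp only [ricci, vdiv, map_sum, Finset.sum_add_distrib, Finset.sum_sub_distrib,
    Finset.mul_sum]
  congr 1
  congr 1
  · congr 1
    rw [Finset.sum_comm]
  · rw [Finset.sum_comm]

/-- The effect of a projective change `Gⁱ ↦ Gⁱ + P yⁱ` on the Ricci curvature. -/
theorem ricci_projective (G : ι → R) (p : R) (hG : ∀ m, P.euler (G m) = 2 * G m)
    (hp : P.euler p = p) :
    P.ricci (fun m => G m + p * P.y m) = P.ricci G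
      + (Fintype.card ι - 1) * (p ^ 2 - ∑ k, P.y k * P.X k p + 2 * ∑ k, G k * P.V k p) := by
  -- `G` has degree 2 in `y`, so its vertical derivatives have degree 1.
  have hVG : ∀ m k, P.euler (P.V k (G m)) = P.V k (G m) := by
    intro m k
    have h := P.euler_V k (G m)
    have h2 : P.V k (2 : R) = 0 := by exact_mod_cast (P.V k).map_natCast 2
    rw [hG, deriv_mul', h2] at h
    linear_combination -h
  have hdivG : P.euler (P.vdiv G) = P.vdiv G := by
    simp only [euler, vdiv, map_sum, Finset.mul_sum]
    rw [Finset.sum_comm]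
    exact Finset.sum_congr rfl fun m _ => hVG m m
  have hVp : ∀ k m, P.V k (p * P.y m) = (if k = m then p else 0) + P.y m * P.V k p := by
    intro k m; rw [deriv_mul', P.V_y]; split_ifs <;> simp
  have hdiv : P.vdiv (fun m => G m + p * P.y m) = P.vdiv G + (Fintype.card ι + 1) * p := by
    simp only [vdiv, map_add, hVp, Finset.sum_add_distrib]
    have : ∑ i, P.y i * P.V i p = p := hp
    simp [this]; ring
  have hD : ∀ D : Derivation ℝ R R, D (Fintype.card ι * p) = Fintype.card ι * D p := by
    intro D; rw [deriv_mul']; simp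
  -- The derivative matrix gains `p δ + y ⊗ ∂p`. The trace of the square of this increment is `n p²
  -- + 2 p² + p²`, by homogeneity of `p`; the cross terms with `∂G` reduce by homogeneity of `G`.
  have hquad : ∑ m, ∑ k, P.V k (G m + p * P.y m) * P.V m (G k + p * P.y k)
      = ∑ m, ∑ k, P.V k (G m) * P.V m (G k) + 2 * (p * P.vdiv G + 2 * ∑ k, G k * P.V k p)
        + (Fintype.card ι + 3) * p ^ 2 := by
    have e1 : ∑ m, ∑ k, P.V k (G m) * (P.y k * P.V m p) = 2 * ∑ k, G k * P.V k p := by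
      rw [Finset.mul_sum]
      refine Finset.sum_congr rfl fun m _ => ?_
      have := hG m
      unfold euler at this
      rw [← mul_assoc, ← this, Finset.sum_mul]
      exact Finset.sum_congr rfl fun k _ => by ring
    have e2 : ∑ m, ∑ k, (P.y m * P.V k p) * (P.y k * P.V m p) = p ^ 2 := by
      have h : p ^ 2 = P.euler p * P.euler p := by rw [hp]; ring
      rw [h, euler, Finset.sum_mul_sum]
      exact Finset.sum_congr rfl fun k _ => Finset.sum_congr rfl fun m _ => by ring
    have e3 : ∑ m, ∑ k, (P.y m * P.V k p) * P.V m (G k) = 2 * ∑ k, G k * P.V k p := by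
      rw [Finset.sum_comm, ← e1]
      exact Finset.sum_congr rfl fun k _ => Finset.sum_congr rfl fun m _ => by ring
    have e4 : ∑ i, P.y i * P.V i p = p := hp
    have e5 : ∑ i, p * (P.y i * P.V i p) = p * p := by rw [← Finset.mul_sum, e4]
    have e6 : ∑ i, p * P.V i (G i) = p * P.vdiv G := by rw [← Finset.mul_sum]; rfl
    simp only [map_add, hVp, add_mul, mul_add, Finset.sum_add_distrib, e1, e2, e3]
    simp only [mul_ite, ite_mul, mul_zero, zero_mul, Finset.sum_ite_eq, Finset.sum_ite_eq',
      Finset.mem_univ, if_true]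
    have e5' : ∑ i, P.y i * P.V i p * p = p * p := by
      rw [← e5]; exact Finset.sum_congr rfl fun k _ => by ring
    have e6' : ∑ i, P.V i (G i) * p = p * P.vdiv G := by
      rw [← e6]; exact Finset.sum_congr rfl fun k _ => by ring
    rw [e5, e5', e6, e6']
    simp
    ring
  have hx : ∑ m, P.X m (G m + p * P.y m) = ∑ m, P.X m (G m) + ∑ k, P.y k * P.X k p := by
    simp [P.X_y, Finset.sum_add_distrib]
  rw [ricci_eq, ricci_eq, hdiv, hquad, hx]
  simp only [map_add, mul_add, add_mul, one_mul, hD, Finset.sum_add_distrib]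
  have e7 : ∑ k, P.y k * (Fintype.card ι * P.X k p) = Fintype.card ι * ∑ k, P.y k * P.X k p := by
    rw [Finset.mul_sum]; exact Finset.sum_congr rfl fun k _ => by ring
  have e8 : ∑ k, G k * (Fintype.card ι * P.V k p) = Fintype.card ι * ∑ k, G k * P.V k p := by
    rw [Finset.mul_sum]; exact Finset.sum_congr rfl fun k _ => by ring
  have e12 : ∑ k, p * (P.y k * P.V k p) = p * p := by rw [← Finset.mul_sum]; exact congrArg _ hp
  have e9 : ∑ k, p * P.y k * (Fintype.card ι * P.V k p) = Fintype.card ι * (p * p) := by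
    rw [← e12, Finset.mul_sum]
    exact Finset.sum_congr rfl fun k _ => by ring
  have e10 : ∑ k, p * P.y k * P.V k p = p * p := by
    rw [← e12]
    exact Finset.sum_congr rfl fun k _ => by ring
  have e11 : ∑ k, p * P.y k * P.V k (P.vdiv G) = p * P.vdiv G := by
    nth_rw 2 [← hdivG]
    simp only [euler, Finset.mul_sum]; exact Finset.sum_congr rfl fun k _ => by ring
  simp only [e7, e8, e9, e10, e11]
  ring

/-- The Ricci curvature of a sum of two sprays. -/
theorem ricci_add (G Q : ι → R) :
    P.ricci (fun m => G m + Q m) = P.ricci G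
      + 2 * (∑ m, P.X m (Q m) + ∑ k, Q k * P.V k (P.vdiv G) - ∑ m, ∑ k, P.V m (G k) * P.V k (Q m))
      - (∑ k, P.y k * P.X k (P.vdiv Q) - 2 * ∑ k, G k * P.V k (P.vdiv Q))
      + 2 * ∑ k, Q k * P.V k (P.vdiv Q) - ∑ m, ∑ k, P.V k (Q m) * P.V m (Q k) := by
  have hdiv : P.vdiv (fun m => G m + Q m) = P.vdiv G + P.vdiv Q := by
    simp [vdiv, Finset.sum_add_distrib]
  have e : ∑ m, ∑ k, P.V k (G m) * P.V m (Q k) = ∑ m, ∑ k, P.V m (G k) * P.V k (Q m) :=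
    Finset.sum_comm
  have e' : ∑ m, ∑ k, P.V k (Q m) * P.V m (G k) = ∑ m, ∑ k, P.V m (G k) * P.V k (Q m) :=
    Finset.sum_congr rfl fun k _ => Finset.sum_congr rfl fun m _ => by ring
  rw [ricci_eq, ricci_eq, hdiv]
  simp only [map_add, mul_add, add_mul, Finset.sum_add_distrib, e, e']
  ring

end PhaseRing

end SprayAlgebra

/-! ### The geodesic spray of the Kropina metric when `s_j = 0`. -/

section KropinaSpray

/-- The algebraic data of a Riemannian metric `a` and a 1-form `b` with `s_j = 0` in a ring of
functions of `(x, y)`, in which `β`, `α²` and `b²` are invertible. -/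
structure KropinaRing (ι R : Type*) [Fintype ι] [DecidableEq ι] [CommRing R] [Algebra ℝ R]
    extends PhaseRing ι R where
  a : ι → ι → R
  A : ι → ι → R
  Γ : ι → ι → ι → R
  b : ι → R
  bu : ι → R
  r : ι → ι → R
  s : ι → ι → R
  su : ι → ι → R
  βinv : R
  Hinv : R
  Binv : R
  a_mem : ∀ i j, a i j ∈ base
  Γ_mem : ∀ i j k, Γ i j k ∈ base
  b_mem : ∀ i, b i ∈ base
  bu_mem : ∀ i, bu i ∈ base
  r_mem : ∀ i j, r i j ∈ base
  s_mem : ∀ i j, s i j ∈ base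
  su_mem : ∀ i j, su i j ∈ base
  Binv_mem : Binv ∈ base
  a_symm : ∀ i j, a i j = a j i
  A_a : ∀ l k, ∑ i, A l i * a i k = if l = k then 1 else 0
  Γ_symm : ∀ k i j, Γ k i j = Γ k j i
  X_a : ∀ k i j, X k (a i j) = ∑ m, (Γ m k i * a m j + Γ m k j * a i m)
  X_b : ∀ i j, X j (b i) = ∑ k, Γ k i j * b k + (r i j + s i j)
  a_bu : ∀ i, ∑ j, a i j * bu j = b i
  a_su : ∀ i j, ∑ k, a i k * su k j = s i j
  su_trace : ∑ m, su m m = 0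
  r_symm : ∀ i j, r i j = r j i
  s_anti : ∀ i j, s i j = - s j i
  s_form : ∀ j, ∑ i, bu i * s i j = 0
  β_inv : (∑ i, b i * y i) * βinv = 1
  H_inv : (∑ i, (∑ j, a i j * y j) * y i) * Hinv = 1
  B_inv : (∑ i, b i * bu i) * Binv = 1

variable {ι R : Type*} [CommRing R] [Algebra ℝ R]

theorem deriv_two' (D : Derivation ℝ R R) : D (2 : R) = 0 := by
  exact_mod_cast D.map_natCast 2

theorem deriv_four' (D : Derivation ℝ R R) : D (4 : R) = 0 := by
  exact_mod_cast D.map_natCast 4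

theorem sum_comm_congr {ι R : Type*} [Fintype ι] [CommRing R] {f g : ι → ι → R} (h : ∀ i j, f i j = g j i) :
    ∑ i, ∑ j, f i j = ∑ i, ∑ j, g i j := by
  rw [Finset.sum_comm]
  exact Finset.sum_congr rfl fun j _ => Finset.sum_congr rfl fun i _ => h i j

variable [Fintype ι] [DecidableEq ι]

namespace KropinaRing

variable (K : KropinaRing ι R)

/-- `y_i = a_ij yʲ`. -/
def yl (i : ι) : R := ∑ j, K.a i j * K.y j
/-- `α²`. -/
def H : R := ∑ i, K.yl i * K.y i
/-- `β`. -/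
def β : R := ∑ i, K.b i * K.y i
/-- `b²`. -/
def B : R := ∑ i, K.b i * K.bu i
/-- The connection coefficients `Γᵐ_kj yʲ`. -/
def N (m k : ι) : R := ∑ j, K.Γ m k j * K.y j
/-- `Γᵐ_jk yʲ yᵏ`. -/
def g2 (m : ι) : R := ∑ k, K.N m k * K.y k
/-- `sᵐ_0`. -/
def su0 (m : ι) : R := ∑ j, K.su m j * K.y j
/-- `s_m0`. -/
def s0 (m : ι) : R := ∑ j, K.s m j * K.y j
/-- `r_m0`. -/
def r0 (m : ι) : R := ∑ j, K.r m j * K.y j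
/-- `r_00`. -/
def r00 : R := ∑ m, K.r0 m * K.y m
/-- The part of the geodesic coefficients of `α² / β` without the projective term. -/
def Q (m : ι) : R := -(K.half * (K.H * K.βinv * K.su0 m)) + K.r00 * K.Binv * (K.half * K.bu m)
/-- The geodesic coefficients of `α² / β`. -/
def G (m : ι) : R := (K.half * K.g2 m + K.Q m) + (-(K.β * K.r00 * K.Binv * K.Hinv)) * K.y m

theorem V_lin (c : ι → R) (hc : ∀ i, c i ∈ K.base) (k : ι) : K.V k (∑ i, c i * K.y i) = c k := by
  simp [K.V_base _ _ (hc _), K.V_y]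

theorem V_yl (k i : ι) : K.V k (K.yl i) = K.a i k := K.V_lin _ (K.a_mem i) k

theorem V_β (k : ι) : K.V k K.β = K.b k := K.V_lin _ K.b_mem k

theorem V_su0 (k m : ι) : K.V k (K.su0 m) = K.su m k := K.V_lin _ (K.su_mem m) k

theorem V_r0 (k m : ι) : K.V k (K.r0 m) = K.r m k := K.V_lin _ (K.r_mem m) k

theorem V_N (k m l : ι) : K.V k (K.N m l) = K.Γ m l k := K.V_lin _ (K.Γ_mem m l) k

theorem V_H (k : ι) : K.V k K.H = 2 * K.yl k := by
  simp only [H, map_sum, deriv_mul', K.V_y, K.V_yl, Finset.sum_add_distrib]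
  have : ∑ x, K.y x * K.a x k = K.yl k :=
    Finset.sum_congr rfl fun j _ => by rw [K.a_symm]; ring
  rw [this]
  simp; ring

theorem V_r00 (k : ι) : K.V k K.r00 = 2 * K.r0 k := by
  simp only [r00, map_sum, deriv_mul', K.V_y, K.V_r0, Finset.sum_add_distrib]
  have : ∑ x, K.y x * K.r x k = K.r0 k :=
    Finset.sum_congr rfl fun j _ => by rw [K.r_symm]; ring
  rw [this]
  simp; ring

theorem V_g2 (k m : ι) : K.V k (K.g2 m) = 2 * K.N m k := by
  simp only [g2, map_sum, deriv_mul', K.V_y, K.V_N, Finset.sum_add_distrib]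
  have : ∑ x, K.y x * K.Γ m x k = K.N m k :=
    Finset.sum_congr rfl fun j _ => by rw [K.Γ_symm]; ring
  rw [this]
  simp; ring

theorem X_yl (k i : ι) :
    K.X k (K.yl i) = ∑ m, K.Γ m k i * K.yl m + ∑ m, K.a i m * K.N m k := by
  simp only [yl, N, map_sum, deriv_mul', K.X_y, K.X_a, mul_zero, zero_add, Finset.mul_sum,
    Finset.sum_add_distrib, mul_add]
  congr 1 <;> exact sum_comm_congr fun i j => by ring

theorem X_H (k : ι) : K.X k K.H = 2 * ∑ m, K.N m k * K.yl m := by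
  simp only [H, map_sum, deriv_mul', K.X_y, K.X_yl, mul_zero, zero_add, mul_add,
    Finset.sum_add_distrib]
  have h1 : ∑ i, K.y i * ∑ m, K.Γ m k i * K.yl m = ∑ m, K.N m k * K.yl m := by
    simp only [N, Finset.mul_sum, Finset.sum_mul]
    exact sum_comm_congr fun i j => by ring
  have h2 : ∑ i, K.y i * ∑ m, K.a i m * K.N m k = ∑ m, K.N m k * K.yl m := by
    simp only [yl, Finset.mul_sum]
    exact sum_comm_congr fun i j => by rw [K.a_symm]; ring
  rw [h1, h2]; ring

theorem X_β (k : ι) :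
    K.X k K.β = ∑ m, K.N m k * K.b m + (K.r0 k - K.s0 k) := by
  simp only [β, map_sum, deriv_mul', K.X_y, K.X_b, mul_zero, zero_add, mul_add,
    Finset.sum_add_distrib, r0, s0, N, Finset.mul_sum, Finset.sum_mul, ← Finset.sum_sub_distrib]
  congr 1
  · exact sum_comm_congr fun i j => by rw [K.Γ_symm]; ring
  · rw [← Finset.sum_add_distrib]
    exact Finset.sum_congr rfl fun i _ => by rw [K.r_symm, K.s_anti]; ring

theorem β_βinv : K.β * K.βinv = 1 := K.β_inv
theorem H_Hinv : K.H * K.Hinv = 1 := K.H_inv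
theorem B_Binv : K.B * K.Binv = 1 := K.B_inv

theorem D_βinv (D : Derivation ℝ R R) : D K.βinv = -K.βinv ^ 2 * D K.β := deriv_inv' D K.β_βinv

theorem a_su0 (l : ι) : ∑ m, K.a l m * K.su0 m = K.s0 l := by
  simp only [su0, s0, ← K.a_su, Finset.mul_sum, Finset.sum_mul]
  exact sum_comm_congr fun i j => by ring

theorem s0_y : ∑ m, K.s0 m * K.y m = 0 := by
  have h : ∑ m, K.s0 m * K.y m = -∑ m, K.s0 m * K.y m := by
    simp only [s0, Finset.sum_mul, ← Finset.sum_neg_distrib]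
    exact sum_comm_congr fun i j => by rw [K.s_anti]; ring
  have h2 : 2 * ∑ m, K.s0 m * K.y m = 0 := by linear_combination h
  linear_combination K.half * h2 - (∑ m, K.s0 m * K.y m) * K.two_half

/-- Moves the metric from `y` to `u`, so that contractions with `y_m` follow from the index-lowering
relations for `su` and `bu`. -/
theorem yl_dot (u : ι → R) : ∑ m, K.yl m * u m = ∑ m, (∑ l, K.a m l * u l) * K.y m := by
  simp only [yl, Finset.sum_mul]
  exact sum_comm_congr fun i j => by rw [K.a_symm]; ring

theorem yl_su0 : ∑ m, K.yl m * K.su0 m = 0 := by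
  rw [yl_dot]; simp only [a_su0, s0_y]

theorem yl_bu : ∑ m, K.yl m * K.bu m = K.β := by
  rw [yl_dot]; simp only [a_bu]; rfl

theorem b_dot (u : ι → R) : ∑ m, K.b m * u m = ∑ l, K.bu l * ∑ m, K.a l m * u m := by
  simp only [← K.a_bu, Finset.sum_mul, Finset.mul_sum]
  exact sum_comm_congr fun i j => by rw [K.a_symm]; ring

theorem b_su (j : ι) : ∑ m, K.b m * K.su m j = 0 := by
  rw [b_dot]; simp only [a_su, s_form]

theorem bu_s0 : ∑ m, K.bu m * K.s0 m = 0 := by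
  simp only [s0, Finset.mul_sum]
  rw [Finset.sum_comm]
  simp only [← mul_assoc, ← Finset.sum_mul, s_form, zero_mul, Finset.sum_const_zero]

theorem b_su0 : ∑ m, K.b m * K.su0 m = 0 := by
  rw [b_dot]; simp only [a_su0, bu_s0]

theorem yl_su (j : ι) : ∑ m, K.yl m * K.su m j = -K.s0 j := by
  rw [yl_dot]; simp only [a_su, s0, ← Finset.sum_neg_distrib]
  exact Finset.sum_congr rfl fun i _ => by rw [K.s_anti]; ring

/-- `F² = (α² / β)²`. -/
def E : R := (K.H * K.βinv) ^ 2

theorem D_E (D : Derivation ℝ R R) :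
    D K.E = 2 * (K.H * K.βinv ^ 2) * D K.H - 2 * (K.H ^ 2 * K.βinv ^ 3) * D K.β := by
  have : K.E = (K.H * K.βinv) * (K.H * K.βinv) := by rw [E, sq]
  rw [this, deriv_mul', deriv_mul', D_βinv]; ring

theorem V_E (l : ι) : K.V l K.E = 4 * (K.H * K.βinv ^ 2 * K.yl l)
    - 2 * (K.H ^ 2 * K.βinv ^ 3 * K.b l) := by
  rw [D_E, V_H, V_β]; ring

theorem D_V_E (D : Derivation ℝ R R) (l : ι) : D (K.V l K.E) =
    4 * K.H * K.βinv ^ 2 * D (K.yl l)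
      + (4 * K.βinv ^ 2 * K.yl l - 4 * K.H * K.βinv ^ 3 * K.b l) * D K.H
      + (6 * K.H ^ 2 * K.βinv ^ 4 * K.b l - 8 * K.H * K.βinv ^ 3 * K.yl l) * D K.β
      - 2 * K.H ^ 2 * K.βinv ^ 3 * D (K.b l) := by
  rw [V_E]
  simp only [map_sub, deriv_mul', deriv_two', deriv_four', Derivation.leibniz_pow, D_βinv]
  simp only [nsmul_eq_mul, smul_eq_mul]
  push_cast
  ring

theorem half_V_V_E (l m : ι) : K.half * K.V l (K.V m K.E) =
    2 * K.H * K.βinv ^ 2 * K.a l m + 4 * K.βinv ^ 2 * K.yl l * K.yl m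
      - 4 * K.H * K.βinv ^ 3 * (K.yl l * K.b m + K.yl m * K.b l)
      + 3 * K.H ^ 2 * K.βinv ^ 4 * K.b l * K.b m := by
  rw [D_V_E, V_yl, V_H, V_β, K.V_base _ _ (K.b_mem _), K.a_symm l m]
  linear_combination (2 * K.H * K.βinv ^ 2 * K.a m l + 4 * K.βinv ^ 2 * K.yl l * K.yl m
      - 4 * K.H * K.βinv ^ 3 * (K.yl l * K.b m + K.yl m * K.b l)
      + 3 * K.H ^ 2 * K.βinv ^ 4 * K.b l * K.b m) * K.two_half

/-- The fundamental tensor is a multiple of `a_lm` plus terms in `y_l`, `b_l`, so applying it to `u`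
needs only three contractions of `u`. -/
theorem fund_dot (l : ι) (u : ι → R) : ∑ m, (K.half * K.V l (K.V m K.E)) * u m =
    2 * K.H * K.βinv ^ 2 * (∑ m, K.a l m * u m)
      + (4 * K.βinv ^ 2 * K.yl l - 4 * K.H * K.βinv ^ 3 * K.b l) * (∑ m, K.yl m * u m)
      + (3 * K.H ^ 2 * K.βinv ^ 4 * K.b l - 4 * K.H * K.βinv ^ 3 * K.yl l)
        * (∑ m, K.b m * u m) := by
  simp only [half_V_V_E, Finset.mul_sum, ← Finset.sum_add_distrib]
  exact Finset.sum_congr rfl fun m _ => by ring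

theorem y_X_H : ∑ k, K.y k * K.X k K.H = 2 * ∑ m, K.yl m * K.g2 m := by
  simp only [X_H, g2, Finset.mul_sum]
  exact sum_comm_congr fun i j => by ring

theorem y_X_β : ∑ k, K.y k * K.X k K.β = ∑ m, K.b m * K.g2 m + K.r00 := by
  have h : ∑ k, K.y k * (K.r0 k - K.s0 k) = K.r00 := by
    have := K.s0_y
    rw [r00, ← sub_zero (∑ m, K.r0 m * K.y m), ← this, ← Finset.sum_sub_distrib]
    exact Finset.sum_congr rfl fun m _ => by ring
  simp only [X_β, mul_add, Finset.sum_add_distrib, h]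
  congr 1
  simp only [g2, Finset.mul_sum]
  exact sum_comm_congr fun i j => by ring

theorem y_X_yl (l : ι) : ∑ k, K.y k * K.X k (K.yl l) =
    ∑ m, K.N m l * K.yl m + ∑ m, K.a l m * K.g2 m := by
  simp only [X_yl, N, g2, mul_add, Finset.sum_add_distrib, Finset.mul_sum, Finset.sum_mul]
  congr 1
  · exact sum_comm_congr fun i j => by rw [K.Γ_symm]; ring
  · rw [Finset.sum_comm]
    exact Finset.sum_congr rfl fun i _ => Finset.sum_congr rfl fun j _ =>
      Finset.sum_congr rfl fun k _ => by ring

theorem y_X_b (l : ι) : ∑ k, K.y k * K.X k (K.b l) =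
    ∑ m, K.N m l * K.b m + (K.r0 l + K.s0 l) := by
  simp only [X_b, N, r0, s0, mul_add, Finset.sum_add_distrib, Finset.mul_sum, Finset.sum_mul]
  congr 1
  · exact sum_comm_congr fun i j => by ring
  · congr 1 <;> exact Finset.sum_congr rfl fun i _ => by ring

theorem dot_G (w : ι → R) : ∑ m, w m * (4 * K.G m) = 2 * (∑ m, w m * K.g2 m)
    - 2 * (K.H * K.βinv * ∑ m, w m * K.su0 m) + 2 * (K.r00 * K.Binv * ∑ m, w m * K.bu m)
    - 4 * (K.β * K.r00 * K.Binv * K.Hinv * ∑ m, w m * K.y m) := by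
  simp only [Finset.mul_sum, ← Finset.sum_sub_distrib, ← Finset.sum_add_distrib]
  refine Finset.sum_congr rfl fun m _ => ?_
  rw [G, Q]
  linear_combination (2 * w m * K.g2 m - 2 * w m * K.H * K.βinv * K.su0 m
    + 2 * w m * K.r00 * K.Binv * K.bu m) * K.two_half

/-- `G` satisfies the defining equation of the geodesic coefficients of `α² / β`. -/
theorem fund_G (l : ι) : ∑ m, (K.half * K.V l (K.V m K.E)) * (4 * K.G m)
    = ∑ k, K.X k (K.V l K.E) * K.y k - K.X l K.E := by
  have hE : ∑ k, K.X k (K.V l K.E) * K.y k =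
      4 * K.H * K.βinv ^ 2 * (∑ k, K.y k * K.X k (K.yl l))
      + (4 * K.βinv ^ 2 * K.yl l - 4 * K.H * K.βinv ^ 3 * K.b l) * (∑ k, K.y k * K.X k K.H)
      + (6 * K.H ^ 2 * K.βinv ^ 4 * K.b l - 8 * K.H * K.βinv ^ 3 * K.yl l)
        * (∑ k, K.y k * K.X k K.β)
      - 2 * K.H ^ 2 * K.βinv ^ 3 * (∑ k, K.y k * K.X k (K.b l)) := by
    simp only [D_V_E, Finset.mul_sum, ← Finset.sum_add_distrib, ← Finset.sum_sub_distrib]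
    exact Finset.sum_congr rfl fun m _ => by ring
  have hH : ∑ m, K.yl m * K.y m = K.H := rfl
  have hβ : ∑ m, K.b m * K.y m = K.β := rfl
  have hB : ∑ m, K.b m * K.bu m = K.B := rfl
  rw [fund_dot, hE, y_X_H, y_X_β, y_X_yl, y_X_b, D_E, X_H, X_β, dot_G, dot_G, dot_G, a_su0, a_bu,
    yl_su0, yl_bu, hH, b_su0, hB, hβ]
  have hy : ∑ m, K.a l m * K.y m = K.yl l := rfl
  rw [hy]
  set g := ∑ m, K.a l m * K.g2 m
  set g' := ∑ m, K.yl m * K.g2 m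
  set g'' := ∑ m, K.b m * K.g2 m
  -- The connection terms `g`, `g'`, `g''` already agree on both sides; the remaining terms agree
  -- modulo the three inverse relations.
  have h1 := K.β_βinv
  have h2 := K.H_Hinv
  have h3 := K.B_Binv
  set r := K.r00 * K.Binv
  set c := K.βinv
  linear_combination (K.yl l * (-24 * c ^ 2 * K.β * r + 16 * c ^ 3 * K.β ^ 2 * r)
      + K.b l * (16 * K.H * c ^ 3 * K.β * r - 12 * K.H * c ^ 4 * K.β ^ 2 * r)) * h2
    + (16 * c ^ 2 * K.β * r * K.yl l + K.b l * (8 * K.H * c ^ 2 * r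
      - 12 * K.H * c ^ 2 * r * (K.β * c + 1))) * h1
    + (6 * K.H ^ 2 * c ^ 4 * K.b l * K.r00 - 8 * K.H * c ^ 3 * K.yl l * K.r00) * h3

/-- `½ g2` satisfies the defining equation of the geodesic coefficients of `α`. -/
theorem metric_g2 (l : ι) : ∑ m, (K.half * K.V l (K.V m K.H)) * (4 * (K.half * K.g2 m))
    = ∑ k, K.X k (K.V l K.H) * K.y k - K.X l K.H := by
  have h1 : ∑ k, K.X k (K.V l K.H) * K.y k = 2 * ∑ k, K.y k * K.X k (K.yl l) := by
    simp only [V_H, deriv_mul', deriv_two', Finset.mul_sum]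
    exact Finset.sum_congr rfl fun m _ => by ring
  rw [h1, y_X_yl, X_H]
  simp only [V_H, deriv_mul', deriv_two', V_yl, mul_add, Finset.mul_sum]
  rw [add_sub_cancel_left]
  refine Finset.sum_congr rfl fun m _ => ?_
  rw [K.a_symm m l]
  linear_combination (2 * K.a l m * K.g2 m * (2 * K.half) + 2 * K.a l m * K.g2 m) * K.two_half

end KropinaRing

end KropinaSpray

/-! ### The Ricci curvature of the Kropina metric modulo `α²`. -/

section KropinaRicci

variable {ι R : Type*} [Fintype ι] [DecidableEq ι] [CommRing R] [Algebra ℝ R]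

namespace PhaseRing

variable (P : PhaseRing ι R)

theorem euler_mul (f g : R) : P.euler (f * g) = f * P.euler g + g * P.euler f := by
  simp only [euler, deriv_mul', Finset.mul_sum, ← Finset.sum_add_distrib]
  exact Finset.sum_congr rfl fun m _ => by ring

theorem euler_base {f : R} (hf : f ∈ P.base) : P.euler f = 0 := by
  simp [euler, P.V_base _ _ hf]

theorem euler_half : P.euler P.half = 0 := by
  simp [euler, P.D_half]

end PhaseRing

theorem deriv_mem_adjoin {S : Set R} (D : Derivation ℝ R R)
    (hD : ∀ f ∈ S, D f ∈ Algebra.adjoin ℝ S) {f : R} (hf : f ∈ Algebra.adjoin ℝ S) :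
    D f ∈ Algebra.adjoin ℝ S := by
  induction hf using Algebra.adjoin_induction with
  | mem x hx => exact hD x hx
  | algebraMap r => rw [D.map_algebraMap]; exact zero_mem _
  | add x y _ _ hx hy => rw [map_add]; exact add_mem hx hy
  | mul x y hx' hy' hx hy =>
    rw [deriv_mul']; exact add_mem (mul_mem hx' hy) (mul_mem hy' hx)

namespace KropinaRing

variable (K : KropinaRing ι R)

/-- The functions that are polynomial in `y` up to a power of `β`. -/
def fibrePoly : Subalgebra ℝ R :=
  Algebra.adjoin ℝ ((K.base : Set R) ∪ Set.range K.y ∪ {K.βinv})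

theorem base_fibrePoly {f : R} (hf : f ∈ K.base) : f ∈ K.fibrePoly :=
  Algebra.subset_adjoin (Or.inl (Or.inl hf))

theorem y_fibrePoly (i : ι) : K.y i ∈ K.fibrePoly :=
  Algebra.subset_adjoin (Or.inl (Or.inr ⟨i, rfl⟩))

theorem βinv_fibrePoly : K.βinv ∈ K.fibrePoly :=
  Algebra.subset_adjoin (Or.inr rfl)

theorem lin_fibrePoly {c : ι → R} (hc : ∀ i, c i ∈ K.fibrePoly) :
    ∑ i, c i * K.y i ∈ K.fibrePoly :=
  sum_mem fun i _ => mul_mem (hc i) (K.y_fibrePoly i)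

theorem half_fibrePoly : K.half ∈ K.fibrePoly := by
  have : K.half = algebraMap ℝ R (1 / 2) := by
    have h : (2 : R) * algebraMap ℝ R (1 / 2) = 1 := by
      have : (2 : R) = algebraMap ℝ R 2 := (map_ofNat _ 2).symm
      rw [this, ← map_mul]; norm_num
    linear_combination K.half * (-1 : R) * h + (algebraMap ℝ R (1 / 2)) * K.two_half
  rw [this]; exact Subalgebra.algebraMap_mem _ _

theorem β_fibrePoly : K.β ∈ K.fibrePoly :=
  K.lin_fibrePoly fun i => K.base_fibrePoly (K.b_mem i)

theorem H_fibrePoly : K.H ∈ K.fibrePoly :=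
  K.lin_fibrePoly fun i => K.lin_fibrePoly fun j => K.base_fibrePoly (K.a_mem i j)

theorem r00_fibrePoly : K.r00 ∈ K.fibrePoly :=
  K.lin_fibrePoly fun i => K.lin_fibrePoly fun j => K.base_fibrePoly (K.r_mem i j)

theorem g2_fibrePoly (m : ι) : K.g2 m ∈ K.fibrePoly :=
  K.lin_fibrePoly fun i => K.lin_fibrePoly fun j => K.base_fibrePoly (K.Γ_mem m i j)

theorem su0_fibrePoly (m : ι) : K.su0 m ∈ K.fibrePoly :=
  K.lin_fibrePoly fun i => K.base_fibrePoly (K.su_mem m i)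

/-- Apart from the projective term, the spray has no `α²` in a denominator. `Hinv` is not among the
generators of `fibrePoly`, which is what makes divisibility by `H` meaningful. -/
theorem Q_fibrePoly (m : ι) : K.half * K.g2 m + K.Q m ∈ K.fibrePoly := by
  refine add_mem (mul_mem K.half_fibrePoly (K.g2_fibrePoly m)) (add_mem (neg_mem ?_) ?_)
  · exact mul_mem K.half_fibrePoly
      (mul_mem (mul_mem K.H_fibrePoly K.βinv_fibrePoly) (K.su0_fibrePoly m))
  · exact mul_mem (mul_mem K.r00_fibrePoly (K.base_fibrePoly K.Binv_mem))
      (mul_mem K.half_fibrePoly (K.base_fibrePoly (K.bu_mem m)))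

theorem X_fibrePoly (k : ι) {f : R} (hf : f ∈ K.fibrePoly) : K.X k f ∈ K.fibrePoly := by
  refine deriv_mem_adjoin _ ?_ hf
  rintro f ((hf | ⟨i, rfl⟩) | rfl)
  · exact K.base_fibrePoly (K.X_base k f hf)
  · rw [K.X_y]; exact zero_mem _
  · rw [D_βinv, X_β]
    refine mul_mem (neg_mem (pow_mem K.βinv_fibrePoly 2)) (add_mem (sum_mem fun m _ => ?_)
      (sub_mem ?_ ?_))
    · exact mul_mem (K.lin_fibrePoly fun j => K.base_fibrePoly (K.Γ_mem m k j))
        (K.base_fibrePoly (K.b_mem m))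
    · exact K.lin_fibrePoly fun j => K.base_fibrePoly (K.r_mem k j)
    · exact K.lin_fibrePoly fun j => K.base_fibrePoly (K.s_mem k j)

theorem V_fibrePoly (k : ι) {f : R} (hf : f ∈ K.fibrePoly) : K.V k f ∈ K.fibrePoly := by
  refine deriv_mem_adjoin _ ?_ hf
  rintro f ((hf | ⟨i, rfl⟩) | rfl)
  · rw [K.V_base k f hf]; exact zero_mem _
  · rw [K.V_y]; split_ifs
    · exact one_mem _
    · exact zero_mem _
  · rw [D_βinv, V_β]
    exact mul_mem (neg_mem (pow_mem K.βinv_fibrePoly 2)) (K.base_fibrePoly (K.b_mem k))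

theorem ricci_fibrePoly {G : ι → R} (hG : ∀ m, G m ∈ K.fibrePoly) :
    K.ricci G ∈ K.fibrePoly := by
  have h2 : (2 : R) ∈ K.fibrePoly := by exact_mod_cast Subalgebra.natCast_mem K.fibrePoly 2
  exact sum_mem fun m _ => sub_mem (add_mem (sub_mem (mul_mem h2 (K.X_fibrePoly m (hG m)))
    (sum_mem fun k _ => mul_mem (K.y_fibrePoly k) (K.X_fibrePoly k (K.V_fibrePoly m (hG m)))))
    (mul_mem h2 (sum_mem fun k _ => mul_mem (hG k) (K.V_fibrePoly k (K.V_fibrePoly m (hG m))))))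
    (sum_mem fun k _ => mul_mem (K.V_fibrePoly k (hG m)) (K.V_fibrePoly m (hG k)))

theorem euler_lin {c : ι → R} (hc : ∀ i, c i ∈ K.base) :
    K.euler (∑ i, c i * K.y i) = ∑ i, c i * K.y i := by
  simp only [PhaseRing.euler, K.V_lin c hc]
  exact Finset.sum_congr rfl fun m _ => by ring

theorem euler_β : K.euler K.β = K.β := K.euler_lin K.b_mem

theorem euler_su0 (m : ι) : K.euler (K.su0 m) = K.su0 m := K.euler_lin (K.su_mem m)

theorem euler_H : K.euler K.H = 2 * K.H := by
  simp only [PhaseRing.euler, V_H]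
  rw [H, Finset.mul_sum]
  exact Finset.sum_congr rfl fun m _ => by ring

theorem euler_r00 : K.euler K.r00 = 2 * K.r00 := by
  simp only [PhaseRing.euler, V_r00]
  rw [r00, Finset.mul_sum]
  exact Finset.sum_congr rfl fun m _ => by ring

theorem euler_g2 (m : ι) : K.euler (K.g2 m) = 2 * K.g2 m := by
  simp only [PhaseRing.euler, V_g2]
  rw [g2, Finset.mul_sum]
  exact Finset.sum_congr rfl fun m _ => by ring

theorem euler_βinv : K.euler K.βinv = -K.βinv := by
  have : K.euler K.βinv = -K.βinv ^ 2 * K.euler K.β := by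
    simp only [PhaseRing.euler, D_βinv, Finset.mul_sum]
    exact Finset.sum_congr rfl fun m _ => by ring
  rw [this, euler_β]
  linear_combination -K.βinv * K.β_βinv

theorem D_Hinv (D : Derivation ℝ R R) : D K.Hinv = -K.Hinv ^ 2 * D K.H := deriv_inv' D K.H_Hinv

theorem euler_Hinv : K.euler K.Hinv = -2 * K.Hinv := by
  have : K.euler K.Hinv = -K.Hinv ^ 2 * K.euler K.H := by
    simp only [PhaseRing.euler, D_Hinv, Finset.mul_sum]
    exact Finset.sum_congr rfl fun m _ => by ring
  rw [this, euler_H]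
  linear_combination -2 * K.Hinv * K.H_Hinv

theorem euler_Q (m : ι) :
    K.euler (K.half * K.g2 m + K.Q m) = 2 * (K.half * K.g2 m + K.Q m) := by
  have hadd : ∀ f g : R, K.euler (f + g) = K.euler f + K.euler g := fun f g => by
    simp [PhaseRing.euler, mul_add, Finset.sum_add_distrib]
  have hneg : ∀ f : R, K.euler (-f) = -K.euler f := fun f => by simp [PhaseRing.euler]
  simp only [Q, hadd, hneg, PhaseRing.euler_mul, K.euler_half, euler_g2, euler_H, euler_βinv,
    euler_su0, euler_r00, K.euler_base K.Binv_mem, K.euler_base (K.bu_mem m)]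
  ring

theorem euler_p : K.euler (-(K.β * K.r00 * K.Binv * K.Hinv)) = -(K.β * K.r00 * K.Binv * K.Hinv) := by
  have hneg : ∀ f : R, K.euler (-f) = -K.euler f := fun f => by simp [PhaseRing.euler]
  simp only [hneg, PhaseRing.euler_mul, euler_Hinv, euler_β, euler_r00, K.euler_base K.Binv_mem]
  ring

/-- All negative powers of `α²` are isolated in the projective factor; the first summand lies in
`fibrePoly`. -/
theorem ricci_G : K.ricci K.G = K.ricci (fun m => K.half * K.g2 m + K.Q m)
    + (Fintype.card ι - 1) * ((-(K.β * K.r00 * K.Binv * K.Hinv)) ^ 2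
      - ∑ k, K.y k * K.X k (-(K.β * K.r00 * K.Binv * K.Hinv))
      + 2 * ∑ k, (K.half * K.g2 k + K.Q k) * K.V k (-(K.β * K.r00 * K.Binv * K.Hinv))) :=
  K.ricci_projective _ _ K.euler_Q K.euler_p

/-- Differentiating `Hinv` vertically produces `y_k`, so this contraction is the contribution of `Q`
to the `α⁻⁴` part of the curvature. -/
theorem yl_Q : ∑ k, K.Q k * K.yl k = K.half * (K.β * K.r00 * K.Binv) := by
  have : ∑ k, K.Q k * K.yl k = -(K.half * (K.H * K.βinv * ∑ k, K.yl k * K.su0 k))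
      + K.r00 * K.Binv * (K.half * ∑ k, K.yl k * K.bu k) := by
    simp only [Finset.mul_sum, ← Finset.sum_neg_distrib, ← Finset.sum_add_distrib]
    exact Finset.sum_congr rfl fun m _ => by rw [Q]; ring
  rw [this, yl_su0, yl_bu]; ring

/-- The part of the Ricci curvature of `α² / β` that is not divisible by `α²` after clearing
denominators. -/
theorem exists_H_sq_mul_ricci_G : ∃ z ∈ K.fibrePoly,
    K.H ^ 2 * K.ricci K.G
      = 3 * (Fintype.card ι - 1) * (K.β * K.r00 * K.Binv) ^ 2 + K.H * z := by
  set w := K.β * K.r00 * K.Binv with hw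
  have hwm : w ∈ K.fibrePoly :=
    mul_mem (mul_mem K.β_fibrePoly K.r00_fibrePoly) (K.base_fibrePoly K.Binv_mem)
  have h2 : (2 : R) ∈ K.fibrePoly := by exact_mod_cast Subalgebra.natCast_mem K.fibrePoly 2
  set Dw := ∑ k, K.y k * K.X k w - 2 * ∑ k, (K.half * K.g2 k + K.Q k) * K.V k w with hDw
  refine ⟨K.H * K.ricci (fun m => K.half * K.g2 m + K.Q m) + (Fintype.card ι - 1) * Dw,
    add_mem (mul_mem K.H_fibrePoly (K.ricci_fibrePoly K.Q_fibrePoly))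
      (mul_mem (sub_mem (Subalgebra.natCast_mem _ _) (one_mem _)) (sub_mem ?_ (mul_mem h2 ?_))), ?_⟩
  · exact sum_mem fun k _ => mul_mem (K.y_fibrePoly k) (K.X_fibrePoly k hwm)
  · exact sum_mem fun k _ => mul_mem (K.Q_fibrePoly k) (K.V_fibrePoly k hwm)
  have hD : ∀ D : Derivation ℝ R R,
      D (-(w * K.Hinv)) = -K.Hinv * D w + w * K.Hinv ^ 2 * D K.H := by
    intro D; rw [map_neg, deriv_mul', D_Hinv]; ring
  have hX : ∑ k, K.y k * K.X k (-(w * K.Hinv)) =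
      -K.Hinv * ∑ k, K.y k * K.X k w + w * K.Hinv ^ 2 * (2 * ∑ k, K.yl k * K.g2 k) := by
    rw [← y_X_H]
    simp only [hD, Finset.mul_sum, ← Finset.sum_add_distrib]
    exact Finset.sum_congr rfl fun m _ => by ring
  have hV : ∑ k, (K.half * K.g2 k + K.Q k) * K.V k (-(w * K.Hinv)) =
      -K.Hinv * ∑ k, (K.half * K.g2 k + K.Q k) * K.V k w
        + w * K.Hinv ^ 2 * (∑ k, K.yl k * K.g2 k + 2 * ∑ k, K.Q k * K.yl k) := by
    simp only [hD, Finset.mul_sum, ← Finset.sum_add_distrib]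
    refine Finset.sum_congr rfl fun m _ => ?_
    rw [V_H]
    linear_combination (w * K.Hinv ^ 2 * K.yl m * K.g2 m) * K.two_half
  -- The factor 3 is `1 + 2`: one `w²` from the square of the projective factor `-w * Hinv`, two
  -- from its derivative along `Q` by `yl_Q`. The terms with `yl · g2` cancel because `α²` is
  -- preserved by its own spray.
  rw [ricci_G, hX, hV, yl_Q]
  rw [← hw]
  have h3 := K.H_Hinv
  linear_combination ((Fintype.card ι - 1) * (3 * w ^ 2 * (K.H * K.Hinv + 1) + K.H * Dw)) * h3
    + ((Fintype.card ι - 1) * K.H ^ 2 * 2 * w ^ 2 * K.Hinv ^ 2) * K.two_half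

end KropinaRing

end KropinaRicci

/-! ### The Ricci curvature when `β` is conformal. -/

section ConformalRicci

variable {ι R : Type*} [Fintype ι] [DecidableEq ι] [CommRing R] [Algebra ℝ R]

namespace KropinaRing

variable (K : KropinaRing ι R)

/-- The horizontal derivative. -/
def hd (m : ι) (f : R) : R := K.X m f - ∑ k, K.N k m * K.V k f

/-- `sᵐ_{i|m}`. -/
def ell (i : ι) : R := ∑ m, (K.X m (K.su m i) - ∑ j, K.su m j * K.Γ j m i
  + ∑ k, K.Γ m m k * K.su k i)

/-- `sᵐ_{0|m}`. -/
def ell0 : R := ∑ i, K.ell i * K.y i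

/-- `sⁱ_m sᵐ_i`. -/
def t : R := ∑ i, ∑ m, K.su i m * K.su m i

theorem hd_mul (m : ι) (f g : R) : K.hd m (f * g) = f * K.hd m g + g * K.hd m f := by
  simp only [hd, deriv_mul', mul_add, Finset.sum_add_distrib]
  have : ∀ f g : R, ∑ k, K.N k m * (f * K.V k g) = f * ∑ k, K.N k m * K.V k g := by
    intro f g; rw [Finset.mul_sum]; exact Finset.sum_congr rfl fun k _ => by ring
  rw [this, this]; ring

theorem hd_add (m : ι) (f g : R) : K.hd m (f + g) = K.hd m f + K.hd m g := by
  simp only [hd, map_add, mul_add, Finset.sum_add_distrib]; ring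

theorem hd_neg (m : ι) (f : R) : K.hd m (-f) = -K.hd m f := by
  simp only [hd, map_neg, mul_neg, Finset.sum_neg_distrib]; ring

theorem hd_base (m : ι) {f : R} (hf : f ∈ K.base) : K.hd m f = K.X m f := by
  simp [hd, K.V_base _ _ hf]

theorem hd_half (m : ι) : K.hd m K.half = 0 := by
  simp [hd, K.D_half]

/-- Metric compatibility of the Levi-Civita connection; hence `α²` behaves as a constant in every
horizontal divergence. -/
theorem hd_H (m : ι) : K.hd m K.H = 0 := by
  simp only [hd, X_H, V_H, Finset.mul_sum, ← Finset.sum_sub_distrib]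
  exact Finset.sum_eq_zero fun k _ => by ring

theorem hd_β (m : ι) : K.hd m K.β = K.r0 m - K.s0 m := by
  simp only [hd, X_β, V_β]; ring

theorem hd_βinv (m : ι) : K.hd m K.βinv = -K.βinv ^ 2 * (K.r0 m - K.s0 m) := by
  rw [← hd_β]
  simp only [hd, D_βinv, mul_sub, Finset.mul_sum]
  congr 1
  exact Finset.sum_congr rfl fun k _ => by ring

/-- The horizontal divergence. -/
def hdiv (Q : ι → R) : R := ∑ m, (K.hd m (Q m) + ∑ k, K.Γ m m k * Q k)

theorem hdiv_mul (f : R) (Q : ι → R) :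
    K.hdiv (fun m => f * Q m) = ∑ m, K.hd m f * Q m + f * K.hdiv Q := by
  simp only [hdiv, hd_mul, Finset.mul_sum, mul_add, ← Finset.sum_add_distrib]
  refine Finset.sum_congr rfl fun m _ => ?_
  have : ∑ k, K.Γ m m k * (f * Q k) = ∑ k, f * (K.Γ m m k * Q k) :=
    Finset.sum_congr rfl fun k _ => by ring
  rw [this]; ring

theorem hdiv_add (Q Q' : ι → R) :
    K.hdiv (fun m => Q m + Q' m) = K.hdiv Q + K.hdiv Q' := by
  simp only [hdiv, hd_add, mul_add, Finset.sum_add_distrib]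
  ring

theorem hdiv_su0 : K.hdiv K.su0 = K.ell0 := by
  simp only [hdiv, ell0, ell, Finset.sum_mul, add_mul, sub_mul, Finset.sum_add_distrib,
    Finset.sum_sub_distrib, hd, V_su0]
  congr 1
  · congr 1
    · simp only [su0, map_sum, deriv_mul', K.X_y, mul_zero, zero_add]
      exact sum_comm_congr fun i j => by ring
    · simp only [N, Finset.sum_mul]
      conv_rhs => rw [Finset.sum_comm]
      refine Finset.sum_congr rfl fun m _ => ?_
      conv_rhs => rw [Finset.sum_comm]
      exact Finset.sum_congr rfl fun i _ => Finset.sum_congr rfl fun j _ => by ring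
  · simp only [su0, Finset.mul_sum]
    conv_rhs => rw [Finset.sum_comm]
    refine Finset.sum_congr rfl fun m _ => ?_
    rw [Finset.sum_comm]
    exact Finset.sum_congr rfl fun i _ => Finset.sum_congr rfl fun j _ => by ring

/-- The covariant derivative of `bⁱ`. -/
theorem X_bu {c : R} (hr : ∀ i j, K.r i j = c * K.a i j) (m l : ι) :
    K.X m (K.bu l) + ∑ j, K.Γ l m j * K.bu j = (if l = m then c else 0) + K.su l m := by
  -- The index is lowered first: differentiating `a_ij bʲ = b_i` gives the identity after
  -- contraction with `a`, and `A` then removes the metric.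
  have key : ∀ i, ∑ k, K.a i k * (K.X m (K.bu k) + ∑ j, K.Γ k m j * K.bu j - K.su k m)
      = c * K.a i m := by
    intro i
    have h := congrArg (K.X m) (K.a_bu i)
    simp only [map_sum, deriv_mul', K.X_a, K.X_b, Finset.sum_add_distrib, hr] at h
    have e1 : ∑ x, K.bu x * ∑ k, (K.Γ k m i * K.a k x + K.Γ k m x * K.a i k)
        = ∑ k, K.Γ k i m * K.b k + ∑ k, K.a i k * ∑ j, K.Γ k m j * K.bu j := by
      simp only [← K.a_bu, Finset.mul_sum, ← Finset.sum_add_distrib]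
      exact sum_comm_congr fun j k => by rw [K.Γ_symm k i m]; ring
    simp only [← Finset.sum_add_distrib] at h
    rw [Finset.sum_add_distrib, e1] at h
    simp only [mul_sub, mul_add, Finset.sum_sub_distrib, Finset.sum_add_distrib, K.a_su]
    linear_combination h
  have h2 : ∀ u : ι → R, ∑ i, K.A l i * ∑ k, K.a i k * u k = u l := by
    intro u
    have : ∑ i, K.A l i * ∑ k, K.a i k * u k = ∑ k, (∑ i, K.A l i * K.a i k) * u k := by
      simp only [Finset.mul_sum, Finset.sum_mul]
      exact sum_comm_congr fun i j => by ring
    rw [this]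
    simp [K.A_a]
  have h3 := h2 fun k => K.X m (K.bu k) + ∑ j, K.Γ k m j * K.bu j - K.su k m
  simp only [key] at h3
  have h4 : ∑ i, K.A l i * (c * K.a i m) = if l = m then c else 0 := by
    have : ∑ i, K.A l i * (c * K.a i m) = c * ∑ i, K.A l i * K.a i m := by
      rw [Finset.mul_sum]; exact Finset.sum_congr rfl fun i _ => by ring
    rw [this, K.A_a]; split_ifs <;> simp
  rw [h4] at h3
  linear_combination -h3

theorem hdiv_bu {c : R} (hr : ∀ i j, K.r i j = c * K.a i j) :
    K.hdiv K.bu = Fintype.card ι * c := by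
  simp only [hdiv, K.hd_base _ (K.bu_mem _), K.X_bu hr, Finset.sum_add_distrib, K.su_trace]
  simp

theorem su_bu (m : ι) : ∑ i, K.su m i * K.bu i = 0 := by
  have h2 : ∀ u : ι → R, ∑ i, K.A m i * ∑ k, K.a i k * u k = u m := by
    intro u
    have : ∑ i, K.A m i * ∑ k, K.a i k * u k = ∑ k, (∑ i, K.A m i * K.a i k) * u k := by
      simp only [Finset.mul_sum, Finset.sum_mul]
      exact sum_comm_congr fun i j => by ring
    rw [this]
    simp [K.A_a]
  rw [← h2 fun m => ∑ i, K.su m i * K.bu i]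
  refine Finset.sum_eq_zero fun i _ => ?_
  have : ∑ k, K.a i k * ∑ j, K.su k j * K.bu j = -∑ j, K.bu j * K.s j i := by
    simp only [K.s_anti _ i, ← K.a_su, Finset.mul_sum]
    simp only [← Finset.sum_neg_distrib, mul_neg, neg_neg, Finset.mul_sum]
    exact sum_comm_congr fun i j => by ring
  rw [this, K.s_form, neg_zero, mul_zero]

/-- Covariant differentiation of `sᵐ_i bⁱ = 0`, followed by a trace. Since `∇b = c δ + s`, the `c`
term is the trace of `s`, which vanishes, and the rest is `-t`. -/
theorem ell_bu {c : R} (hr : ∀ i j, K.r i j = c * K.a i j) :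
    ∑ i, K.ell i * K.bu i = -K.t := by
  have h1 : ∑ i, K.ell i * K.bu i = ∑ m, (K.X m (∑ i, K.su m i * K.bu i)
      - ∑ i, K.su m i * (K.X m (K.bu i) + ∑ j, K.Γ i m j * K.bu j)
      + ∑ k, K.Γ m m k * ∑ i, K.su k i * K.bu i) := by
    simp only [ell, Finset.sum_mul]
    rw [Finset.sum_comm]
    refine Finset.sum_congr rfl fun m _ => ?_
    simp only [map_sum, deriv_mul', add_mul, sub_mul, Finset.sum_add_distrib,
      Finset.sum_sub_distrib, mul_add]
    have e1 : ∑ i, (∑ j, K.su m j * K.Γ j m i) * K.bu i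
        = ∑ i, K.su m i * ∑ j, K.Γ i m j * K.bu j := by
      simp only [Finset.mul_sum, Finset.sum_mul]
      exact sum_comm_congr fun i j => by ring
    have e2 : ∑ i, (∑ k, K.Γ m m k * K.su k i) * K.bu i
        = ∑ k, K.Γ m m k * ∑ i, K.su k i * K.bu i := by
      simp only [Finset.mul_sum, Finset.sum_mul]
      exact sum_comm_congr fun i j => by ring
    have e3 : ∑ i, K.bu i * K.X m (K.su m i) = ∑ i, K.X m (K.su m i) * K.bu i :=
      Finset.sum_congr rfl fun i _ => by ring
    rw [e1, e2, e3]; ring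
  rw [h1]
  simp only [su_bu, K.X_bu hr, map_zero, mul_zero, Finset.sum_const_zero, add_zero, zero_sub,
    mul_add, Finset.sum_add_distrib, Finset.sum_neg_distrib]
  have e : ∑ m, ∑ i, K.su m i * (if i = m then c else 0) = 0 := by
    simp [← Finset.sum_mul, K.su_trace]
  rw [neg_inj, t, e, zero_add]

theorem su_su0 : ∑ i, ∑ m, K.V m (K.H * K.βinv * K.su0 i) * K.V i (K.H * K.βinv * K.su0 m)
    = 4 * (K.H * K.βinv ^ 2 * ∑ i, K.s0 i * K.su0 i) * (-1)
      + (K.H * K.βinv) ^ 2 * K.t := by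
  have hF : ∀ k, K.V k (K.H * K.βinv) = 2 * K.βinv * K.yl k - K.H * K.βinv ^ 2 * K.b k := by
    intro k; rw [deriv_mul', D_βinv, V_H, V_β]; ring
  have hdot : ∀ u : ι → R, ∑ k, K.V k (K.H * K.βinv) * u k = 2 * K.βinv * ∑ k, K.yl k * u k
      - K.H * K.βinv ^ 2 * ∑ k, K.b k * u k := by
    intro u
    simp only [hF, Finset.mul_sum, ← Finset.sum_sub_distrib]
    exact Finset.sum_congr rfl fun k _ => by ring
  set F := K.H * K.βinv with hFdef
  have h0 : ∑ k, K.V k F * K.su0 k = 0 := by rw [hdot, yl_su0, b_su0]; ring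
  have h1 : ∀ i, ∑ k, K.V k F * K.su k i = -2 * K.βinv * K.s0 i := by
    intro i; rw [hdot, yl_su, b_su]; ring
  simp only [deriv_mul', V_su0]
  have e : ∀ i m, (F * K.su i m + K.su0 i * K.V m F) * (F * K.su m i + K.su0 m * K.V i F)
      = F ^ 2 * (K.su i m * K.su m i) + F * ((K.V i F * K.su i m) * K.su0 m)
        + F * ((K.V m F * K.su m i) * K.su0 i)
        + (K.V i F * K.su0 i) * (K.V m F * K.su0 m) := by intros; ring
  simp only [e, Finset.sum_add_distrib, ← Finset.mul_sum, ← Finset.sum_mul]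
  rw [h0]
  have e1 : ∑ i, ∑ m, K.V i F * K.su i m * K.su0 m = ∑ m, -2 * K.βinv * K.s0 m * K.su0 m := by
    rw [Finset.sum_comm]; simp only [← Finset.sum_mul, h1]
  have e2 : ∑ i, (∑ m, K.V m F * K.su m i) * K.su0 i = ∑ m, -2 * K.βinv * K.s0 m * K.su0 m := by
    simp only [h1]
  have e3 : ∑ m, -2 * K.βinv * K.s0 m * K.su0 m = -2 * K.βinv * ∑ m, K.s0 m * K.su0 m := by
    rw [Finset.mul_sum]; exact Finset.sum_congr rfl fun k _ => by ring
  rw [e1, e2, e3, t]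
  ring

/-- The Ricci curvature of `α² / β` when `r_ij = c a_ij`. -/
theorem ricci_G_of_conformal {c κ : R} (hκ : κ ∈ K.base)
    (hr : ∀ i j, K.r i j = c * K.a i j) (hc : κ * K.B = c) :
    K.ricci K.G = K.ricci (fun m => K.half * K.g2 m) - K.H * K.βinv * K.ell0
      - K.half ^ 2 * (K.H * K.βinv) ^ 2 * K.t
      + K.H * (∑ k, K.X k κ * K.bu k + Fintype.card ι * κ * c)
      + (Fintype.card ι - 2) * ((∑ k, K.X k κ * K.y k) * K.β + κ ^ 2 * K.β ^ 2) := by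
  have hr0 : ∀ m, K.r0 m = c * K.yl m := by
    intro m; simp only [r0, yl, hr, Finset.mul_sum]
    exact Finset.sum_congr rfl fun k _ => by ring
  have hr00 : K.r00 = c * K.H := by
    simp only [r00, H, hr0, Finset.mul_sum]
    exact Finset.sum_congr rfl fun k _ => by ring
  have hcB : c * K.Binv = κ := by rw [← hc]; linear_combination κ * K.B_Binv
  have hQ : ∀ m, K.Q m = -K.half * (K.H * K.βinv * K.su0 m) + K.half * κ * (K.H * K.bu m) := by
    intro m; rw [Q, hr00]; linear_combination K.half * K.H * K.bu m * hcB
  -- With `r₀₀ = c α²` the factor `α²` cancels: the projective factor becomes linear in `y`.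
  have hp : -(K.β * K.r00 * K.Binv * K.Hinv) = -(κ * K.β) := by
    rw [hr00]; linear_combination -(K.β * (K.H * K.Hinv)) * hcB - K.β * κ * K.H_Hinv
  have hVκ : ∀ k, K.V k κ = 0 := fun k => K.V_base k κ hκ
  have hVbu : ∀ k m, K.V k (K.bu m) = 0 := fun k m => K.V_base k _ (K.bu_mem m)
  have hVB : ∀ k m, K.V k (K.H * K.bu m) = 2 * K.yl k * K.bu m := by
    intro k m; rw [deriv_mul', hVbu, V_H]; ring
  have hVQ : ∀ k m, K.V k (K.Q m) = -K.half * K.V k (K.H * K.βinv * K.su0 m)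
      + κ * K.yl k * K.bu m := by
    intro k m
    rw [hQ, map_add, deriv_mul', deriv_mul' _ (K.half * κ), deriv_mul' _ K.half κ, map_neg,
      K.D_half, hVκ, hVB]
    linear_combination κ * K.yl k * K.bu m * K.two_half
  have hVS : ∀ k m, K.V k (K.H * K.βinv * K.su0 m) = K.H * K.βinv * K.su m k
      + K.su0 m * (2 * K.βinv * K.yl k - K.H * K.βinv ^ 2 * K.b k) := by
    intro k m; rw [deriv_mul', deriv_mul', D_βinv, V_H, V_β, V_su0]; ring
  have hdivS : ∑ m, K.V m (K.H * K.βinv * K.su0 m) = 0 := by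
    have : ∑ m, K.V m (K.H * K.βinv * K.su0 m) = K.H * K.βinv * ∑ m, K.su m m
        + 2 * K.βinv * ∑ m, K.yl m * K.su0 m - K.H * K.βinv ^ 2 * ∑ m, K.b m * K.su0 m := by
      simp only [hVS, Finset.mul_sum, ← Finset.sum_add_distrib, ← Finset.sum_sub_distrib]
      exact Finset.sum_congr rfl fun m _ => by ring
    rw [this, K.su_trace, yl_su0, b_su0]; ring
  have hdivQ : K.vdiv K.Q = κ * K.β := by
    have : ∑ m, κ * K.yl m * K.bu m = κ * K.β := by
      rw [← yl_bu, Finset.mul_sum]; exact Finset.sum_congr rfl fun m _ => by ring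
    simp only [PhaseRing.vdiv, hVQ, Finset.sum_add_distrib, this, ← Finset.mul_sum, hdivS]
    ring
  have hdivg : K.vdiv (fun m => K.half * K.g2 m) = ∑ m, K.N m m := by
    refine Finset.sum_congr rfl fun m _ => ?_
    rw [deriv_mul', K.D_half, V_g2]; linear_combination K.N m m * K.two_half
  have hVg : ∀ k m, K.V k (K.half * K.g2 m) = K.N m k := by
    intro k m
    rw [deriv_mul', K.D_half, V_g2]; linear_combination K.N m k * K.two_half
  -- The terms linear in `Q` that do not involve its vertical divergence assemble into the
  -- horizontal divergence for the connection of `α`.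
  have hlin : ∑ m, K.X m (K.Q m) + ∑ k, K.Q k * K.V k (∑ m, K.N m m)
      - ∑ m, ∑ k, K.V m (K.half * K.g2 k) * K.V k (K.Q m) = K.hdiv K.Q := by
    simp only [hdiv, hd, hVg, map_sum, V_N, Finset.sum_add_distrib, Finset.sum_sub_distrib]
    have : ∑ k, K.Q k * ∑ m, K.Γ m m k = ∑ m, ∑ k, K.Γ m m k * K.Q k := by
      simp only [Finset.mul_sum]
      exact sum_comm_congr fun i j => by ring
    rw [this]; ring
  have hhdQ : 2 * K.hdiv K.Q = -(K.H * K.βinv ^ 2 * ∑ m, K.s0 m * K.su0 m)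
      - K.H * K.βinv * K.ell0 + K.H * (∑ k, K.X k κ * K.bu k + Fintype.card ι * κ * c) := by
    have hQ' : K.Q = fun m => (-K.half * (K.H * K.βinv)) * K.su0 m
        + (K.half * κ * K.H) * K.bu m := by
      ext m; rw [hQ]; ring
    have h1 : ∀ m, K.hd m (-K.half * (K.H * K.βinv)) =
        K.half * K.H * K.βinv ^ 2 * (c * K.yl m - K.s0 m) := by
      intro m
      rw [hd_mul, hd_mul, hd_neg, hd_half, hd_H, hd_βinv, hr0]; ring
    have h2 : ∀ m, K.hd m (K.half * κ * K.H) = K.half * K.H * K.X m κ := by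
      intro m
      rw [hd_mul, hd_mul, hd_half, hd_H, K.hd_base _ hκ]; ring
    have h3 : ∑ m, K.half * K.H * K.βinv ^ 2 * (c * K.yl m - K.s0 m) * K.su0 m
        = K.half * K.H * K.βinv ^ 2 * (c * ∑ m, K.yl m * K.su0 m - ∑ m, K.s0 m * K.su0 m) := by
      simp only [Finset.mul_sum, ← Finset.sum_sub_distrib]
      exact Finset.sum_congr rfl fun m _ => by ring
    have h4 : ∑ m, K.half * K.H * K.X m κ * K.bu m = K.half * K.H * ∑ m, K.X m κ * K.bu m := by
      simp only [Finset.mul_sum]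
      exact Finset.sum_congr rfl fun m _ => by ring
    rw [hQ', hdiv_add, hdiv_mul, hdiv_mul, hdiv_su0, K.hdiv_bu hr]
    simp only [h1, h2]
    rw [h3, h4, yl_su0]
    linear_combination (-(K.H * K.βinv ^ 2 * ∑ m, K.s0 m * K.su0 m) - K.H * K.βinv * K.ell0
      + K.H * (∑ k, K.X k κ * K.bu k + Fintype.card ι * κ * c)) * K.two_half
  have hyX : ∑ k, K.y k * K.X k (κ * K.β) - 2 * ∑ k, (K.half * K.g2 k) * K.V k (κ * K.β)
      = (∑ k, K.X k κ * K.y k) * K.β + κ * c * K.H := by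
    have h1 : ∑ k, K.y k * K.X k (κ * K.β) = κ * ∑ k, K.y k * K.X k K.β
        + K.β * ∑ k, K.X k κ * K.y k := by
      simp only [deriv_mul', Finset.mul_sum, ← Finset.sum_add_distrib]
      exact Finset.sum_congr rfl fun m _ => by ring
    have h2 : ∑ k, (K.half * K.g2 k) * K.V k (κ * K.β) = κ * K.half * ∑ k, K.b k * K.g2 k := by
      simp only [deriv_mul', hVκ, V_β, Finset.mul_sum]
      exact Finset.sum_congr rfl fun m _ => by ring
    rw [h1, h2, y_X_β, hr00]
    linear_combination -κ * (∑ k, K.b k * K.g2 k) * K.two_half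
  have hQb : ∑ k, K.Q k * K.b k = K.half * κ * K.H * K.B := by
    have : ∑ k, K.Q k * K.b k = -K.half * (K.H * K.βinv) * ∑ k, K.b k * K.su0 k
        + K.half * κ * K.H * ∑ k, K.b k * K.bu k := by
      simp only [hQ, Finset.mul_sum, ← Finset.sum_add_distrib]
      exact Finset.sum_congr rfl fun m _ => by ring
    rw [this, b_su0, B]; ring
  have hQβ : 2 * ∑ k, K.Q k * K.V k (κ * K.β) = κ * c * K.H := by
    have : ∑ k, K.Q k * K.V k (κ * K.β) = κ * ∑ k, K.Q k * K.b k := by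
      simp only [deriv_mul', hVκ, V_β, Finset.mul_sum]
      exact Finset.sum_congr rfl fun m _ => by ring
    rw [this, hQb, ← hc]
    linear_combination κ ^ 2 * K.H * K.B * K.two_half
  have hbuS : ∀ i, ∑ k, K.yl k * K.V i (K.H * K.βinv * K.su0 k) * K.bu i
      = -K.H * K.βinv * (K.s0 i * K.bu i) := by
    intro i
    have : ∑ k, K.yl k * K.V i (K.H * K.βinv * K.su0 k) * K.bu i
        = (K.H * K.βinv * ∑ k, K.yl k * K.su k i + (2 * K.βinv * K.yl i
          - K.H * K.βinv ^ 2 * K.b i) * ∑ k, K.yl k * K.su0 k) * K.bu i := by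
      simp only [hVS, Finset.mul_sum, ← Finset.sum_add_distrib, Finset.sum_mul]
      exact Finset.sum_congr rfl fun m _ => by ring
    rw [this, yl_su, yl_su0]; ring
  have hbus : ∑ i, K.s0 i * K.bu i = 0 := by
    rw [← K.bu_s0]; exact Finset.sum_congr rfl fun m _ => by ring
  have hcross : ∑ i, ∑ k, K.yl k * K.V i (K.H * K.βinv * K.su0 k) * K.bu i = 0 := by
    simp only [hbuS, ← Finset.mul_sum, hbus]; ring
  have hquad : ∑ m, ∑ k, K.V k (K.Q m) * K.V m (K.Q k) =
      K.half ^ 2 * (K.H * K.βinv) ^ 2 * K.t - K.H * K.βinv ^ 2 * (∑ i, K.s0 i * K.su0 i)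
        + κ ^ 2 * K.β ^ 2 := by
    have e : ∀ m k, K.V k (K.Q m) * K.V m (K.Q k) =
        K.half ^ 2 * (K.V k (K.H * K.βinv * K.su0 m) * K.V m (K.H * K.βinv * K.su0 k))
        - K.half * κ * (K.yl k * K.V m (K.H * K.βinv * K.su0 k) * K.bu m)
        - K.half * κ * (K.yl m * K.V k (K.H * K.βinv * K.su0 m) * K.bu k)
        + κ ^ 2 * ((K.yl k * K.bu k) * (K.yl m * K.bu m)) := by
      intro m k; rw [hVQ, hVQ]; ring
    have hcross' : ∑ m, ∑ k, K.yl m * K.V k (K.H * K.βinv * K.su0 m) * K.bu k = 0 := by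
      rw [Finset.sum_comm, hcross]
    have hmul : ∑ m, ∑ k, (K.yl k * K.bu k) * (K.yl m * K.bu m) = K.β * K.β := by
      rw [← yl_bu, Finset.sum_mul_sum]
      exact sum_comm_congr fun i j => by ring
    simp only [e, Finset.sum_add_distrib, Finset.sum_sub_distrib, ← Finset.mul_sum, hcross,
      hcross', hmul]
    rw [su_su0]
    linear_combination (-(2 * K.half + 1) * (K.H * K.βinv ^ 2 * ∑ i, K.s0 i * K.su0 i)) * K.two_half
  -- The contribution `κ c α²` of `r₀₀` along the spray of `α` is cancelled by the derivative along
  -- `Q`.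
  have hproj : (-(κ * K.β)) ^ 2 - ∑ k, K.y k * K.X k (-(κ * K.β))
      + 2 * ∑ k, (K.half * K.g2 k + K.Q k) * K.V k (-(κ * K.β))
      = κ ^ 2 * K.β ^ 2 + (∑ k, K.X k κ * K.y k) * K.β := by
    simp only [map_neg, mul_neg, Finset.sum_neg_distrib, add_mul, Finset.sum_add_distrib]
    linear_combination hyX - hQβ
  -- The terms `s₀ · su₀` of `hhdQ` and `hquad` cancel. The bracket `(∂κ·y) β + κ² β²` enters `n -
  -- 1` times from the projective change and `-1` times from `hyX` and `hquad`, hence the factor `n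
  -- - 2`.
  rw [ricci_G, hp, hproj, PhaseRing.ricci_add, hdivg, hdivQ, hlin, hhdQ, hyX, hQβ, hquad]
  ring

end KropinaRing

end ConformalRicci

noncomputable section

/-! ### Smooth functions on an open set as a ring with commuting derivations. -/

section SmoothRing

theorem two_le_infty : (2 : WithTop ℕ∞) ≤ ∞ := by
  exact ENat.LEInfty.out

section Extension

variable {W : Type*} [TopologicalSpace W]

/-- Extension by zero of a function on an open set. -/
def zeroExt {Ω : TopologicalSpace.Opens W} (f : Ω → ℝ) : W → ℝ := Function.extend Subtype.val f 0

theorem zeroExt_apply {Ω : TopologicalSpace.Opens W} (f : Ω → ℝ) (p : Ω) : zeroExt f p = f p :=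
  Subtype.val_injective.extend_apply _ _ _

theorem zeroExt_eqOn {Ω : TopologicalSpace.Opens W} {f : Ω → ℝ} {g : W → ℝ}
    (h : ∀ p : Ω, f p = g p) : Set.EqOn (zeroExt f) g Ω := fun p hp => by
  rw [← h ⟨p, hp⟩]; exact zeroExt_apply f ⟨p, hp⟩

theorem zeroExt_eventuallyEq {Ω : TopologicalSpace.Opens W} {f : Ω → ℝ} {g : W → ℝ}
    (h : ∀ p : Ω, f p = g p) (p : Ω) : zeroExt f =ᶠ[nhds (p : W)] g :=
  Filter.eventuallyEq_of_mem (Ω.isOpen.mem_nhds p.2) (zeroExt_eqOn h)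

end Extension

variable {W : Type*} [NormedAddCommGroup W] [NormedSpace ℝ W]

/-- The ring of smooth functions on an open set. -/
def smoothRing (Ω : TopologicalSpace.Opens W) : Subalgebra ℝ (Ω → ℝ) where
  -- Elements live on `Ω` itself, so equality in the ring is equality on `Ω`. The extension by zero
  -- only provides a function to differentiate; its values off the open set `Ω` do not affect
  -- derivatives on `Ω`.
  carrier := {f | ContDiffOn ℝ ∞ (zeroExt f) Ω}
  mul_mem' {f g} hf hg := (ContDiffOn.mul hf hg).congr
    (zeroExt_eqOn fun p => by simp [zeroExt_apply])
  add_mem' {f g} hf hg := (ContDiffOn.add hf hg).congr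
    (zeroExt_eqOn fun p => by simp [zeroExt_apply])
  algebraMap_mem' r := (contDiffOn_const (c := r)).congr (zeroExt_eqOn fun p => by simp)

variable {Ω : TopologicalSpace.Opens W}

theorem mem_smoothRing {g : W → ℝ} (hg : ContDiffOn ℝ ∞ g Ω) {f : Ω → ℝ}
    (h : ∀ p : Ω, f p = g p) : f ∈ smoothRing Ω :=
  hg.congr (zeroExt_eqOn h)

theorem smoothRing_contDiffAt (f : smoothRing Ω) (p : Ω) : ContDiffAt ℝ ∞ (zeroExt f.1) p :=
  ContDiffOn.contDiffAt f.2 (Ω.isOpen.mem_nhds p.2)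

theorem smoothRing_differentiableAt (f : smoothRing Ω) (p : Ω) :
    DifferentiableAt ℝ (zeroExt f.1) p :=
  (smoothRing_contDiffAt f p).differentiableAt (by simp)

/-- The directional derivative on the ring of smooth functions. -/
def dirDeriv (v : W) : Derivation ℝ (smoothRing Ω) (smoothRing Ω) :=
  Derivation.mk'
    { toFun := fun f => ⟨fun p => fderiv ℝ (zeroExt f.1) p v,
        mem_smoothRing (((ContDiffOn.fderiv_of_isOpen (m := ∞) f.2 Ω.isOpen (by simp)).clm_apply
          contDiffOn_const)) fun p => rfl⟩
      map_add' := fun f g => by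
        ext p
        have : zeroExt (f + g : smoothRing Ω).1 =ᶠ[nhds (p : W)] zeroExt f.1 + zeroExt g.1 :=
          zeroExt_eventuallyEq (fun p => by simp [zeroExt_apply]) p
        change fderiv ℝ (zeroExt (f + g : smoothRing Ω).1) p v = _
        rw [this.fderiv_eq, fderiv_add (smoothRing_differentiableAt f p)
          (smoothRing_differentiableAt g p)]
        rfl
      map_smul' := fun c f => by
        ext p
        have : zeroExt (c • f : smoothRing Ω).1 =ᶠ[nhds (p : W)] c • zeroExt f.1 :=
          zeroExt_eventuallyEq (fun p => by simp [zeroExt_apply]) p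
        change fderiv ℝ (zeroExt (c • f : smoothRing Ω).1) p v = _
        rw [this.fderiv_eq, fderiv_const_smul (smoothRing_differentiableAt f p)]
        rfl }
    fun f g => by
      ext p
      have : zeroExt (f * g : smoothRing Ω).1 =ᶠ[nhds (p : W)] zeroExt f.1 * zeroExt g.1 :=
        zeroExt_eventuallyEq (fun p => by simp [zeroExt_apply]) p
      change fderiv ℝ (zeroExt (f * g : smoothRing Ω).1) p v = _
      rw [this.fderiv_eq, fderiv_mul (smoothRing_differentiableAt f p)
        (smoothRing_differentiableAt g p), zeroExt_apply, zeroExt_apply]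
      rfl

theorem dirDeriv_apply (v : W) (f : smoothRing Ω) (p : Ω) :
    (dirDeriv v f).1 p = fderiv ℝ (zeroExt f.1) p v := rfl

theorem dirDeriv_apply_of_eq (v : W) {f : smoothRing Ω} {g : W → ℝ} (h : ∀ p : Ω, f.1 p = g p)
    (p : Ω) : (dirDeriv v f).1 p = fderiv ℝ g p v := by
  rw [dirDeriv_apply, (zeroExt_eventuallyEq h p).fderiv_eq]

theorem dirDeriv_comm (v w : W) (f : smoothRing Ω) :
    dirDeriv v (dirDeriv w f) = dirDeriv w (dirDeriv v f) := by
  ext p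
  have hd : DifferentiableAt ℝ (fderiv ℝ (zeroExt f.1)) p :=
    ((smoothRing_contDiffAt f p).fderiv_right (m := 1)
      (by rw [one_add_one_eq_two]; exact two_le_infty)).differentiableAt (by simp)
  have h : ∀ v w : W, (dirDeriv v (dirDeriv w f)).1 p
      = fderiv ℝ (fderiv ℝ (zeroExt f.1)) p v w := by
    intro v w
    rw [dirDeriv_apply_of_eq v (g := fun q => fderiv ℝ (zeroExt f.1) q w) fun q => rfl]
    rw [fderiv_clm_apply hd (by fun_prop)]
    simp
  rw [h, h]
  have := (smoothRing_contDiffAt f p).isSymmSndFDerivAt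
    (by simpa using two_le_infty)
  exact this v w

/-- Evaluation at a point. -/
def ev (p : Ω) : smoothRing Ω →ₐ[ℝ] ℝ := (Pi.evalAlgHom ℝ (fun _ : Ω => ℝ) p).comp (smoothRing Ω).val

theorem ev_apply (p : Ω) (f : smoothRing Ω) : ev p f = f.1 p := rfl

theorem smoothRing_ext {f g : smoothRing Ω} (h : ∀ p, ev p f = ev p g) : f = g :=
  Subtype.ext (funext h)

end SmoothRing

/-! ### Phase space over a coordinate domain; geodesic coefficients and curvature as ring elements.
-/

section PhaseSpace

variable {n : ℕ} {Ω : TopologicalSpace.Opens (Coord n × Coord n)}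

/-- `∂/∂xᵏ` -/
def dX (k : Fin n) : Derivation ℝ (smoothRing Ω) (smoothRing Ω) :=
  dirDeriv (EuclideanSpace.single k 1, 0)

/-- `∂/∂yᵏ` -/
def dV (k : Fin n) : Derivation ℝ (smoothRing Ω) (smoothRing Ω) :=
  dirDeriv (0, EuclideanSpace.single k 1)

/-- Translates analytic partial derivatives into ring derivations. Agreement on the open set `Ω`
suffices, because differentiation is local; applied repeatedly, it handles iterated derivatives. -/
theorem partialDeriv_fst_eq {F : Coord n → Coord n → ℝ} {f : smoothRing Ω}
    (h : ∀ p : Ω, F p.1.1 p.1.2 = ev p f) (k : Fin n) (p : Ω) :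
    partialDeriv k (fun x => F x p.1.2) p.1.1 = ev p (dX k f) := by
  have h' : ∀ q : Ω, f.1 q = (fun q : Coord n × Coord n => F q.1 q.2) q := fun q => (h q).symm
  have hd : DifferentiableAt ℝ (fun q : Coord n × Coord n => F q.1 q.2) p :=
    (smoothRing_differentiableAt f p).congr_of_eventuallyEq (zeroExt_eventuallyEq h' p).symm
  rw [ev_apply, dX, dirDeriv_apply_of_eq _ (g := fun q : Coord n × Coord n => F q.1 q.2) h', partialDeriv]
  have hc : HasFDerivAt (fun x : Coord n => (x, p.1.2)) (ContinuousLinearMap.inl ℝ _ _) p.1.1 :=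
    hasFDerivAt_prodMk_left _ _
  have := HasFDerivAt.comp p.1.1 (f := fun x : Coord n => (x, p.1.2)) hd.hasFDerivAt hc
  have h2 := this.fderiv
  simp only [Function.comp_def] at h2
  rw [h2]
  simp

theorem partialDeriv_snd_eq {F : Coord n → Coord n → ℝ} {f : smoothRing Ω}
    (h : ∀ p : Ω, F p.1.1 p.1.2 = ev p f) (k : Fin n) (p : Ω) :
    partialDeriv k (fun y => F p.1.1 y) p.1.2 = ev p (dV k f) := by
  have h' : ∀ q : Ω, f.1 q = (fun q : Coord n × Coord n => F q.1 q.2) q := fun q => (h q).symm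
  have hd : DifferentiableAt ℝ (fun q : Coord n × Coord n => F q.1 q.2) p :=
    (smoothRing_differentiableAt f p).congr_of_eventuallyEq (zeroExt_eventuallyEq h' p).symm
  rw [ev_apply, dV, dirDeriv_apply_of_eq _ (g := fun q : Coord n × Coord n => F q.1 q.2) h', partialDeriv]
  have hc : HasFDerivAt (fun y : Coord n => (p.1.1, y)) (ContinuousLinearMap.inr ℝ _ _) p.1.2 :=
    hasFDerivAt_prodMk_right _ _
  have := HasFDerivAt.comp p.1.2 (f := fun y : Coord n => (p.1.1, y)) hd.hasFDerivAt hc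
  have h2 := this.fderiv
  simp only [Function.comp_def] at h2
  rw [h2]
  simp

variable (Ω) in
/-- A coordinate `yⁱ`. -/
def coordY (i : Fin n) : smoothRing Ω :=
  ⟨fun p => p.1.2 i, mem_smoothRing (g := fun q : Coord n × Coord n => q.2 i)
    (by fun_prop) fun _ => rfl⟩

theorem ev_coordY (p : Ω) (i : Fin n) : ev p (coordY Ω i) = p.1.2 i := rfl

theorem dX_coordY (k i : Fin n) : dX k (coordY Ω i) = 0 := by
  refine smoothRing_ext fun p => ?_
  rw [← partialDeriv_fst_eq (F := fun _ y => y i) (fun _ => rfl)]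
  simp [partialDeriv]

theorem dV_coordY (k i : Fin n) : dV k (coordY Ω i) = if k = i then 1 else 0 := by
  refine smoothRing_ext fun p => ?_
  rw [← partialDeriv_snd_eq (F := fun _ y => y i) (fun _ => rfl), partialDeriv]
  have : (fun y : Coord n => y i) = (EuclideanSpace.proj i : Coord n →L[ℝ] ℝ) := rfl
  rw [this, ContinuousLinearMap.fderiv]
  by_cases h : k = i
  · subst h; simp
  · simp [h, Ne.symm h]

variable (Ω) in
/-- The pull back of a function of `x`. -/
def pullX {U : Set (Coord n)} (hΩ : ∀ p ∈ Ω, p.1 ∈ U) (g : Coord n → ℝ) (hg : ContDiffOn ℝ ∞ g U) :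
    smoothRing Ω :=
  ⟨fun p => g p.1.1, mem_smoothRing (g := fun q : Coord n × Coord n => g q.1)
    (hg.comp contDiffOn_fst fun p hp => hΩ p hp) fun _ => rfl⟩

theorem ev_pullX {U : Set (Coord n)} (hΩ : ∀ p ∈ Ω, p.1 ∈ U) {g : Coord n → ℝ}
    (hg : ContDiffOn ℝ ∞ g U) (p : Ω) : ev p (pullX Ω hΩ g hg) = g p.1.1 := rfl

theorem contDiffOn_partialDeriv {U : Set (Coord n)} (hU : IsOpen U) {g : Coord n → ℝ}
    (hg : ContDiffOn ℝ ∞ g U) (k : Fin n) : ContDiffOn ℝ ∞ (partialDeriv k g) U :=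
  (hg.fderiv_of_isOpen (m := ∞) hU (by simp)).clm_apply contDiffOn_const

theorem ev_dX_pullX {U : Set (Coord n)} (hΩ : ∀ p ∈ Ω, p.1 ∈ U) {g : Coord n → ℝ}
    (hg : ContDiffOn ℝ ∞ g U) (k : Fin n) (p : Ω) :
    ev p (dX k (pullX Ω hΩ g hg)) = partialDeriv k g p.1.1 :=
  (partialDeriv_fst_eq (F := fun x _ => g x) (fun _ => rfl) k p).symm

theorem dX_pullX {U : Set (Coord n)} (hU : IsOpen U) (hΩ : ∀ p ∈ Ω, p.1 ∈ U) {g : Coord n → ℝ}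
    (hg : ContDiffOn ℝ ∞ g U) (k : Fin n) : dX k (pullX Ω hΩ g hg) =
      pullX Ω hΩ (partialDeriv k g) (contDiffOn_partialDeriv hU hg k) :=
  smoothRing_ext fun p => by rw [ev_dX_pullX, ev_pullX]

theorem dV_pullX {U : Set (Coord n)} (hΩ : ∀ p ∈ Ω, p.1 ∈ U) {g : Coord n → ℝ}
    (hg : ContDiffOn ℝ ∞ g U) (k : Fin n) : dV k (pullX Ω hΩ g hg) = 0 :=
  smoothRing_ext fun p => by
    rw [← partialDeriv_snd_eq (F := fun x _ => g x) (fun _ => rfl)]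
    simp [partialDeriv]

/-- The functions on phase space that depend on `x` alone. -/
def baseRing {U : Set (Coord n)} (hΩ : ∀ p ∈ Ω, p.1 ∈ U) : Subalgebra ℝ (smoothRing Ω) where
  carrier := {f | ∃ g hg, f = pullX Ω hΩ g hg}
  mul_mem' := by
    rintro _ _ ⟨g, hg, rfl⟩ ⟨g', hg', rfl⟩
    exact ⟨g * g', hg.mul hg', rfl⟩
  add_mem' := by
    rintro _ _ ⟨g, hg, rfl⟩ ⟨g', hg', rfl⟩
    exact ⟨g + g', hg.add hg', rfl⟩
  algebraMap_mem' r := ⟨fun _ => r, contDiffOn_const, rfl⟩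

theorem pullX_mem {U : Set (Coord n)} (hΩ : ∀ p ∈ Ω, p.1 ∈ U) {g : Coord n → ℝ}
    (hg : ContDiffOn ℝ ∞ g U) : pullX Ω hΩ g hg ∈ baseRing hΩ := ⟨g, hg, rfl⟩

/-- The ring of smooth functions on an open subset of the tangent bundle of `U`. -/
def phaseRing {U : Set (Coord n)} (hU : IsOpen U) (hΩ : ∀ p ∈ Ω, p.1 ∈ U) :
    PhaseRing (Fin n) (smoothRing Ω) where
  X := dX
  V := dV
  y := coordY Ω
  base := baseRing hΩ
  half := algebraMap ℝ _ (1 / 2)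
  two_half := by
    rw [show (2 : smoothRing Ω) = algebraMap ℝ _ 2 from (map_ofNat _ 2).symm, ← map_mul]; norm_num
  V_y := dV_coordY
  X_y := dX_coordY
  VV _ _ _ := dirDeriv_comm _ _ _
  V_base := by rintro k _ ⟨g, hg, rfl⟩; exact dV_pullX hΩ hg k
  X_base := by rintro k _ ⟨g, hg, rfl⟩; rw [dX_pullX hU]; exact pullX_mem _ _

/-- The Ricci curvature of a Finsler metric in terms of its geodesic coefficients. -/
theorem ricciCurvature_eq_ev_ricci {U : Set (Coord n)} (hU : IsOpen U) (hΩ : ∀ p ∈ Ω, p.1 ∈ U)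
    {F : Coord n → Coord n → ℝ} {G : Fin n → smoothRing Ω}
    (hG : ∀ i, ∀ p : Ω, geodesicCoeff F i p.1.1 p.1.2 = ev p (G i)) (p : Ω) :
    ricciCurvature F p.1.1 p.1.2 = ev p ((phaseRing hU hΩ).ricci G) := by
  have hV : ∀ i k, ∀ p : Ω, partialDeriv k (fun y => geodesicCoeff F i p.1.1 y) p.1.2
      = ev p (dV k (G i)) := fun i k p => partialDeriv_snd_eq (hG i) k p
  simp only [ricciCurvature, riemannCurvature, PhaseRing.ricci, map_sum, map_sub, map_add, map_mul,
    map_ofNat]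
  refine Finset.sum_congr rfl fun m _ => ?_
  congr 1
  · congr 1
    · congr 1
      · rw [partialDeriv_fst_eq (hG m)]; rfl
      · refine Finset.sum_congr rfl fun k _ => ?_
        rw [partialDeriv_fst_eq (F := fun x y => partialDeriv m (fun y' => geodesicCoeff F m x y') y)
          (hV m m)]
        rfl
    · congr 1
      refine Finset.sum_congr rfl fun k _ => ?_
      rw [partialDeriv_snd_eq (F := fun x y => partialDeriv m (fun y' => geodesicCoeff F m x y') y)
          (hV m m), hG]
      rfl
  · refine Finset.sum_congr rfl fun k _ => ?_
    rw [hV, hV]; rfl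

/-- The geodesic coefficients are determined by a linear system if the fundamental tensor is
nondegenerate. -/
theorem geodesicCoeff_eq_ev {U : Set (Coord n)} (hU : IsOpen U) (hΩ : ∀ p ∈ Ω, p.1 ∈ U)
    {F : Coord n → Coord n → ℝ} {E : smoothRing Ω} (hE : ∀ p : Ω, F p.1.1 p.1.2 ^ 2 = ev p E)
    {G : Fin n → smoothRing Ω}
    (hG : ∀ l, ∑ m, ((phaseRing hU hΩ).half * dV l (dV m E)) * (4 * G m)
      = ∑ k, dX k (dV l E) * coordY Ω k - dX l E)
    (p : Ω) (hp : ∀ v : Fin n → ℝ,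
      (∀ l, ∑ m, ev p ((phaseRing hU hΩ).half * dV l (dV m E)) * v m = 0) → v = 0) (i : Fin n) :
    geodesicCoeff F i p.1.1 p.1.2 = ev p (G i) := by
  have hV : ∀ l, ∀ p : Ω, partialDeriv l (fun y => F p.1.1 y ^ 2) p.1.2 = ev p (dV l E) :=
    fun l p => partialDeriv_snd_eq (F := fun x y => F x y ^ 2) hE l p
  have hfund : ∀ l m, fundamentalTensor F p.1.1 p.1.2 l m
      = ev p ((phaseRing hU hΩ).half * dV l (dV m E)) := by
    intro l m
    rw [fundamentalTensor, Matrix.of_apply, partialDeriv_snd_eq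
      (F := fun x y => partialDeriv m (fun y' => F x y' ^ 2) y) (hV m), map_mul]
    rfl
  have hunit : IsUnit (fundamentalTensor F p.1.1 p.1.2) := by
    rw [← Matrix.mulVec_injective_iff_isUnit]
    refine (injective_iff_map_eq_zero
      (Matrix.mulVecLin (fundamentalTensor F p.1.1 p.1.2))).2 fun v hv => hp v fun l => ?_
    have := congrFun hv l
    simpa [Matrix.mulVec, dotProduct, hfund] using this
  have hdet : IsUnit (fundamentalTensor F p.1.1 p.1.2).det := (Matrix.isUnit_iff_isUnit_det _).1 hunit
  have hsys : (fundamentalTensor F p.1.1 p.1.2).mulVec (fun m => 4 * ev p (G m)) = fun l =>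
      (∑ k, partialDeriv k (fun x' => partialDeriv l (fun y' => F x' y' ^ 2) p.1.2) p.1.1 * p.1.2 k)
      - partialDeriv l (fun x' => F x' p.1.2 ^ 2) p.1.1 := by
    ext l
    have := congrArg (ev p) (hG l)
    simp only [map_sub, map_sum, map_mul, map_ofNat] at this
    simp only [Matrix.mulVec, dotProduct, hfund, map_mul]
    rw [partialDeriv_fst_eq (F := fun x y => F x y ^ 2) hE]
    simp only [partialDeriv_fst_eq (F := fun x y => partialDeriv l (fun y' => F x y' ^ 2) y) (hV l)]
    exact this
  have h4 := congrArg ((fundamentalTensor F p.1.1 p.1.2)⁻¹.mulVec) hsys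
  rw [Matrix.mulVec_mulVec, Matrix.nonsing_inv_mul _ hdet, Matrix.one_mulVec] at h4
  have h5 := congrFun h4 i
  rw [geodesicCoeff]
  simp only [Matrix.mulVec, dotProduct] at h5
  rw [← h5]; ring

end PhaseSpace

/-! ### The metric and the 1-form in one chart. -/

section LocalData

/-- A Riemannian metric and a nowhere vanishing 1-form with `s_j = 0` on an open subset
of `ℝⁿ`. -/
structure LocalKropina (n : ℕ) where
  U : Set (Coord n)
  isOpen : IsOpen U
  a : Coord n → Matrix (Fin n) (Fin n) ℝ
  b : Coord n → Fin n → ℝ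
  a_smooth : ∀ i j, ContDiffOn ℝ ∞ (fun u => a u i j) U
  b_smooth : ∀ i, ContDiffOn ℝ ∞ (fun u => b u i) U
  a_symm : ∀ u i j, a u i j = a u j i
  a_pos : ∀ u ∈ U, ∀ v : Fin n → ℝ, v ≠ 0 → 0 < ∑ i, (∑ j, a u i j * v j) * v i
  b_ne : ∀ u ∈ U, b u ≠ 0
  s_form : ∀ u ∈ U, ∀ j, sForm a b j u = 0

/-- Cramer's rule: each entry of the inverse is a quotient of determinants, polynomial in the
entries. -/
theorem contDiffOn_inv_apply {n : ℕ} {U : Set (Coord n)}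
    {a : Coord n → Matrix (Fin n) (Fin n) ℝ} (ha : ∀ i j, ContDiffOn ℝ ∞ (fun u => a u i j) U)
    (hdet : ∀ u ∈ U, (a u).det ≠ 0) (i j : Fin n) :
    ContDiffOn ℝ ∞ (fun u => (a u)⁻¹ i j) U := by
  have hd : ∀ c : Coord n → Matrix (Fin n) (Fin n) ℝ,
      (∀ i j, ContDiffOn ℝ ∞ (fun u => c u i j) U) → ContDiffOn ℝ ∞ (fun u => (c u).det) U := by
    intro c hc
    simp only [Matrix.det_apply]
    refine ContDiffOn.sum fun σ _ => ContDiffOn.const_smul _ ?_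
    exact contDiffOn_prod fun k _ => hc _ _
  have : ∀ u, (a u)⁻¹ i j = ((a u).det)⁻¹ * ((a u).updateRow j (Pi.single i 1)).det := by
    intro u
    rw [Matrix.inv_def, Matrix.smul_apply, Matrix.adjugate_apply, Ring.inverse_eq_inv', smul_eq_mul]
  simp only [this]
  refine ((hd a ha).inv hdet).mul (hd _ fun k l => ?_)
  by_cases h : k = j
  · subst h; simpa using contDiffOn_const
  · simpa [Matrix.updateRow_ne h] using ha k l

namespace LocalKropina

variable {n : ℕ} (L : LocalKropina n)

theorem isUnit_det {u : Coord n} (hu : u ∈ L.U) : IsUnit (L.a u).det := by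
  rw [← Matrix.isUnit_iff_isUnit_det, ← Matrix.mulVec_injective_iff_isUnit]
  refine (injective_iff_map_eq_zero (Matrix.mulVecLin (L.a u))).2 fun v hv => ?_
  by_contra h0
  have := L.a_pos u hu v h0
  have hz : ∀ i, ∑ j, L.a u i j * v j = 0 := fun i => congrFun hv i
  simp [hz] at this

theorem inv_smooth (i j : Fin n) : ContDiffOn ℝ ∞ (fun u => (L.a u)⁻¹ i j) L.U :=
  contDiffOn_inv_apply L.a_smooth (fun _ hu => (L.isUnit_det hu).ne_zero) i j

theorem inv_symm (u : Coord n) (i j : Fin n) : (L.a u)⁻¹ i j = (L.a u)⁻¹ j i := by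
  have h : (L.a u).transpose = L.a u := by ext i j; exact L.a_symm u j i
  have := congrFun (congrFun (Matrix.transpose_nonsing_inv (L.a u)) j) i
  rw [h] at this
  exact this

theorem inv_mul {u : Coord n} (hu : u ∈ L.U) (l k : Fin n) :
    ∑ i, (L.a u)⁻¹ l i * L.a u i k = if l = k then 1 else 0 := by
  have := congrFun (congrFun (Matrix.nonsing_inv_mul _ (L.isUnit_det hu)) l) k
  rwa [Matrix.mul_apply, Matrix.one_apply] at this

theorem mul_inv {u : Coord n} (hu : u ∈ L.U) (l k : Fin n) :
    ∑ i, L.a u l i * (L.a u)⁻¹ i k = if l = k then 1 else 0 := by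
  have := congrFun (congrFun (Matrix.mul_nonsing_inv _ (L.isUnit_det hu)) l) k
  rwa [Matrix.mul_apply, Matrix.one_apply] at this

theorem mul_inv_sum {u : Coord n} (hu : u ∈ L.U) (l : Fin n) (w : Fin n → ℝ) :
    ∑ i, L.a u l i * ∑ k, (L.a u)⁻¹ i k * w k = w l := by
  have : ∑ i, L.a u l i * ∑ k, (L.a u)⁻¹ i k * w k
      = ∑ k, (∑ i, L.a u l i * (L.a u)⁻¹ i k) * w k := by
    simp only [Finset.mul_sum, Finset.sum_mul]
    exact sum_comm_congr fun i j => by ring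
  rw [this]
  simp [L.mul_inv hu]

/-- The components `sⁱ_j`. -/
def su (i j : Fin n) (u : Coord n) : ℝ := ∑ k, (L.a u)⁻¹ i k * sTensor L.a L.b k j u

theorem christoffel_smooth (k i j : Fin n) : ContDiffOn ℝ ∞ (christoffel L.a k i j) L.U :=
  contDiffOn_const.mul <| ContDiffOn.sum fun l _ => (L.inv_smooth k l).mul <|
    ((contDiffOn_partialDeriv L.isOpen (L.a_smooth _ _) _).add
      (contDiffOn_partialDeriv L.isOpen (L.a_smooth _ _) _)).sub
      (contDiffOn_partialDeriv L.isOpen (L.a_smooth _ _) _)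

theorem covDeriv_smooth (i j : Fin n) : ContDiffOn ℝ ∞ (covDeriv L.a L.b i j) L.U :=
  (contDiffOn_partialDeriv L.isOpen (L.b_smooth _) _).sub <| ContDiffOn.sum fun k _ =>
    (L.christoffel_smooth k i j).mul (L.b_smooth k)

theorem rTensor_smooth (i j : Fin n) : ContDiffOn ℝ ∞ (rTensor L.a L.b i j) L.U :=
  contDiffOn_const.mul ((L.covDeriv_smooth i j).add (L.covDeriv_smooth j i))

theorem sTensor_smooth (i j : Fin n) : ContDiffOn ℝ ∞ (sTensor L.a L.b i j) L.U :=
  contDiffOn_const.mul ((L.covDeriv_smooth i j).sub (L.covDeriv_smooth j i))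

theorem bUp_smooth (i : Fin n) : ContDiffOn ℝ ∞ (bUp L.a L.b i) L.U :=
  ContDiffOn.sum fun k _ => (L.inv_smooth i k).mul (L.b_smooth k)

theorem bSq_smooth : ContDiffOn ℝ ∞ (bSq L.a L.b) L.U :=
  ContDiffOn.sum fun k _ => (L.bUp_smooth k).mul (L.b_smooth k)

theorem su_smooth (i j : Fin n) : ContDiffOn ℝ ∞ (L.su i j) L.U :=
  ContDiffOn.sum fun k _ => (L.inv_smooth i k).mul (L.sTensor_smooth k j)

theorem christoffel_symm (k i j : Fin n) (u : Coord n) :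
    christoffel L.a k i j u = christoffel L.a k j i u := by
  simp only [christoffel, fun v => L.a_symm v i j]
  congr 1
  exact Finset.sum_congr rfl fun l _ => by ring

theorem a_christoffel {u : Coord n} (hu : u ∈ L.U) (l i j : Fin n) :
    ∑ m, L.a u l m * christoffel L.a m i j u = (1 / 2) *
      (partialDeriv i (fun v => L.a v j l) u + partialDeriv j (fun v => L.a v i l) u
      - partialDeriv l (fun v => L.a v i j) u) := by
  rw [← L.mul_inv_sum hu l (fun l => (1 / 2) * (partialDeriv i (fun v => L.a v j l) u
    + partialDeriv j (fun v => L.a v i l) u - partialDeriv l (fun v => L.a v i j) u))]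
  refine Finset.sum_congr rfl fun m _ => ?_
  rw [christoffel, Finset.mul_sum]
  congr 1
  exact Finset.sum_congr rfl fun l _ => by ring

theorem partialDeriv_a {u : Coord n} (hu : u ∈ L.U) (k i j : Fin n) :
    partialDeriv k (fun v => L.a v i j) u =
      ∑ m, (christoffel L.a m k i u * L.a u m j + christoffel L.a m k j u * L.a u i m) := by
  rw [Finset.sum_add_distrib]
  have h1 := L.a_christoffel hu j k i
  have h2 := L.a_christoffel hu i k j
  have e1 : ∑ m, christoffel L.a m k i u * L.a u m j = ∑ m, L.a u j m * christoffel L.a m k i u :=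
    Finset.sum_congr rfl fun m _ => by rw [L.a_symm u m j]; ring
  have e2 : ∑ m, christoffel L.a m k j u * L.a u i m = ∑ m, L.a u i m * christoffel L.a m k j u :=
    Finset.sum_congr rfl fun m _ => by ring
  rw [e1, e2, h1, h2]
  simp only [fun v => L.a_symm v j i, fun v => L.a_symm v k j, fun v => L.a_symm v k i]
  ring

theorem partialDeriv_b (i j : Fin n) (u : Coord n) : partialDeriv j (fun v => L.b v i) u =
    ∑ k, christoffel L.a k i j u * L.b u k + (rTensor L.a L.b i j u + sTensor L.a L.b i j u) := by
  rw [rTensor, sTensor]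
  have : covDeriv L.a L.b i j u = partialDeriv j (fun v => L.b v i) u
    - ∑ k, christoffel L.a k i j u * L.b u k := rfl
  linear_combination -this

theorem a_bUp {u : Coord n} (hu : u ∈ L.U) (i : Fin n) :
    ∑ j, L.a u i j * bUp L.a L.b j u = L.b u i := L.mul_inv_sum hu i (L.b u)

theorem a_su {u : Coord n} (hu : u ∈ L.U) (i j : Fin n) :
    ∑ k, L.a u i k * L.su k j u = sTensor L.a L.b i j u :=
  L.mul_inv_sum hu i fun k => sTensor L.a L.b k j u

theorem rTensor_symm (i j : Fin n) (u : Coord n) :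
    rTensor L.a L.b i j u = rTensor L.a L.b j i u := by
  rw [rTensor, rTensor, add_comm]

theorem sTensor_anti (i j : Fin n) (u : Coord n) :
    sTensor L.a L.b i j u = -sTensor L.a L.b j i u := by
  rw [sTensor, sTensor]; ring

theorem su_trace (u : Coord n) : ∑ m, L.su m m u = 0 := by
  have h : ∑ m, L.su m m u = -∑ m, L.su m m u := by
    simp only [su, ← Finset.sum_neg_distrib]
    exact sum_comm_congr fun i j => by rw [L.inv_symm u i j, L.sTensor_anti]; ring
  linarith

theorem bSq_pos {u : Coord n} (hu : u ∈ L.U) : 0 < bSq L.a L.b u := by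
  have hne : (fun i => bUp L.a L.b i u) ≠ 0 := by
    intro h
    apply L.b_ne u hu
    ext i
    rw [← L.a_bUp hu i]
    exact Finset.sum_eq_zero fun j _ => by rw [show bUp L.a L.b j u = 0 from congrFun h j, mul_zero]
  have := L.a_pos u hu _ hne
  simp only [L.a_bUp hu] at this
  rw [bSq]
  convert this using 1
  exact Finset.sum_congr rfl fun i _ => mul_comm _ _

/-- The domain of the Kropina metric. -/
def domain : TopologicalSpace.Opens (Coord n × Coord n) :=
  ⟨{p | p.1 ∈ L.U ∧ 0 < ∑ i, L.b p.1 i * p.2 i}, by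
    have hc : ContinuousOn (fun p : Coord n × Coord n => ∑ i, L.b p.1 i * p.2 i)
        (Prod.fst ⁻¹' L.U) := by
      refine continuousOn_finsetSum _ fun i _ => ContinuousOn.mul ?_ (by fun_prop)
      exact (L.b_smooth i).continuousOn.comp continuousOn_fst fun p hp => hp
    exact hc.isOpen_inter_preimage (L.isOpen.preimage continuous_fst) isOpen_Ioi⟩

theorem domain_fst : ∀ p ∈ L.domain, p.1 ∈ L.U := fun _ hp => hp.1

/-- A function on `U` as a function on phase space. -/
abbrev pull (g : Coord n → ℝ) (hg : ContDiffOn ℝ ∞ g L.U) : smoothRing L.domain :=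
  pullX L.domain L.domain_fst g hg

/-- The inverse of a nowhere vanishing smooth function. -/
def invOf {W : Type*} [NormedAddCommGroup W] [NormedSpace ℝ W] {Ω : TopologicalSpace.Opens W}
    (f : smoothRing Ω) (hf : ∀ p, ev p f ≠ 0) : smoothRing Ω :=
  ⟨fun p => (ev p f)⁻¹, mem_smoothRing (ContDiffOn.inv f.2 fun p hp h =>
    hf ⟨p, hp⟩ ((zeroExt_apply f.1 ⟨p, hp⟩).symm.trans h)) fun p =>
    congrArg Inv.inv (zeroExt_apply f.1 p).symm⟩

theorem mul_invOf {W : Type*} [NormedAddCommGroup W] [NormedSpace ℝ W]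
    {Ω : TopologicalSpace.Opens W} (f : smoothRing Ω) (hf : ∀ p, ev p f ≠ 0) :
    f * invOf f hf = 1 :=
  smoothRing_ext fun p => by
    rw [map_mul, map_one]; exact mul_inv_cancel₀ (hf p)

theorem ne_zero_of_mem_domain (p : L.domain) : (fun i => p.1.2 i) ≠ 0 := by
  intro h
  have := p.2.2
  simp [fun i => congrFun h i] at this

/-- The 1-form `β` as an element of the ring. -/
def ringβ : smoothRing L.domain :=
  ∑ i, L.pull (fun u => L.b u i) (L.b_smooth i) * coordY L.domain i

/-- `α²` as an element of the ring. -/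
def ringH : smoothRing L.domain :=
  ∑ i, (∑ j, L.pull (fun u => L.a u i j) (L.a_smooth i j) * coordY L.domain j) * coordY L.domain i

theorem ev_ringβ (p : L.domain) : ev p L.ringβ = ∑ i, L.b p.1.1 i * p.1.2 i := by
  simp only [ringβ, map_sum, map_mul, ev_pullX, ev_coordY]

theorem ev_ringH (p : L.domain) :
    ev p L.ringH = ∑ i, (∑ j, L.a p.1.1 i j * p.1.2 j) * p.1.2 i := by
  simp only [ringH, map_sum, map_mul, ev_pullX, ev_coordY]

/-- The ring of smooth functions on the domain of the Kropina metric. -/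
def ring : KropinaRing (Fin n) (smoothRing L.domain) where
  toPhaseRing := phaseRing L.isOpen L.domain_fst
  a i j := L.pull (fun u => L.a u i j) (L.a_smooth i j)
  A i j := L.pull (fun u => (L.a u)⁻¹ i j) (L.inv_smooth i j)
  Γ k i j := L.pull (christoffel L.a k i j) (L.christoffel_smooth k i j)
  b i := L.pull (fun u => L.b u i) (L.b_smooth i)
  bu i := L.pull (bUp L.a L.b i) (L.bUp_smooth i)
  r i j := L.pull (rTensor L.a L.b i j) (L.rTensor_smooth i j)
  s i j := L.pull (sTensor L.a L.b i j) (L.sTensor_smooth i j)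
  su i j := L.pull (L.su i j) (L.su_smooth i j)
  βinv := invOf L.ringβ fun p => by rw [ev_ringβ]; exact p.2.2.ne'
  Hinv := invOf L.ringH fun p => by
    rw [ev_ringH]
    exact (L.a_pos _ p.2.1 _ (L.ne_zero_of_mem_domain p)).ne'
  Binv := L.pull (fun u => (bSq L.a L.b u)⁻¹) (L.bSq_smooth.inv fun u hu => (L.bSq_pos hu).ne')
  a_mem _ _ := pullX_mem _ _
  Γ_mem _ _ _ := pullX_mem _ _
  b_mem _ := pullX_mem _ _
  bu_mem _ := pullX_mem _ _
  r_mem _ _ := pullX_mem _ _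
  s_mem _ _ := pullX_mem _ _
  su_mem _ _ := pullX_mem _ _
  Binv_mem := pullX_mem _ _
  a_symm i j := smoothRing_ext fun p => L.a_symm _ _ _
  A_a l k := smoothRing_ext fun p => by
    simp only [map_sum, map_mul, ev_pullX, L.inv_mul p.2.1]
    split_ifs <;> simp
  Γ_symm k i j := smoothRing_ext fun p => L.christoffel_symm _ _ _ _
  X_a k i j := smoothRing_ext fun p => by
    simp only [phaseRing, map_sum, map_mul, map_add, ev_pullX, ev_dX_pullX,
      L.partialDeriv_a p.2.1]
  X_b i j := smoothRing_ext fun p => by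
    simp only [phaseRing, map_sum, map_mul, map_add, ev_pullX, ev_dX_pullX, L.partialDeriv_b]
  a_bu i := smoothRing_ext fun p => by
    simp only [map_sum, map_mul, ev_pullX, L.a_bUp p.2.1]
  a_su i j := smoothRing_ext fun p => by
    simp only [map_sum, map_mul, ev_pullX, L.a_su p.2.1]
  su_trace := smoothRing_ext fun p => by
    simp only [map_sum, ev_pullX, L.su_trace, map_zero]
  r_symm i j := smoothRing_ext fun p => L.rTensor_symm _ _ _
  s_anti i j := smoothRing_ext fun p => L.sTensor_anti _ _ _
  s_form j := smoothRing_ext fun p => by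
    simp only [map_sum, map_mul, ev_pullX, map_zero]
    exact L.s_form _ p.2.1 j
  β_inv := mul_invOf _ _
  H_inv := mul_invOf _ _
  B_inv := smoothRing_ext fun p => by
    have : ∑ i, L.b p.1.1 i * bUp L.a L.b i p.1.1 = bSq L.a L.b p.1.1 :=
      Finset.sum_congr rfl fun i _ => mul_comm _ _
    simp only [map_sum, map_mul, ev_pullX, map_one, this]
    exact mul_inv_cancel₀ (L.bSq_pos p.2.1).ne'

end LocalKropina

end LocalData

/-! ### Symmetric bilinear forms and a divisibility criterion. -/

section Forms

variable {n : ℕ}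

/-- The bilinear form with matrix `m`. -/
def bil (m : Fin n → Fin n → ℝ) (v w : Fin n → ℝ) : ℝ := ∑ i, (∑ j, m i j * v j) * w i

theorem bil_comb {m : Fin n → Fin n → ℝ} (hm : ∀ i j, m i j = m j i) (s t : ℝ)
    (v w : Fin n → ℝ) : bil m (fun i => s * v i + t * w i) (fun i => s * v i + t * w i)
      = s ^ 2 * bil m v v + 2 * s * t * bil m v w + t ^ 2 * bil m w w := by
  have hsymm : bil m w v = bil m v w := by
    simp only [bil, Finset.sum_mul]
    exact sum_comm_congr fun i j => by rw [hm]; ring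
  have : bil m (fun i => s * v i + t * w i) (fun i => s * v i + t * w i)
      = s ^ 2 * bil m v v + s * t * bil m v w + s * t * bil m w v + t ^ 2 * bil m w w := by
    simp only [bil, Finset.sum_mul, Finset.mul_sum, ← Finset.sum_add_distrib]
    exact Finset.sum_congr rfl fun i _ => Finset.sum_congr rfl fun j _ => by ring
  rw [this, hsymm]; ring

theorem bil_single (m : Fin n → Fin n → ℝ) (i j : Fin n) :
    bil m (Pi.single j 1) (Pi.single i 1) = m i j := by
  simp [bil, Pi.single_apply]

/-- Symmetric bilinear forms with proportional quadratic forms are proportional. -/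
theorem eq_of_quadratic {m m' : Fin n → Fin n → ℝ} (hm : ∀ i j, m i j = m j i)
    (hm' : ∀ i j, m' i j = m' j i) (c : ℝ) (h : ∀ v, bil m v v = c * bil m' v v) (i j : Fin n) :
    m i j = c * m' i j := by
  have h1 := h (fun k => 1 * Pi.single (M := fun _ => ℝ) j 1 k + 1 * Pi.single (M := fun _ => ℝ) i 1 k)
  rw [bil_comb hm, bil_comb hm', h, h] at h1
  simp only [bil_single] at h1
  linarith

open Polynomial in
/-- If `p X² + q` divides the square of a quadratic polynomial, it is proportional to it. -/
theorem quadratic_of_dvd_sq {p q k A B C : ℝ} (hp : 0 < p) (hq : 0 < q) (hk : k ≠ 0) (f : ℝ[X])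
    (h : ∀ s, k * (A + 2 * s * B + s ^ 2 * C) ^ 2 = (q + s ^ 2 * p) * f.eval s) :
    B = 0 ∧ A * p = C * q := by
  have hpoly : (Polynomial.C k * (Polynomial.C A + 2 * X * Polynomial.C B + X ^ 2 * Polynomial.C C) ^ 2
      : ℝ[X]) = (Polynomial.C q + X ^ 2 * Polynomial.C p) * f := by
    refine Polynomial.funext fun s => ?_
    have := h s
    simp
    linarith
  -- The purely imaginary number `I * d` is a root of `p X² + q`, so it annihilates the squared
  -- quadratic and hence the quadratic itself. The imaginary part gives `B = 0`, the real part `A p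
  -- = C q`.
  set d := Real.sqrt (q / p) with hd
  have hd2 : d ^ 2 = q / p := Real.sq_sqrt (by positivity)
  have hdpos : 0 < d := Real.sqrt_pos.2 (by positivity)
  have h2 := congrArg (Polynomial.aeval (Complex.I * (d : ℂ))) hpoly
  have hz : (Complex.I * (d : ℂ)) ^ 2 = ((-(q / p) : ℝ) : ℂ) := by
    rw [mul_pow, Complex.I_sq, ← Complex.ofReal_pow, hd2]; push_cast; ring
  simp only [map_mul, map_add, map_pow, Polynomial.aeval_C, Polynomial.aeval_X, hz, map_ofNat,
    Complex.coe_algebraMap] at h2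
  have h3 : ((q : ℂ) + ((-(q / p) : ℝ) : ℂ) * (p : ℂ)) = 0 := by
    rw [← Complex.ofReal_mul, ← Complex.ofReal_add]
    rw [show q + -(q / p) * p = 0 by field_simp; ring]; simp
  rw [h3, zero_mul] at h2
  have h4 := (mul_eq_zero.1 h2).resolve_left (by exact_mod_cast hk)
  have h5 : (A : ℂ) + 2 * (Complex.I * d) * B + ((-(q / p) : ℝ) : ℂ) * C = 0 :=
    pow_eq_zero_iff (two_ne_zero) |>.1 h4
  have hre := congrArg Complex.re h5
  have him := congrArg Complex.im h5
  simp at hre him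
  refine ⟨him.resolve_left hdpos.ne', ?_⟩
  field_simp at hre
  linarith

end Forms

/-! ### The Einstein condition on `F` forces `r_ij` to be a multiple of `a_ij`. -/

namespace LocalKropina

variable {n : ℕ} (L : LocalKropina n)

/-- The Kropina metric in coordinates. -/
def kropinaF (x y : Coord n) : ℝ := bil (L.a x) y y / ∑ i, L.b x i * y i

/-- The Riemannian metric in coordinates, as a Finsler metric. -/
def alphaF (x y : Coord n) : ℝ := Real.sqrt (bil (L.a x) y y)

theorem bil_pos {u : Coord n} (hu : u ∈ L.U) {v : Fin n → ℝ} (hv : v ≠ 0) :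
    0 < bil (L.a u) v v := L.a_pos u hu v hv

theorem bil_nonneg {u : Coord n} (hu : u ∈ L.U) (v : Fin n → ℝ) : 0 ≤ bil (L.a u) v v := by
  by_cases hv : v = 0
  · simp [hv, bil]
  · exact (L.bil_pos hu hv).le

theorem cauchy_schwarz {u : Coord n} (hu : u ∈ L.U) {y : Fin n → ℝ} (hy : y ≠ 0)
    (v : Fin n → ℝ) : bil (L.a u) y v ^ 2 ≤ bil (L.a u) y y * bil (L.a u) v v := by
  have h := L.bil_nonneg hu fun i => (-bil (L.a u) y v) * y i + bil (L.a u) y y * v i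
  rw [bil_comb (L.a_symm u)] at h
  have hpos := L.bil_pos hu hy
  have : 0 ≤ bil (L.a u) y y * (bil (L.a u) y y * bil (L.a u) v v - bil (L.a u) y v ^ 2) := by
    linarith
  linarith [nonneg_of_mul_nonneg_right this hpos]

theorem ev_H (p : L.domain) : ev p L.ring.H = bil (L.a p.1.1) p.1.2 p.1.2 := L.ev_ringH p

theorem ev_β (p : L.domain) : ev p L.ring.β = ∑ i, L.b p.1.1 i * p.1.2 i := L.ev_ringβ p

theorem ev_βinv (p : L.domain) : ev p L.ring.βinv = (∑ i, L.b p.1.1 i * p.1.2 i)⁻¹ := by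
  rw [← L.ev_ringβ]; rfl

theorem ev_half (p : L.domain) : ev p L.ring.half = 1 / 2 := rfl

theorem ev_E (p : L.domain) : L.kropinaF p.1.1 p.1.2 ^ 2 = ev p L.ring.E := by
  rw [KropinaRing.E, map_pow, map_mul, ev_H, ev_βinv]; rfl

theorem ev_yl_dot (p : L.domain) (v : Fin n → ℝ) :
    ∑ i, ev p (L.ring.yl i) * v i = bil (L.a p.1.1) p.1.2 v := by
  simp only [KropinaRing.yl, map_sum, map_mul, bil]
  rfl

theorem fund_nondegenerate (p : L.domain) (v : Fin n → ℝ)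
    (h : ∀ l, ∑ m, ev p (L.ring.half * L.ring.V l (L.ring.V m L.ring.E)) * v m = 0) : v = 0 := by
  by_contra hv
  set bi := (∑ i, L.b p.1.1 i * p.1.2 i)⁻¹ with hbi
  have hbipos : 0 < bi := inv_pos.2 p.2.2
  set H := bil (L.a p.1.1) p.1.2 p.1.2 with hH
  set P := bil (L.a p.1.1) p.1.2 v
  set q := ∑ i, L.b p.1.1 i * v i
  have hHpos : 0 < H := L.bil_pos p.2.1 (L.ne_zero_of_mem_domain p)
  have hA : 0 < bil (L.a p.1.1) v v := L.bil_pos p.2.1 hv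
  have hcs : P ^ 2 ≤ H * bil (L.a p.1.1) v v := L.cauchy_schwarz p.2.1 (L.ne_zero_of_mem_domain p) v
  have hsum : ∑ l, (∑ m, ev p (L.ring.half * L.ring.V l (L.ring.V m L.ring.E)) * v m) * v l
      = 2 * H * bi ^ 2 * bil (L.a p.1.1) v v + 4 * bi ^ 2 * P ^ 2 - 8 * H * bi ^ 3 * P * q
        + 3 * H ^ 2 * bi ^ 4 * q ^ 2 := by
    have e : ∀ l m, ev p (L.ring.half * L.ring.V l (L.ring.V m L.ring.E)) =
        2 * H * bi ^ 2 * L.a p.1.1 l m + 4 * bi ^ 2 * ev p (L.ring.yl l) * ev p (L.ring.yl m)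
        - 4 * H * bi ^ 3 * (ev p (L.ring.yl l) * L.b p.1.1 m + ev p (L.ring.yl m) * L.b p.1.1 l)
        + 3 * H ^ 2 * bi ^ 4 * L.b p.1.1 l * L.b p.1.1 m := by
      intro l m
      rw [KropinaRing.half_V_V_E]
      simp only [map_add, map_sub, map_mul, map_pow, map_ofNat, ev_H, ev_βinv]
      rfl
    have h1 := L.ev_yl_dot p v
    have h2 : P ^ 2 = ∑ l, ∑ m, (ev p (L.ring.yl l) * v l) * (ev p (L.ring.yl m) * v m) := by
      rw [← Finset.sum_mul_sum, h1]; ring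
    have h3 : P * q = ∑ l, ∑ m, (ev p (L.ring.yl l) * v l) * (L.b p.1.1 m * v m) := by
      rw [← Finset.sum_mul_sum, h1]
    have h4 : P * q = ∑ l, ∑ m, (L.b p.1.1 l * v l) * (ev p (L.ring.yl m) * v m) := by
      rw [← Finset.sum_mul_sum, h1]; ring
    have h5 : q ^ 2 = ∑ l, ∑ m, (L.b p.1.1 l * v l) * (L.b p.1.1 m * v m) := by
      rw [← Finset.sum_mul_sum]; ring
    have h6 : 8 * H * bi ^ 3 * P * q = 4 * H * bi ^ 3 * (P * q) + 4 * H * bi ^ 3 * (P * q) := by ring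
    rw [h6]
    nth_rw 1 [h3]
    have h7 : bil (L.a p.1.1) v v = ∑ l, ∑ m, L.a p.1.1 l m * v m * v l := by
      simp only [bil, Finset.sum_mul]
    rw [h2, h4, h5, h7]
    simp only [e, Finset.sum_mul, Finset.mul_sum, ← Finset.sum_add_distrib,
      ← Finset.sum_sub_distrib]
    exact Finset.sum_congr rfl fun l _ => Finset.sum_congr rfl fun m _ => by ring
  simp only [h, zero_mul, Finset.sum_const_zero] at hsum
  have hb2 : 0 < bi ^ 2 := by positivity
  have : bi ^ 2 * (2 * (H * bil (L.a p.1.1) v v) + 4 * P ^ 2 - 8 * (H * bi * q) * P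
      + 3 * (H * bi * q) ^ 2) = 0 := by rw [hsum]; ring
  have h0 := (mul_eq_zero.1 this).resolve_left hb2.ne'
  -- With `X = H * bi * q` and `|v|² = bil a v v` the bracket equals `(3X - 4P)²/3 + 2 H |v|² -
  -- 4P²/3`. By Cauchy-Schwarz this is at least `2 H |v|² / 3 > 0`.
  nlinarith [sq_nonneg (3 * (H * bi * q) - 4 * P), mul_pos hHpos hA]

theorem geodesicCoeff_kropinaF (i : Fin n) (p : L.domain) :
    geodesicCoeff L.kropinaF i p.1.1 p.1.2 = ev p (L.ring.G i) :=
  geodesicCoeff_eq_ev L.isOpen L.domain_fst L.ev_E L.ring.fund_G p (L.fund_nondegenerate p) i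

theorem ricciCurvature_kropinaF (p : L.domain) :
    ricciCurvature L.kropinaF p.1.1 p.1.2 = ev p (L.ring.ricci L.ring.G) :=
  ricciCurvature_eq_ev_ricci L.isOpen L.domain_fst L.geodesicCoeff_kropinaF p

theorem alphaF_sq (p : L.domain) : L.alphaF p.1.1 p.1.2 ^ 2 = ev p L.ring.H := by
  rw [ev_H, alphaF, Real.sq_sqrt (L.bil_nonneg p.2.1 _)]

theorem metric_nondegenerate (p : L.domain) (v : Fin n → ℝ)
    (h : ∀ l, ∑ m, ev p (L.ring.half * L.ring.V l (L.ring.V m L.ring.H)) * v m = 0) : v = 0 := by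
  by_contra hv
  have hA : 0 < bil (L.a p.1.1) v v := L.bil_pos p.2.1 hv
  have e : ∀ l m, ev p (L.ring.half * L.ring.V l (L.ring.V m L.ring.H)) = L.a p.1.1 l m := by
    intro l m
    have : L.ring.half * L.ring.V l (L.ring.V m L.ring.H) = L.ring.a m l := by
      rw [KropinaRing.V_H, deriv_mul', deriv_two', KropinaRing.V_yl]
      linear_combination L.ring.a m l * L.ring.two_half
    rw [this]
    exact L.a_symm _ _ _
  simp only [e] at h
  simp [bil, h] at hA

theorem geodesicCoeff_alphaF (i : Fin n) (p : L.domain) :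
    geodesicCoeff L.alphaF i p.1.1 p.1.2 = ev p (L.ring.half * L.ring.g2 i) :=
  geodesicCoeff_eq_ev (G := fun i => L.ring.half * L.ring.g2 i) L.isOpen L.domain_fst L.alphaF_sq
    L.ring.metric_g2 p (L.metric_nondegenerate p) i

theorem ricciCurvature_alphaF (p : L.domain) :
    ricciCurvature L.alphaF p.1.1 p.1.2 = ev p (L.ring.ricci fun i => L.ring.half * L.ring.g2 i) :=
  ricciCurvature_eq_ev_ricci (G := fun i => L.ring.half * L.ring.g2 i) L.isOpen L.domain_fst
    L.geodesicCoeff_alphaF p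

/-- `bⁱ + s vⁱ`. -/
def line (x : Coord n) (v : Fin n → ℝ) (s : ℝ) : Coord n :=
  WithLp.toLp 2 fun i => 1 * bUp L.a L.b i x + s * v i

theorem b_line {x : Coord n} {v : Fin n → ℝ} (hv : ∑ i, L.b x i * v i = 0) (s : ℝ) :
    ∑ i, L.b x i * L.line x v s i = bSq L.a L.b x := by
  have : ∑ i, L.b x i * L.line x v s i
      = ∑ i, bUp L.a L.b i x * L.b x i + s * ∑ i, L.b x i * v i := by
    rw [Finset.mul_sum, ← Finset.sum_add_distrib]
    exact Finset.sum_congr rfl fun i _ => by simp only [line]; ring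
  rw [this, hv, mul_zero, add_zero, bSq]

theorem line_mem {x : Coord n} (hx : x ∈ L.U) {v : Fin n → ℝ} (hv : ∑ i, L.b x i * v i = 0)
    (s : ℝ) : (x, L.line x v s) ∈ L.domain :=
  ⟨hx, by
    change 0 < ∑ i, L.b x i * L.line x v s i
    rw [L.b_line hv]; exact L.bSq_pos hx⟩

open Polynomial in
-- Along `b + s v` with `v` orthogonal to `b`, the value of `β` is the constant `b²`; so even `βinv`
-- restricts to a constant.
theorem exists_polynomial {x : Coord n} (hx : x ∈ L.U) {v : Fin n → ℝ}
    (hv : ∑ i, L.b x i * v i = 0) {f : smoothRing L.domain} (hf : f ∈ L.ring.fibrePoly) :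
    ∃ q : ℝ[X], ∀ s, ev ⟨(x, L.line x v s), L.line_mem hx hv s⟩ f = q.eval s := by
  induction hf using Algebra.adjoin_induction with
  | mem f hf =>
    rcases hf with ((⟨g, hg, rfl⟩ | ⟨i, rfl⟩) | rfl)
    · exact ⟨C (g x), fun s => by rw [ev_pullX, eval_C]⟩
    · exact ⟨C (bUp L.a L.b i x) + X * C (v i), fun s => by
        simp [ring, phaseRing, ev_coordY, line]
        exact mul_comm _ _⟩
    · exact ⟨C (bSq L.a L.b x)⁻¹, fun s => by rw [ev_βinv, eval_C, L.b_line hv]⟩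
  | algebraMap r => exact ⟨C r, fun s => by rw [eval_C, AlgHom.commutes]; rfl⟩
  | add f g _ _ hf hg =>
    obtain ⟨p, hp⟩ := hf
    obtain ⟨q, hq⟩ := hg
    exact ⟨p + q, fun s => by rw [map_add, hp, hq, eval_add]⟩
  | mul f g _ _ hf hg =>
    obtain ⟨p, hp⟩ := hf
    obtain ⟨q, hq⟩ := hg
    exact ⟨p * q, fun s => by rw [map_mul, hp, hq, eval_mul]⟩

/-- The conformal factor of `β`. -/
def c (u : Coord n) : ℝ :=
  (∑ i, (∑ j, rTensor L.a L.b i j u * bUp L.a L.b j u) * bUp L.a L.b i u) * (bSq L.a L.b u)⁻¹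

theorem ev_r00 (p : L.domain) :
    ev p L.ring.r00 = bil (fun i j => rTensor L.a L.b i j p.1.1) p.1.2 p.1.2 := by
  simp only [KropinaRing.r00, KropinaRing.r0, map_sum, map_mul, bil]
  rfl

theorem bil_bUp {u : Coord n} (hu : u ∈ L.U) (v : Fin n → ℝ) :
    bil (L.a u) (fun i => bUp L.a L.b i u) v = ∑ i, L.b u i * v i := by
  simp only [bil, L.a_bUp hu]

theorem bil_bUp_self {u : Coord n} (hu : u ∈ L.U) :
    bil (L.a u) (fun i => bUp L.a L.b i u) (fun i => bUp L.a L.b i u) = bSq L.a L.b u := by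
  rw [L.bil_bUp hu, bSq]
  exact Finset.sum_congr rfl fun i _ => mul_comm _ _

/-- If `α² / β` is an Einstein metric, `β` is conformal. -/
theorem rTensor_eq (hn : 2 ≤ n) {u : Coord n} (hu : u ∈ L.U) {σ : ℝ}
    (hF : ∀ y, 0 < ∑ i, L.b u i * y i →
      ricciCurvature L.kropinaF u y = σ * L.kropinaF u y ^ 2) (i j : Fin n) :
    rTensor L.a L.b i j u = L.c u * L.a u i j := by
  set B := bSq L.a L.b u with hB
  have hBpos : 0 < B := L.bSq_pos hu
  set r : Fin n → Fin n → ℝ := fun i j => rTensor L.a L.b i j u with hr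
  have hrs : ∀ i j, r i j = r j i := fun i j => L.rTensor_symm i j u
  set bu : Fin n → ℝ := fun i => bUp L.a L.b i u with hbu
  have hc : L.c u * B = bil r bu bu := by
    rw [c, ← hB, mul_assoc, inv_mul_cancel₀ hBpos.ne', mul_one]; rfl
  have horth : ∀ v : Fin n → ℝ, ∑ i, L.b u i * v i = 0 →
      bil r bu v = 0 ∧ bil r v v = L.c u * bil (L.a u) v v := by
    intro v hv
    by_cases hv0 : v = 0
    · subst hv0; simp [bil]
    have hA := L.bil_pos hu hv0
    obtain ⟨z, hz, hric⟩ := L.ring.exists_H_sq_mul_ricci_G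
    have h2 : (L.ring.H ^ 3 * L.ring.βinv ^ 2) ∈ L.ring.fibrePoly :=
      mul_mem (pow_mem L.ring.H_fibrePoly 3) (pow_mem L.ring.βinv_fibrePoly 2)
    obtain ⟨q1, hq1⟩ := L.exists_polynomial hu hv hz
    obtain ⟨q2, hq2⟩ := L.exists_polynomial hu hv h2
    have hn' : (3 * ((n : ℝ) - 1)) ≠ 0 := by
      have : (2 : ℝ) ≤ n := by exact_mod_cast hn
      intro h; linarith
    -- The Einstein equation turns `H² Ric` into `σ H⁴ βinv²`, so the cofactor of `H` is `σ H³ βinv²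
    -- - z`, restricted to the line.
    have key := quadratic_of_dvd_sq (p := bil (L.a u) v v) (q := B) (k := 3 * ((n : ℝ) - 1))
      (A := bil r bu bu) (B := bil r bu v) (C := bil r v v) hA hBpos hn'
      (Polynomial.C σ * q2 - q1) ?_
    · refine ⟨key.1, ?_⟩
      have := key.2
      rw [← hc] at this
      have h3 : B * (bil r v v - L.c u * bil (L.a u) v v) = 0 := by linarith
      linarith [(mul_eq_zero.1 h3).resolve_left hBpos.ne']
    · intro s
      set p : L.domain := ⟨(u, L.line u v s), L.line_mem hu hv s⟩ with hp
      have hH : ev p L.ring.H = B + s ^ 2 * bil (L.a u) v v := by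
        rw [ev_H]
        have := bil_comb (L.a_symm u) 1 s bu v
        rw [L.bil_bUp_self hu, L.bil_bUp hu v, hv] at this
        exact this.trans (by ring)
      have hr00 : ev p L.ring.r00 = bil r bu bu + 2 * s * bil r bu v + s ^ 2 * bil r v v := by
        rw [ev_r00]
        exact (bil_comb hrs 1 s bu v).trans (by ring)
      have hβ : ev p L.ring.β = B := by rw [ev_β]; exact L.b_line hv s
      have hBi : ev p L.ring.Binv = B⁻¹ := rfl
      have e := congrArg (ev p) hric
      have hR := hF (L.line u v s) (L.line_mem hu hv s).2
      have hR' : ev p (L.ring.ricci L.ring.G) = σ * (ev p L.ring.H * ev p L.ring.βinv) ^ 2 := by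
        rw [← L.ricciCurvature_kropinaF p, hR, L.ev_E p, KropinaRing.E, map_pow, map_mul]
      simp only [map_add, map_mul, map_pow, map_sub, map_natCast, map_one, map_ofNat, hR', hβ, hBi,
        hr00, Fintype.card_fin] at e
      rw [Polynomial.eval_sub, Polynomial.eval_mul, Polynomial.eval_C, ← hq1, ← hq2, ← hp, ← hH,
        map_mul, map_pow, map_pow]
      have hBB : B * B⁻¹ = 1 := mul_inv_cancel₀ hBpos.ne'
      linear_combination -e - 3 * ((n : ℝ) - 1) * (bil r bu bu + 2 * s * bil r bu v
        + s ^ 2 * bil r v v) ^ 2 * (B * B⁻¹ + 1) * hBB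
  -- Every `y` splits as `s b + v` with `v` orthogonal to `b`, and both quadratic forms are diagonal
  -- for this splitting by `horth`.
  refine eq_of_quadratic (m' := L.a u) hrs (L.a_symm u) (L.c u) (fun y => ?_) i j
  set s := (∑ i, L.b u i * y i) / B with hs
  set v : Fin n → ℝ := fun i => y i - s * bu i with hvdef
  have hv : ∑ i, L.b u i * v i = 0 := by
    have h1 : ∑ i, L.b u i * bu i = B := by
      rw [hB, bSq]; exact Finset.sum_congr rfl fun i _ => mul_comm _ _
    have : ∑ i, L.b u i * v i = ∑ i, L.b u i * y i - s * ∑ i, L.b u i * bu i := by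
      rw [Finset.mul_sum, ← Finset.sum_sub_distrib]
      exact Finset.sum_congr rfl fun i _ => by rw [hvdef]; ring
    rw [this, h1, hs]; field_simp; ring
  obtain ⟨h1, h2⟩ := horth v hv
  have hy : y = fun i => s * bu i + 1 * v i := by ext i; rw [hvdef]; ring
  rw [hy, bil_comb hrs, bil_comb (L.a_symm u), h1, h2, L.bil_bUp_self hu, L.bil_bUp hu v, hv, ← hc]
  ring

end LocalKropina

/-! ### Pointwise consequences of the two Einstein equations. -/

namespace KropinaRing

variable {ι R : Type*} [Fintype ι] [DecidableEq ι] [CommRing R] [Algebra ℝ R]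
  (K : KropinaRing ι R)

theorem ell_mem (i : ι) : K.ell i ∈ K.base :=
  sum_mem fun m _ => add_mem (sub_mem (K.X_base m _ (K.su_mem m i))
    (sum_mem fun j _ => mul_mem (K.su_mem m j) (K.Γ_mem j m i)))
    (sum_mem fun k _ => mul_mem (K.Γ_mem m m k) (K.su_mem k i))

theorem X_B {c : R} (hr : ∀ i j, K.r i j = c * K.a i j) (k : ι) : K.X k K.B = 2 * (c * K.b k) := by
  have h1 : ∀ i, K.X k (K.bu i) = (if i = k then c else 0) + K.su i k
      - ∑ j, K.Γ i k j * K.bu j := fun i => by rw [← K.X_bu hr k i]; ring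
  have e1 : ∑ i, K.b i * ∑ j, K.Γ i k j * K.bu j = ∑ i, K.bu i * ∑ j, K.Γ j i k * K.b j := by
    simp only [Finset.mul_sum]
    exact sum_comm_congr fun i j => by rw [K.Γ_symm]; ring
  have e2 : ∑ i, K.bu i * (c * K.a i k) = c * K.b k := by
    rw [← K.a_bu, Finset.mul_sum]
    exact Finset.sum_congr rfl fun i _ => by rw [K.a_symm]; ring
  simp only [B, map_sum, deriv_mul', h1, K.X_b, hr, mul_add, mul_sub, Finset.sum_add_distrib,
    Finset.sum_sub_distrib, e1, e2, b_su, K.s_form]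
  simp; ring

/-- If `κ` satisfies `κ_k = -κ² b_k`, then `κ² s_ij = 0`. -/
theorem sq_mul_s_eq_zero {κ : R} (hκ : ∀ k, K.X k κ = -(κ ^ 2 * K.b k))
    (hcomm : ∀ j k, K.X j (K.X k κ) = K.X k (K.X j κ)) (i j : ι) : κ ^ 2 * K.s i j = 0 := by
  -- In the difference of the mixed derivatives of `κ`, the terms `dκ ∧ β` vanish because `dκ` is
  -- parallel to `β`; only `κ² dβ`, that is `κ² s_ij`, survives.
  have h := hcomm j i
  rw [hκ, hκ, map_neg, map_neg, deriv_mul', deriv_mul', K.X_b, K.X_b, K.r_symm j i, K.s_anti j i]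
    at h
  simp only [sq, deriv_mul', hκ, K.Γ_symm _ j i] at h
  linear_combination -K.half * h - κ ^ 2 * K.s i j * K.two_half

end KropinaRing

/-- Only positive `s` are available, since `β` must be positive on the line; five values determine a
quartic. -/
theorem quartic_coeff_eq_zero {c0 c1 c2 c3 c4 : ℝ}
    (h : ∀ s : ℝ, 0 < s → c0 + c1 * s + c2 * s ^ 2 + c3 * s ^ 3 + c4 * s ^ 4 = 0) :
    c0 = 0 ∧ c1 = 0 ∧ c2 = 0 ∧ c3 = 0 ∧ c4 = 0 := by
  have h1 := h 1 (by norm_num)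
  have h2 := h 2 (by norm_num)
  have h3 := h 3 (by norm_num)
  have h4 := h 4 (by norm_num)
  have h5 := h 5 (by norm_num)
  norm_num at h1 h2 h3 h4 h5
  refine ⟨?_, ?_, ?_, ?_, ?_⟩ <;> linarith

/-- The consequences of the Einstein equation along a line `v + s b`. -/
theorem einstein_line {τ μ h B lv lb mv mb k N : ℝ} (hh : 0 < h) (hB : 0 < B) (hN : 0 < N)
    (H : ∀ s : ℝ, 0 < s → τ * (h + s ^ 2 * B) ^ 2 = (s * B) * (μ * (h + s ^ 2 * B) * (s * B)
      - (h + s ^ 2 * B) * (lv + s * lb) + N * (s * B) ^ 2 * (mv + s * mb + k * (s * B)))) :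
    τ = 0 ∧ lv = 0 ∧ lb = μ * B ∧ mv = 0 ∧ mb = -(k * B) := by
  -- The right side is divisible by `s B`, so the constant term alone gives `τ = 0`. Each later
  -- coefficient then isolates one unknown; those of degree 3 and 4 need `N > 0`.
  obtain ⟨h0, h1, h2, h3, h4⟩ := quartic_coeff_eq_zero
    (c0 := τ * h ^ 2) (c1 := B * h * lv) (c2 := 2 * τ * h * B - B * (μ * h * B - h * lb))
    (c3 := B * (B * lv) - B * (N * B ^ 2 * mv))
    (c4 := τ * B ^ 2 - B * (μ * B * B - B * lb + N * B ^ 2 * (mb + k * B)))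
    fun s hs => by linear_combination H s hs
  have hτ : τ = 0 := by simpa [hh.ne'] using h0
  have hlv : lv = 0 := by simpa [hh.ne', hB.ne'] using h1
  rw [hτ] at h2 h4
  rw [hlv] at h3
  have hlb : lb = μ * B := by
    have : (B * h) * (lb - μ * B) = 0 := by linarith
    have := (mul_eq_zero.1 this).resolve_left (by positivity)
    linarith
  have hmv : mv = 0 := by
    have : (N * B ^ 3) * mv = 0 := by linarith
    exact (mul_eq_zero.1 this).resolve_left (by positivity)
  refine ⟨hτ, hlv, hlb, hmv, ?_⟩
  rw [hlb] at h4
  have : (N * B ^ 3) * (mb + k * B) = 0 := by linarith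
  linarith [(mul_eq_zero.1 this).resolve_left (by positivity)]

theorem exists_orthogonal {n : ℕ} (hn : 2 ≤ n) (b : Fin n → ℝ) :
    ∃ v : Fin n → ℝ, v ≠ 0 ∧ ∑ i, b i * v i = 0 := by
  set i0 : Fin n := ⟨0, by omega⟩
  set i1 : Fin n := ⟨1, by omega⟩
  have h01 : i0 ≠ i1 := by simp [i0, i1]
  by_cases h : b i0 = 0
  · exact ⟨Pi.single i0 1, by simp, by simp [h, Pi.single_apply]⟩
  · refine ⟨fun k => b i1 * Pi.single (M := fun _ => ℝ) i0 1 k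
      - b i0 * Pi.single (M := fun _ => ℝ) i1 1 k, fun h0 => h ?_, ?_⟩
    · have := congrFun h0 i1
      simpa [Pi.single_apply, h01.symm] using this
    · simp [mul_sub, Finset.sum_sub_distrib, Pi.single_apply]; ring

namespace LocalKropina

variable {n : ℕ} (L : LocalKropina n)

theorem c_smooth : ContDiffOn ℝ ∞ L.c L.U :=
  ContDiffOn.mul (ContDiffOn.sum fun i _ => (ContDiffOn.sum fun j _ =>
    (L.rTensor_smooth i j).mul (L.bUp_smooth j)).mul (L.bUp_smooth i))
    (L.bSq_smooth.inv fun _ hu => (L.bSq_pos hu).ne')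

/-- `c / b²`. -/
def kappa (u : Coord n) : ℝ := L.c u * (bSq L.a L.b u)⁻¹

theorem kappa_smooth : ContDiffOn ℝ ∞ L.kappa L.U :=
  L.c_smooth.mul (L.bSq_smooth.inv fun _ hu => (L.bSq_pos hu).ne')

/-- `sⁱ_m sᵐ_i`. -/
def t (u : Coord n) : ℝ := ∑ i, ∑ m, L.su i m u * L.su m i u

theorem ev_t (p : L.domain) : ev p L.ring.t = L.t p.1.1 := by
  simp only [KropinaRing.t, t, map_sum, map_mul]; rfl

theorem ev_B (p : L.domain) : ev p L.ring.B = bSq L.a L.b p.1.1 := by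
  simp only [KropinaRing.B, bSq, map_sum, map_mul]
  exact Finset.sum_congr rfl fun i _ => mul_comm _ _

/-- The point `(u, b)` of the domain. -/
def base (u : Coord n) (hu : u ∈ L.U) : L.domain :=
  ⟨(u, L.line u 0 0), L.line_mem hu (by simp) 0⟩

/-- With `A` the inverse metric and `S` skew, `t = tr(A S A S) = -tr(A · S A Sᵀ)`. Decomposing the
positive semidefinite `S A Sᵀ` as a sum of `v vᵀ`, each summand has trace `vᵀ A v ≥ 0`. -/
theorem t_nonpos {u : Coord n} (hu : u ∈ L.U) : L.t u ≤ 0 := by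
  set S : Matrix (Fin n) (Fin n) ℝ := Matrix.of fun i j => sTensor L.a L.b i j u with hS
  have hSt : S.transpose = -S := by ext i j; exact L.sTensor_anti j i u
  have hpd : (L.a u).PosDef := by
    refine Matrix.PosDef.of_dotProduct_mulVec_pos ?_ fun v hv => ?_
    · ext i j; exact L.a_symm u j i
    · have := L.a_pos u hu v hv
      simp only [Matrix.mulVec, dotProduct, star_trivial]
      exact this.trans_eq (Finset.sum_congr rfl fun i _ => mul_comm _ _)
  set A := (L.a u)⁻¹ with hA
  obtain ⟨m, v, hv⟩ := Matrix.posSemidef_iff_eq_sum_vecMulVec.1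
    (hpd.inv.posSemidef.mul_mul_conjTranspose_same S)
  rw [Matrix.conjTranspose_eq_transpose_of_trivial, hSt, ← hA] at hv
  have ht : L.t u = (A * S * (A * S)).trace := by
    have : ∀ i j, L.su i j u = (A * S) i j := fun i j => by
      rw [Matrix.mul_apply]; rfl
    simp only [t, this, Matrix.trace, Matrix.diag, Matrix.mul_apply (M := A * S)]
  have h2 : A * S * (A * S) = -(A * ∑ i, Matrix.vecMulVec (v i) (star (v i))) := by
    rw [← hv]; simp only [Matrix.mul_assoc, Matrix.mul_neg, neg_neg]
  rw [ht, h2, Matrix.trace_neg, Matrix.mul_sum, Matrix.trace_sum, neg_nonpos]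
  refine Finset.sum_nonneg fun i _ => ?_
  rw [Matrix.mul_vecMulVec, Matrix.trace_vecMulVec, dotProduct_comm]
  exact hpd.inv.posSemidef.dotProduct_mulVec_nonneg _

/-- Both metrics are Einstein. -/
structure IsEinstein (σ lam : Coord n → ℝ) : Prop where
  kropina : ∀ u ∈ L.U, ∀ y : Coord n, 0 < ∑ i, L.b u i * y i →
    ricciCurvature L.kropinaF u y = σ u * L.kropinaF u y ^ 2
  alpha : ∀ u ∈ L.U, ∀ y : Coord n, y ≠ 0 →
    ricciCurvature L.alphaF u y = lam u * L.alphaF u y ^ 2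

variable {L} {σ lam : Coord n → ℝ}

theorem ring_conformal (hn : 2 ≤ n) (hE : L.IsEinstein σ lam) (i j : Fin n) :
    L.ring.r i j = L.pull L.c L.c_smooth * L.ring.a i j :=
  smoothRing_ext fun p => L.rTensor_eq hn p.2.1 (hE.kropina _ p.2.1) i j

theorem ring_kappa : L.pull L.kappa L.kappa_smooth * L.ring.B = L.pull L.c L.c_smooth :=
  smoothRing_ext fun p => by
    rw [map_mul, ev_B, ev_pullX, ev_pullX, kappa, mul_assoc,
      inv_mul_cancel₀ (L.bSq_pos p.2.1).ne', mul_one]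

theorem kappa_mul_bSq {u : Coord n} (hu : u ∈ L.U) : L.kappa u * bSq L.a L.b u = L.c u := by
  rw [kappa, mul_assoc, inv_mul_cancel₀ (L.bSq_pos hu).ne', mul_one]

/-- The Einstein equations at a point. -/
theorem einstein_equation (hn : 2 ≤ n) (hE : L.IsEinstein σ lam) (p : L.domain) :
    σ p.1.1 * (ev p L.ring.H * ev p L.ring.βinv) ^ 2 = lam p.1.1 * ev p L.ring.H
      - ev p L.ring.H * ev p L.ring.βinv * (∑ i, ev p (L.ring.ell i) * p.1.2 i)
      - 1 / 4 * (ev p L.ring.H * ev p L.ring.βinv) ^ 2 * L.t p.1.1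
      + ev p L.ring.H * (∑ k, partialDeriv k L.kappa p.1.1 * bUp L.a L.b k p.1.1
        + n * L.kappa p.1.1 * L.c p.1.1)
      + (n - 2) * ((∑ k, partialDeriv k L.kappa p.1.1 * p.1.2 k) * ev p L.ring.β
        + L.kappa p.1.1 ^ 2 * ev p L.ring.β ^ 2) := by
  have h := congrArg (ev p) (L.ring.ricci_G_of_conformal (κ := L.pull L.kappa L.kappa_smooth)
    (pullX_mem _ _) (ring_conformal hn hE) ring_kappa)
  have hy : (p.1.2 : Coord n) ≠ 0 := by
    intro h0
    apply L.ne_zero_of_mem_domain p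
    rw [h0]; rfl
  rw [← L.ricciCurvature_kropinaF, hE.kropina _ p.2.1 _ p.2.2, L.ev_E, KropinaRing.E] at h
  simp only [map_add, map_sub, map_mul, map_pow, map_sum, map_natCast, map_ofNat, Fintype.card_fin,
    ← L.ricciCurvature_alphaF, hE.alpha _ p.2.1 _ hy, L.alphaF_sq, ev_t, KropinaRing.ell0,
    ev_half] at h
  have hX : ∀ k, ev p (L.ring.X k (L.pull L.kappa L.kappa_smooth))
    = partialDeriv k L.kappa p.1.1 := fun k => ev_dX_pullX _ _ _ _
  have hbu : ∀ k, ev p (L.ring.bu k) = bUp L.a L.b k p.1.1 := fun k => rfl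
  have hyy : ∀ k, ev p (L.ring.y k) = p.1.2 k := fun k => rfl
  simp only [hX, hbu, hyy, ev_pullX] at h
  rw [h]; ring

/-- After multiplication by `β²` the Einstein equation reads `(σ + t/4) H² = β (μ H β - H ℓ·y +
(n-2) β² (∂κ·y + κ² β))`, and `einstein_line` compares coefficients. The third relation combines
`ℓ·b = μ B` with `ℓ·b = -t` from `ell_bu`. -/
theorem einstein_consequences (hn : 3 ≤ n) (hE : L.IsEinstein σ lam) {u : Coord n}
    (hu : u ∈ L.U) :
    σ u = -(1 / 4) * L.t u ∧ (∀ k, partialDeriv k L.kappa u = -(L.kappa u ^ 2 * L.b u k)) ∧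
    -L.t u = (lam u + (n - 1) * L.kappa u * L.c u) * bSq L.a L.b u := by
  have hn2 : 2 ≤ n := by omega
  set B := bSq L.a L.b u with hBdef
  have hB : 0 < B := L.bSq_pos hu
  -- `ell i` depends on `x` alone, so one number `l i` serves for all directions `y` over `u`.
  have hell : ∀ i, ∃ g : ℝ, ∀ y (hy : (u, y) ∈ L.domain), ev ⟨(u, y), hy⟩ (L.ring.ell i) = g := by
    intro i
    obtain ⟨g, hg, h⟩ := L.ring.ell_mem i
    exact ⟨g u, fun y hy => by rw [h, ev_pullX]⟩
  choose l hl using hell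
  set m : Fin n → ℝ := fun k => partialDeriv k L.kappa u with hm
  set bu : Fin n → ℝ := fun k => bUp L.a L.b k u with hbu
  set μ := lam u + (∑ k, m k * bu k + n * L.kappa u * L.c u) with hμ
  have hbb : ∑ i, L.b u i * bu i = B := by
    rw [hBdef, bSq]; exact Finset.sum_congr rfl fun i _ => mul_comm _ _
  have hline : ∀ v : Fin n → ℝ, v ≠ 0 → ∑ i, L.b u i * v i = 0 →
      σ u + 1 / 4 * L.t u = 0 ∧ ∑ i, l i * v i = 0 ∧ ∑ i, l i * bu i = μ * B ∧
      ∑ i, m i * v i = 0 ∧ ∑ i, m i * bu i = -(L.kappa u ^ 2 * B) := by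
    intro v hv0 hv
    refine einstein_line (L.bil_pos hu hv0) hB (N := n - 2) ?_ fun s hs => ?_
    · have : (3 : ℝ) ≤ n := by exact_mod_cast hn
      linarith
    set y : Coord n := WithLp.toLp 2 fun i => s * bu i + 1 * v i with hy
    have hlin : ∀ w : Fin n → ℝ, ∑ i, w i * y i = ∑ i, w i * v i + s * ∑ i, w i * bu i := by
      intro w
      rw [Finset.mul_sum, ← Finset.sum_add_distrib]
      exact Finset.sum_congr rfl fun i _ => by rw [hy]; ring
    have hβ : ∑ i, L.b u i * y i = s * B := by rw [hlin, hv, hbb, zero_add]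
    have hmem : (u, y) ∈ L.domain := ⟨hu, by
      change 0 < ∑ i, L.b u i * y i
      rw [hβ]; positivity⟩
    have key := einstein_equation hn2 hE ⟨(u, y), hmem⟩
    have hH : ev ⟨(u, y), hmem⟩ L.ring.H = bil (L.a u) v v + s ^ 2 * B := by
      rw [ev_H]
      have := bil_comb (L.a_symm u) s 1 bu v
      rw [L.bil_bUp_self hu, L.bil_bUp hu v, hv] at this
      exact this.trans (by ring)
    rw [hH, ev_βinv, ev_β] at key
    simp only [hl, hβ] at key
    have e1 : ∑ i, l i * y i = ∑ i, l i * v i + s * ∑ i, l i * bu i := hlin l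
    have e2 : ∑ i, partialDeriv i L.kappa u * y i = ∑ i, m i * v i + s * ∑ i, m i * bu i := hlin m
    rw [e1, e2] at key
    have hsB : s * B ≠ 0 := by positivity
    set h' := bil (L.a u) v v
    have hinv : (s * B)⁻¹ * (s * B) = 1 := inv_mul_cancel₀ hsB
    have hsq : ((s * B)⁻¹) ^ 2 * (s * B) ^ 2 = 1 := by rw [← mul_pow, hinv, one_pow]
    rw [hμ]
    linear_combination (s * B) ^ 2 * key - (σ u + 1 / 4 * L.t u) * (h' + s ^ 2 * B) ^ 2 * hsq
      - (h' + s ^ 2 * B) * (∑ i, l i * v i + s * ∑ i, l i * bu i) * (s * B) * hinv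
  obtain ⟨v, hv0, hv⟩ := exists_orthogonal hn2 (L.b u)
  obtain ⟨h1, -, h3, -, h5⟩ := hline v hv0 hv
  refine ⟨by linarith, fun k => ?_, ?_⟩
  -- `w` is the component of the coordinate vector `e_k` orthogonal to `b`, so `∂κ·w = 0` gives the
  -- `k`-th component of the gradient.
  · set s := L.b u k / B with hs
    set w : Fin n → ℝ := fun i => Pi.single (M := fun _ => ℝ) k 1 i - s * bu i with hw
    have hdot : ∀ q : Fin n → ℝ, ∑ i, q i * w i = q k - s * ∑ i, q i * bu i := by
      intro q
      simp only [hw, mul_sub, Finset.sum_sub_distrib, Finset.mul_sum]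
      congr 1
      · simp [Pi.single_apply]
      · exact Finset.sum_congr rfl fun i _ => by ring
    have hwb : ∑ i, L.b u i * w i = 0 := by
      rw [hdot, hbb, hs]; field_simp; ring
    have hmw : ∑ i, m i * w i = 0 := by
      by_cases hw0 : w = 0
      · simp [hw0]
      · exact (hline w hw0 hwb).2.2.2.1
    rw [hdot, h5] at hmw
    have : m k = -(L.kappa u ^ 2 * (s * B)) := by linarith
    rw [hs, div_mul_cancel₀ _ hB.ne'] at this
    exact this
  · have ht := congrArg (ev (L.base u hu)) (L.ring.ell_bu (ring_conformal hn2 hE))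
    rw [map_neg, ev_t, map_sum] at ht
    have h6 : ∑ i, l i * bu i = -L.t u := by
      refine Eq.trans (Finset.sum_congr rfl fun i _ => ?_) ht
      rw [map_mul, base, hl]; rfl
    rw [← h6, h3, hμ, h5]
    have := kappa_mul_bSq (L := L) hu
    rw [← hBdef] at this
    linear_combination -L.kappa u * B * this

theorem partialDeriv_bSq (hn : 2 ≤ n) (hE : L.IsEinstein σ lam) {u : Coord n} (hu : u ∈ L.U)
    (k : Fin n) : partialDeriv k (bSq L.a L.b) u = 2 * (L.c u * L.b u k) := by
  have h := congrArg (ev (L.base u hu)) (L.ring.X_B (ring_conformal hn hE) k)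
  have hB : L.ring.B = L.pull (bSq L.a L.b) L.bSq_smooth := smoothRing_ext fun p => L.ev_B p
  rw [hB] at h
  have h2 : ev (L.base u hu) (L.ring.X k (L.pull (bSq L.a L.b) L.bSq_smooth))
    = partialDeriv k (bSq L.a L.b) u := ev_dX_pullX _ _ _ _
  rw [h2] at h
  rw [h, map_mul, map_mul, map_ofNat]
  rfl

theorem kappa_sq_mul_sTensor (hn : 3 ≤ n) (hE : L.IsEinstein σ lam) {u : Coord n} (hu : u ∈ L.U)
    (i j : Fin n) : L.kappa u ^ 2 * sTensor L.a L.b i j u = 0 := by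
  have h := congrArg (ev (L.base u hu)) (L.ring.sq_mul_s_eq_zero
    (κ := L.pull L.kappa L.kappa_smooth) (fun k => smoothRing_ext fun p => ?_)
    (fun j k => dirDeriv_comm _ _ _) i j)
  · rw [map_mul, map_pow, map_zero] at h
    exact h
  · refine (ev_dX_pullX _ _ k p).trans ?_
    rw [(einstein_consequences hn hE p.2.1).2.1 k, map_neg, map_mul, map_pow]
    rfl

theorem rTensor_eq_zero (hn : 2 ≤ n) (hE : L.IsEinstein σ lam) {u : Coord n} (hu : u ∈ L.U)
    (hκ : L.kappa u = 0) (i j : Fin n) : rTensor L.a L.b i j u = 0 := by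
  rw [L.rTensor_eq hn hu (hE.kropina u hu), ← kappa_mul_bSq hu, hκ, zero_mul, zero_mul]

end LocalKropina

/-! ### Zeros of solutions of the gradient equation `∂f = -f² b`. -/

section Riccati

variable {n : ℕ}

theorem clm_eq_sum (l : Coord n →L[ℝ] ℝ) (v : Coord n) :
    l v = ∑ k, v k * l (EuclideanSpace.single k 1) := by
  conv_lhs => rw [← (EuclideanSpace.basisFun (Fin n) ℝ).sum_repr v]
  simp [map_sum]

theorem fderiv_apply_eq_sum (f : Coord n → ℝ) (u v : Coord n) :
    fderiv ℝ f u v = ∑ k, v k * partialDeriv k f u := clm_eq_sum _ v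

/-- A function with gradient `-f² b` vanishes near each of its zeros. -/
theorem eventually_eq_zero_of_gradient {U : Set (Coord n)} (hU : IsOpen U) {f : Coord n → ℝ}
    {b : Coord n → Fin n → ℝ} (hf : ContDiffOn ℝ ∞ f U)
    (hb : ∀ i, ContinuousOn (fun u => b u i) U)
    (h : ∀ u ∈ U, ∀ k, partialDeriv k f u = -(f u ^ 2 * b u k)) {u : Coord n} (hu : u ∈ U)
    (h0 : f u = 0) : ∀ᶠ v in nhds u, f v = 0 := by
  have hc : ContinuousAt (fun v => |f v| * ∑ k, |b v k|) u := by
    refine ContinuousOn.continuousAt (s := U) ?_ (hU.mem_nhds hu)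
    exact hf.continuousOn.abs.mul (continuousOn_finsetSum _ fun k _ => (hb k).abs)
  -- Near a zero of `f` the bound `|f| ∑ |b_k| < 1` makes the quadratic equation a linear
  -- differential inequality `|g'| ≤ ‖w‖ |g|` along segments, to which Gronwall's lemma applies.
  have hev : ∀ᶠ v in nhds u, v ∈ U ∧ |f v| * ∑ k, |b v k| < 1 := by
    refine (hU.eventually_mem hu).and (hc.eventually_lt_const ?_)
    simp [h0]
  obtain ⟨ε, hε, hball⟩ := Metric.eventually_nhds_iff_ball.1 hev
  refine Metric.eventually_nhds_iff_ball.2 ⟨ε, hε, fun v hv => ?_⟩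
  set w := v - u with hw
  have hmem : ∀ t ∈ Set.Icc (0 : ℝ) 1, u + t • w ∈ Metric.ball u ε := by
    intro t ht
    rw [Metric.mem_ball, dist_eq_norm, add_sub_cancel_left, norm_smul, Real.norm_eq_abs,
      abs_of_nonneg ht.1]
    rw [Metric.mem_ball, dist_eq_norm] at hv
    calc t * ‖w‖ ≤ 1 * ‖w‖ := by gcongr; exact ht.2
      _ < ε := by rw [one_mul]; exact hv
  have hderiv : ∀ t ∈ Set.Icc (0 : ℝ) 1,
      HasDerivAt (fun t : ℝ => f (u + t • w)) (fderiv ℝ f (u + t • w) w) t := by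
    intro t ht
    have hd : DifferentiableAt ℝ f (u + t • w) :=
      (hf.contDiffAt (hU.mem_nhds (hball _ (hmem t ht)).1)).differentiableAt (by simp)
    have hl : HasDerivAt (fun t : ℝ => u + t • w) w t := by
      simpa using ((hasDerivAt_id t).smul_const w).const_add u
    exact hd.hasFDerivAt.comp_hasDerivAt t hl
  have hbound : ∀ t ∈ Set.Icc (0 : ℝ) 1,
      ‖fderiv ℝ f (u + t • w) w‖ ≤ ‖w‖ * ‖f (u + t • w)‖ := by
    intro t ht
    obtain ⟨hmU, hlt⟩ := hball _ (hmem t ht)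
    set x := u + t • w
    have e : fderiv ℝ f x w = -(f x ^ 2 * ∑ k, w k * b x k) := by
      rw [fderiv_apply_eq_sum, Finset.mul_sum, ← Finset.sum_neg_distrib]
      exact Finset.sum_congr rfl fun k _ => by rw [h x hmU]; ring
    have hs : |∑ k, w k * b x k| ≤ ‖w‖ * ∑ k, |b x k| := by
      refine (Finset.abs_sum_le_sum_abs _ _).trans ?_
      rw [Finset.mul_sum]
      refine Finset.sum_le_sum fun k _ => ?_
      rw [abs_mul]
      exact mul_le_mul_of_nonneg_right (PiLp.norm_apply_le w k) (abs_nonneg _)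
    rw [e, norm_neg, Real.norm_eq_abs, Real.norm_eq_abs, abs_mul, abs_pow]
    calc |f x| ^ 2 * |∑ k, w k * b x k| ≤ |f x| ^ 2 * (‖w‖ * ∑ k, |b x k|) := by gcongr
      _ = ‖w‖ * |f x| * (|f x| * ∑ k, |b x k|) := by ring
      _ ≤ ‖w‖ * |f x| * 1 := by gcongr
      _ = ‖w‖ * |f x| := mul_one _
  have := eq_zero_of_abs_deriv_le_mul_abs_self_of_eq_zero_right (a := 0) (b := 1)
    (f := fun t : ℝ => f (u + t • w)) (fun t ht => (hderiv t ht).continuousAt.continuousWithinAt)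
    (fun t ht => (hderiv t (Set.Ico_subset_Icc_self ht)).hasDerivWithinAt) (by simpa using h0)
    (fun t ht => hbound t (Set.Ico_subset_Icc_self ht)) 1 (by simp)
  simpa [hw] using this

end Riccati

/-! ### Zeros of `κ` in terms of the length of `β`. -/

namespace LocalKropina

variable {n : ℕ} {L : LocalKropina n} {σ lam : Coord n → ℝ}

/-- `κ` vanishes exactly where `b²` is locally constant. -/
theorem kappa_eq_zero_iff (hn : 3 ≤ n) (hE : L.IsEinstein σ lam) {u : Coord n} (hu : u ∈ L.U) :
    L.kappa u = 0 ↔ ∀ᶠ v in nhds u, bSq L.a L.b v = bSq L.a L.b u := by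
  constructor
  · intro h
    have h1 := eventually_eq_zero_of_gradient L.isOpen L.kappa_smooth
      (fun i => (L.b_smooth i).continuousOn)
      (fun u hu => (einstein_consequences hn hE hu).2.1) hu h
    obtain ⟨ε, hε, hball⟩ := Metric.eventually_nhds_iff_ball.1 ((L.isOpen.eventually_mem hu).and h1)
    refine Metric.eventually_nhds_iff_ball.2 ⟨ε, hε, fun v hv => ?_⟩
    refine Metric.isOpen_ball.is_const_of_fderiv_eq_zero (𝕜 := ℝ) (s := Metric.ball u ε)
      (convex_ball u ε).isPreconnected (fun w hw => ?_) (fun w hw => ?_) hv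
      (Metric.mem_ball_self hε)
    · exact ((L.bSq_smooth.contDiffAt (L.isOpen.mem_nhds (hball w hw).1)).differentiableAt
        (by simp)).differentiableWithinAt
    · ext z
      rw [fderiv_apply_eq_sum]
      refine Finset.sum_eq_zero fun k _ => ?_
      -- The gradient of `b²` is `2 κ b² b_k`, which vanishes where `κ` does.
      rw [partialDeriv_bSq (by omega) hE (hball w hw).1, ← kappa_mul_bSq (hball w hw).1,
        (hball w hw).2]
      ring
  · intro h
    have hd : ∀ k, partialDeriv k (bSq L.a L.b) u = 0 := by
      intro k
      rw [partialDeriv, Filter.EventuallyEq.fderiv_eq (f₁ := bSq L.a L.b)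
        (f := fun _ => bSq L.a L.b u) h]
      simp
    obtain ⟨k, hk⟩ := Function.ne_iff.1 (L.b_ne u hu)
    have h2 := hd k
    rw [partialDeriv_bSq (by omega) hE hu] at h2
    have hc : L.c u = 0 := by
      have hk' : L.b u k ≠ 0 := hk
      simpa [hk'] using h2
    rw [kappa, hc, zero_mul]

theorem kappa_eq_zero_of_rTensor {u : Coord n} (hr : ∀ i j, rTensor L.a L.b i j u = 0) :
    L.kappa u = 0 := by
  simp [kappa, c, hr]

theorem t_eq_zero_of_sTensor {u : Coord n} (hs : ∀ i j, sTensor L.a L.b i j u = 0) :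
    L.t u = 0 := by
  simp [t, su, hs]

end LocalKropina

/-! ### From the manifold to charts. -/

section Charts

variable {n : ℕ} {M : Type*} [TopologicalSpace M] [ChartedSpace (Coord n) M]

theorem coordVector_bijective {e : OpenPartialHomeomorph M (Coord n)}
    (he : e ∈ IsManifold.maximalAtlas (𝓡 n) ∞ M) {u : Coord n} (hu : u ∈ e.target) :
    Function.Bijective (coordVector e u) := by
  have h : e.MDifferentiable (𝓡 n) (𝓡 n) :=
    ⟨(contMDiffOn_of_mem_maximalAtlas he).mdifferentiableOn (by simp),
      (contMDiffOn_symm_of_mem_maximalAtlas he).mdifferentiableOn (by simp)⟩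
  exact h.symm.mfderiv_bijective hu

theorem coordVector_eq_sum (e : OpenPartialHomeomorph M (Coord n)) (u y : Coord n) :
    coordVector e u y = ∑ i, y i • coordVector e u (EuclideanSpace.single i 1) := by
  have key : ∀ (T : Type) [AddCommGroup T] [Module ℝ T] (f : Coord n →ₗ[ℝ] T),
      f y = ∑ i, y i • f (EuclideanSpace.single i 1) := by
    intro T _ _ f
    conv_lhs => rw [← (EuclideanSpace.basisFun (Fin n) ℝ).sum_repr y]
    simp [map_sum]
  exact key (TangentSpace (𝓡 n) (e.symm u)) (mfderiv (𝓡 n) (𝓡 n) e.symm u).toLinearMap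

theorem form_coordVector (β : (x : M) → TangentSpace (𝓡 n) x →L[ℝ] ℝ)
    (e : OpenPartialHomeomorph M (Coord n)) (u y : Coord n) :
    β (e.symm u) (coordVector e u y) = ∑ i, formCoeff β e u i * y i := by
  rw [coordVector_eq_sum, map_sum]
  exact Finset.sum_congr rfl fun i _ => by rw [map_smul, smul_eq_mul, mul_comm]; rfl

variable [IsManifold (𝓡 n) ∞ M]

theorem contMDiffOn_coordVector {e : OpenPartialHomeomorph M (Coord n)}
    (he : e ∈ IsManifold.maximalAtlas (𝓡 n) ∞ M) (v : Coord n) :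
    ContMDiffOn (𝓡 n) ((𝓡 n).prod (𝓡 n)) ∞
      (fun u => (Bundle.TotalSpace.mk' (Coord n) (e.symm u) (coordVector e u v) :
        TangentBundle (𝓡 n) M)) e.target := by
  have h1 := (contMDiffOn_symm_of_mem_maximalAtlas he).contMDiffOn_tangentMapWithin (m := ∞)
    (by simp) e.open_target.uniqueMDiffOn
  have h2 : ContMDiffOn (𝓡 n) ((𝓡 n).prod (𝓡 n)) ∞
      (fun u : Coord n => (Bundle.TotalSpace.mk' (Coord n) u v : TangentBundle (𝓡 n) (Coord n)))
      e.target := contMDiffOn_vectorSpace_iff_contDiffOn.2 contDiffOn_const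
  refine (h1.comp h2 fun u hu => hu).congr fun u hu => ?_
  simp only [Function.comp_def, tangentMapWithin]
  rw [mfderivWithin_of_isOpen e.open_target hu]
  rfl

theorem metricCoeff_smooth (a : Metric n M) {e : OpenPartialHomeomorph M (Coord n)}
    (he : e ∈ IsManifold.maximalAtlas (𝓡 n) ∞ M) (i j : Fin n) :
    ContDiffOn ℝ ∞ (fun u => metricCoeff a e u i j) e.target := by
  rw [← contMDiffOn_iff_contDiffOn]
  intro u hu
  have h := ContMDiffWithinAt.clm_bundle_apply₂ (F₁ := Coord n) (F₂ := Coord n)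
    (E₁ := fun x : M => TangentSpace (𝓡 n) x) (E₂ := fun x : M => TangentSpace (𝓡 n) x)
    (F₃ := ℝ) (E₃ := Bundle.Trivial M ℝ) (b := e.symm) (ψ := fun u => a.inner (e.symm u))
    (ContMDiffAt.comp_contMDiffWithinAt u a.contMDiff.contMDiffAt
      (contMDiffOn_symm_of_mem_maximalAtlas he u hu))
    (contMDiffOn_coordVector he (EuclideanSpace.single i 1) u hu)
    (contMDiffOn_coordVector he (EuclideanSpace.single j 1) u hu)
  simp only [Bundle.contMDiffWithinAt_totalSpace] at h
  exact h.2

theorem formCoeff_smooth {β : (x : M) → TangentSpace (𝓡 n) x →L[ℝ] ℝ} (hβ : IsSmoothOneForm β)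
    {e : OpenPartialHomeomorph M (Coord n)}
    (he : e ∈ IsManifold.maximalAtlas (𝓡 n) ∞ M) (i : Fin n) :
    ContDiffOn ℝ ∞ (fun u => formCoeff β e u i) e.target := by
  rw [← contMDiffOn_iff_contDiffOn]
  intro u hu
  have h := ContMDiffWithinAt.clm_bundle_apply (F₁ := Coord n)
    (E₁ := fun x : M => TangentSpace (𝓡 n) x)
    (F₂ := ℝ) (E₂ := Bundle.Trivial M ℝ) (b := e.symm) (ϕ := fun u => β (e.symm u))
    (ContMDiffAt.comp_contMDiffWithinAt u (ContMDiff.contMDiffAt hβ)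
      (contMDiffOn_symm_of_mem_maximalAtlas he u hu))
    (contMDiffOn_coordVector he (EuclideanSpace.single i 1) u hu)
  simp only [Bundle.contMDiffWithinAt_totalSpace] at h
  exact h.2

theorem metricCoeff_symm (a : Metric n M) (e : OpenPartialHomeomorph M (Coord n)) (u : Coord n)
    (i j : Fin n) : metricCoeff a e u i j = metricCoeff a e u j i := a.symm _ _ _

theorem inner_coordVector (a : Metric n M) (e : OpenPartialHomeomorph M (Coord n))
    (u y z : Coord n) : a.inner (e.symm u) (coordVector e u y) (coordVector e u z)
      = bil (metricCoeff a e u) y z := by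
  rw [coordVector_eq_sum e u z, map_sum]
  change _ = ∑ i, (∑ j, metricCoeff a e u i j * y j) * z i
  refine Finset.sum_congr rfl fun i _ => ?_
  rw [map_smul, smul_eq_mul, mul_comm]
  congr 1
  rw [a.symm, coordVector_eq_sum e u y, map_sum]
  exact Finset.sum_congr rfl fun j _ => by rw [map_smul, smul_eq_mul, mul_comm]; rfl

theorem inner_self_nonneg' (a : Metric n M) (x : M) (v : TangentSpace (𝓡 n) x) :
    0 ≤ a.inner x v v := by
  by_cases h : v = 0
  · simp [h]
  · exact (a.pos x v h).le

/-- A metric and a nowhere vanishing 1-form with `s_j = 0`, in a chart. -/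
def chartKropina (a : Metric n M) {β : (x : M) → TangentSpace (𝓡 n) x →L[ℝ] ℝ}
    (hβ : IsSmoothOneForm β) (hβ0 : ∀ x, β x ≠ 0) (hs : SFormVanishes a β)
    {e : OpenPartialHomeomorph M (Coord n)} (he : e ∈ IsManifold.maximalAtlas (𝓡 n) ∞ M) :
    LocalKropina n where
  U := e.target
  isOpen := e.open_target
  a := metricCoeff a e
  b := formCoeff β e
  a_smooth := metricCoeff_smooth a he
  b_smooth := formCoeff_smooth hβ he
  a_symm := metricCoeff_symm a e
  a_pos u hu v hv := by
    have h := inner_coordVector a e u (WithLp.toLp 2 v) (WithLp.toLp 2 v)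
    refine lt_of_lt_of_eq (a.pos _ _ fun h0 => hv ?_) h
    have h1 : coordVector e u 0 = 0 := by unfold coordVector; exact map_zero _
    have := (coordVector_bijective he hu).1 (h0.trans h1.symm)
    exact congrArg WithLp.ofLp this
  b_ne u hu h0 := by
    apply hβ0 (e.symm u)
    ext w
    obtain ⟨y, rfl⟩ := (coordVector_bijective he hu).2 w
    rw [form_coordVector, h0]
    simp
  s_form := hs e he

section

variable (a : Metric n M) {β : (x : M) → TangentSpace (𝓡 n) x →L[ℝ] ℝ}

theorem inChart_kropina
    (hβ : IsSmoothOneForm β) (hβ0 : ∀ x, β x ≠ 0) (hs : SFormVanishes a β)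
    {e : OpenPartialHomeomorph M (Coord n)} (he : e ∈ IsManifold.maximalAtlas (𝓡 n) ∞ M) :
    inChart (kropina a β) e = (chartKropina a hβ hβ0 hs he).kropinaF := by
  ext u y
  rw [inChart, kropina, alpha, Real.sq_sqrt (inner_self_nonneg' a _ _), inner_coordVector,
    form_coordVector]
  rfl

theorem inChart_alpha
    (hβ : IsSmoothOneForm β) (hβ0 : ∀ x, β x ≠ 0) (hs : SFormVanishes a β)
    {e : OpenPartialHomeomorph M (Coord n)} (he : e ∈ IsManifold.maximalAtlas (𝓡 n) ∞ M) :
    inChart (alpha a) e = (chartKropina a hβ hβ0 hs he).alphaF := by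
  ext u y
  rw [inChart, alpha, inner_coordVector]
  rfl

theorem chartKropina_isEinstein
    (hβ : IsSmoothOneForm β) (hβ0 : ∀ x, β x ≠ 0) (hs : SFormVanishes a β)
    {e : OpenPartialHomeomorph M (Coord n)} (he : e ∈ IsManifold.maximalAtlas (𝓡 n) ∞ M)
    {σ lam : M → ℝ}
    (hF : IsEinsteinWith (kropina a β) (positiveDomain β) σ)
    (hα : IsEinsteinWith (alpha a) (slitDomain n M) lam) :
    (chartKropina a hβ hβ0 hs he).IsEinstein (fun u => σ (e.symm u)) (fun u => lam (e.symm u)) where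
  kropina u hu y hy := by
    have := hF e he u hu y (by
      change 0 < β (e.symm u) (coordVector e u y)
      rw [form_coordVector]; exact hy)
    rwa [inChart_kropina a hβ hβ0 hs he] at this
  alpha u hu y hy := by
    have := hα e he u hu y (by
      intro h0
      have h1 : coordVector e u 0 = 0 := by unfold coordVector; exact map_zero _
      exact hy ((coordVector_bijective he hu).1 (h0.trans h1.symm)))
    rwa [inChart_alpha a hβ hβ0 hs he] at this

/-- Describes `bⁱ` without coordinates, as the vector dual to `β` under the metric. Two charts then
yield the same `b²`. -/
theorem exists_dual
    (hβ : IsSmoothOneForm β) (hβ0 : ∀ x, β x ≠ 0) (hs : SFormVanishes a β)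
    {e : OpenPartialHomeomorph M (Coord n)} (he : e ∈ IsManifold.maximalAtlas (𝓡 n) ∞ M)
    {u : Coord n} (hu : u ∈ e.target) :
    ∃ w : TangentSpace (𝓡 n) (e.symm u), (∀ v, a.inner (e.symm u) w v = β (e.symm u) v) ∧
      β (e.symm u) w = bSq (metricCoeff a e) (formCoeff β e) u := by
  set L := chartKropina a hβ hβ0 hs he
  refine ⟨coordVector e u (WithLp.toLp 2 fun i => bUp (metricCoeff a e) (formCoeff β e) i u),
    fun v => ?_, ?_⟩
  · obtain ⟨y, rfl⟩ := (coordVector_bijective he hu).2 v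
    rw [inner_coordVector, form_coordVector]
    exact L.bil_bUp hu y
  · rw [form_coordVector, bSq]
    exact Finset.sum_congr rfl fun i _ => mul_comm _ _

/-- The squared length in an arbitrary chart. -/
theorem lengthSq_symm
    (hβ : IsSmoothOneForm β) (hβ0 : ∀ x, β x ≠ 0) (hs : SFormVanishes a β)
    {e : OpenPartialHomeomorph M (Coord n)} (he : e ∈ IsManifold.maximalAtlas (𝓡 n) ∞ M)
    {u : Coord n} (hu : u ∈ e.target) :
    lengthSq a β (e.symm u) = bSq (metricCoeff a e) (formCoeff β e) u := by
  set x := e.symm u with hx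
  have hmem := IsManifold.chart_mem_maximalAtlas (I := 𝓡 n) (n := ∞) x
  obtain ⟨w, hw, hw'⟩ := exists_dual a hβ hβ0 hs he hu
  obtain ⟨w', hv, hv'⟩ := exists_dual a hβ hβ0 hs hmem
    ((chartAt (Coord n) x).map_source (mem_chart_source _ x))
  rw [lengthSq, ← hv', ← hw']
  have hxx : (chartAt (Coord n) x).symm (chartAt (Coord n) x x) = x :=
    (chartAt (Coord n) x).left_inv (mem_chart_source _ x)
  clear hv'  hw'
  -- `w'` is tangent at a point that equals `x` through `hxx`. Once both vectors are tangent at `x`,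
  -- `β w = ⟨w', w⟩ = ⟨w, w'⟩ = β w'`.
  revert w'
  rw [hxx]
  intro w' hv
  rw [← hv w, ← hw w']
  exact a.symm _ _ _

end

end Charts

end

end KropinaGeometry

/-! ### The dichotomy, by connectedness, and the value of the Einstein scalar. -/

open KropinaGeometry in
theorem corollary3p1 {n : ℕ} (hn : 3 ≤ n)
    {M : Type*} [TopologicalSpace M] [T2Space M] [SecondCountableTopology M] [ConnectedSpace M]
    [ChartedSpace (Coord n) M] [IsManifold (𝓡 n) ∞ M]
    (a : Metric n M)
    (β : (x : M) → TangentSpace (𝓡 n) x →L[ℝ] ℝ) (hβ : IsSmoothOneForm β)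
    (hβ0 : ∀ x, β x ≠ 0)
    (hs : SFormVanishes a β)
    (σ lam : M → ℝ)
    (hF : IsEinsteinWith (kropina a β) (positiveDomain β) σ)
    (hα : IsEinsteinWith (alpha a) (slitDomain n M) lam) :
    (IsConstantKilling a β ∨ IsClosedForm a β) ∧
    (IsConstantKilling a β → ∀ x, σ x = 1 / 4 * lam x * lengthSq a β x ∧ 0 ≤ σ x) ∧
    (IsClosedForm a β → (∀ x, σ x = 0) ∧ IsRicciFlat (kropina a β) (positiveDomain β)) := by
  have hE := fun (e : OpenPartialHomeomorph M (Coord n))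
    (he : e ∈ IsManifold.maximalAtlas (𝓡 n) ∞ M) => chartKropina_isEinstein a hβ hβ0 hs he hF hα
  have hchart := fun x : M => IsManifold.chart_mem_maximalAtlas (I := 𝓡 n) (n := ∞) x
  have htarget := fun x : M => (chartAt (Coord n) x).map_source (mem_chart_source _ x)
  have hleft := fun x : M => (chartAt (Coord n) x).left_inv (mem_chart_source _ x)
  refine ⟨?_, fun hK x => ?_, fun hcl => ?_⟩
  -- `κ` is defined chart by chart, so its zero set is described by local constancy of `b²`, which
  -- makes sense on `M`. Openness of `Z` is then formal; the Riccati argument enters through `hiff`.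
  · set Z : Set M := {x | ∀ᶠ x' in nhds x, lengthSq a β x' = lengthSq a β x} with hZ
    have hiff : ∀ (e : OpenPartialHomeomorph M (Coord n))
        (he : e ∈ IsManifold.maximalAtlas (𝓡 n) ∞ M) (u : Coord n), u ∈ e.target →
        ((chartKropina a hβ hβ0 hs he).kappa u = 0 ↔ e.symm u ∈ Z) := by
      intro e he u hu
      have hux : e.symm u ∈ e.source := e.map_target hu
      rw [LocalKropina.kappa_eq_zero_iff hn (hE e he) hu]
      constructor
      · intro h
        have hcont := e.continuousAt hux
        rw [ContinuousAt, e.right_inv hu] at hcont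
        filter_upwards [hcont.eventually h, e.open_source.mem_nhds hux] with x hx hxs
        rw [lengthSq_symm a hβ hβ0 hs he hu, ← e.left_inv hxs,
          lengthSq_symm a hβ hβ0 hs he (e.map_source hxs)]
        exact hx
      · intro h
        have hcont := e.continuousAt_symm hu
        filter_upwards [hcont.eventually h, e.open_target.mem_nhds hu] with v hv hvt
        rw [lengthSq_symm a hβ hβ0 hs he hu, lengthSq_symm a hβ hβ0 hs he hvt] at hv
        exact hv
    have hopen : IsOpen Z := by
      rw [isOpen_iff_mem_nhds]
      intro x hx
      have hx' : ∀ᶠ x' in nhds x, lengthSq a β x' = lengthSq a β x := hx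
      filter_upwards [hx'.eventually_nhds] with y hy
      filter_upwards [hy] with z hz
      rw [hz, hy.self_of_nhds]
    -- In a chart the complement of `Z` is the set where the continuous function `κ` is nonzero.
    have hclosed : IsClosed Z := by
      rw [← isOpen_compl_iff, isOpen_iff_mem_nhds]
      intro x hx
      set e := chartAt (Coord n) x
      have hne : (chartKropina a hβ hβ0 hs (hchart x)).kappa (e x) ≠ 0 := by
        rw [Ne, hiff e (hchart x) _ (htarget x), hleft x]
        exact hx
      have hc : ContinuousAt (chartKropina a hβ hβ0 hs (hchart x)).kappa (e x) :=
        (LocalKropina.kappa_smooth _).continuousOn.continuousAt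
          (e.open_target.mem_nhds (htarget x))
      filter_upwards [(e.continuousAt (mem_chart_source _ x)).eventually (hc.eventually_ne hne),
        e.open_source.mem_nhds (mem_chart_source _ x)] with y hy hys
      have := (hiff e (hchart x) _ (e.map_source hys)).not.1 hy
      rwa [e.left_inv hys] at this
    rcases isClopen_iff.1 ⟨hclosed, hopen⟩ with h | h
    · right
      intro e he u hu i j
      have hκ : (chartKropina a hβ hβ0 hs he).kappa u ≠ 0 := by
        rw [Ne, hiff e he u hu, h]
        exact Set.notMem_empty _
      exact (mul_eq_zero.1 (LocalKropina.kappa_sq_mul_sTensor hn (hE e he) hu i j)).resolve_left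
        (pow_ne_zero 2 hκ)
    · left
      have hall : ∀ x, x ∈ Z := fun x => h ▸ Set.mem_univ x
      refine ⟨fun e he u hu i j => ?_, ?_⟩
      · exact LocalKropina.rTensor_eq_zero (by omega) (hE e he) hu
          ((hiff e he u hu).2 (hall _)) i j
      · have hloc : IsLocallyConstant (lengthSq a β) :=
          (IsLocallyConstant.iff_eventually_eq _).2 hall
        obtain ⟨x0⟩ := (inferInstance : Nonempty M)
        exact ⟨lengthSq a β x0, fun x => hloc.apply_eq_of_preconnectedSpace x x0⟩
  -- With `κ = 0` the third relation becomes `-t = λ b²`; together with `σ = -t/4` and `t ≤ 0` it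
  -- gives both claims.
  · have hκ := LocalKropina.kappa_eq_zero_of_rTensor
      (L := chartKropina a hβ hβ0 hs (hchart x)) (hK.1 _ (hchart x) _ (htarget x))
    obtain ⟨h1, -, h3⟩ := LocalKropina.einstein_consequences hn (hE _ (hchart x)) (htarget x)
    have ht := LocalKropina.t_nonpos (chartKropina a hβ hβ0 hs (hchart x)) (htarget x)
    rw [hκ] at h3
    have hl : bSq (chartKropina a hβ hβ0 hs (hchart x)).a (chartKropina a hβ hβ0 hs (hchart x)).b
      (chartAt (Coord n) x x) = lengthSq a β x := rfl
    rw [hl] at h3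
    simp only [hleft x] at h1 h3
    exact ⟨by linarith, by linarith⟩
  · have hσ : ∀ x, σ x = 0 := by
      intro x
      have ht := LocalKropina.t_eq_zero_of_sTensor
        (L := chartKropina a hβ hβ0 hs (hchart x)) (hcl _ (hchart x) _ (htarget x))
      have h1 := (LocalKropina.einstein_consequences hn (hE _ (hchart x)) (htarget x)).1
      rw [ht] at h1
      simp only [hleft x] at h1
      rw [h1, mul_zero]
    exact ⟨hσ, fun e he u hu y hy => by rw [hF e he u hu y hy, hσ, zero_mul]⟩
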